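/- Proposition 4.2 (Nonexistence of Minimizers). Let $0<\alpha\le\frac12$. For Lebesgue measurable $F\subset\mathbb R^2$ let $$E(F)=P(F)+V(F),\qquad P(F)=\sup\Big\{\int_F\nabla\cdot\phi\,dx:\ \phi\in C^1_c(\mathbb R^2;\mathbb R^2),\ |\phi|\le1\Big\},\qquad V(F)=\int_F\int_F\frac{dx\,dy}{|x-y|^\alpha},$$ with values in $[0,\infty]$. A minimizer of $E$ with mass $m$ is a Lebesgue measurable set $\Omega\subset\mathbb R^2$ with $|\Omega|=m$ and $E(\Omega)\le E(G)$ for all Lebesgue measurable $G\subset\mathbb R^2$ with $|G|=m$. Put $$m_{c1}(\alpha)=\pi\left(\frac{(\sqrt2-1)\,\Gamma(2-\frac\alpha2)\,\Gamma(3-\frac\alpha2)}{\pi\,(1-2^{\frac{\alpha-2}{2}})\,\Gamma(2-\alpha)}\right)^{\frac2{3-\alpha}},\qquad R_{c1}=\sqrt{m_{c1}(\alpha)/\pi},\qquad V_0=V(B_1(0)),$$ $$\rho_{c1}=\frac{2\pi R_{c1}+V_0R_{c1}^{4-\alpha}}{\pi R_{c1}^2},\qquad \rho_0(R)=\frac2R+\frac{2^\alpha\pi^{1-\alpha}}{\rho_{c1}^\alpha}R^{2-2\alpha}\quad(R>0).$$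 The formula for $m_{c1}$ is also used at $\alpha=0$. Then: 1. There is a unique $R_0=R_0(\alpha)\ge R_{c1}$ with $\rho_0(R_0)=\rho_{c1}$. Put $m_2(\alpha)=\pi R_0(\alpha)^2$. 2. For every $m>m_2(\alpha)$ there is no minimizer of $E$ with mass $m$. 3. $m_2(\alpha)\to m_{c1}(0)$ as $\alpha\to0^+$. -/

import Mathlib

open MeasureTheory Filter Topology Set
open scoped ENNReal

noncomputable section

namespace NonlocalIsoperimetric

/-- The Euclidean plane. -/
abbrev Plane : Type := EuclideanSpace ℝ (Fin 2)

/-- The divergence of a (differentiable) vector field on the plane. -/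
def divergence (φ : Plane → Plane) (x : Plane) : ℝ :=
  ∑ i : Fin 2, (fderiv ℝ φ x (EuclideanSpace.single i 1)) i

/-- Admissible fields in the definition of the perimeter: `φ ∈ C¹_c(ℝ²; ℝ²)` with `|φ| ≤ 1`
(Euclidean norm). -/
def IsTestField (φ : Plane → Plane) : Prop :=
  ContDiff ℝ 1 φ ∧ HasCompactSupport φ ∧ ∀ x, ‖φ x‖ ≤ 1

/-- De Giorgi perimeter, with values in `[0, ∞]`. Replacing negative numbers by `0` does not
change the supremum, since `φ = 0` is admissible. -/
def perimeter (F : Set Plane) : ℝ≥0∞ :=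
  ⨆ (φ : Plane → Plane) (_ : IsTestField φ), ENNReal.ofReal (∫ x in F, divergence φ x)

/-- The repulsive interaction `V(F) = ∫_F ∫_F |x - y|^{-α} dx dy`, with values in `[0, ∞]`. -/
def interaction (α : ℝ) (F : Set Plane) : ℝ≥0∞ :=
  ∫⁻ x in F, ∫⁻ y in F, (edist x y ^ α)⁻¹

/-- The energy `E = P + V`. -/
def energy (α : ℝ) (F : Set Plane) : ℝ≥0∞ :=
  perimeter F + interaction α F

/-- `F` is a minimizer of `E` with mass `m`: it minimizes `E` among all Lebesgue measurable sets
(`NullMeasurableSet` for the Lebesgue measure) of Lebesgue measure `m`. -/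
def IsMinimizer (α m : ℝ) (F : Set Plane) : Prop :=
  NullMeasurableSet F volume ∧ volume F = ENNReal.ofReal m ∧
    ∀ G : Set Plane, NullMeasurableSet G volume → volume G = ENNReal.ofReal m →
      energy α F ≤ energy α G

/-- The explicit critical mass `m_{c1}(α)`. -/
def mc1 (α : ℝ) : ℝ :=
  Real.pi * (((√2 - 1) * Real.Gamma (2 - α / 2) * Real.Gamma (3 - α / 2)) /
    (Real.pi * (1 - (2 : ℝ) ^ ((α - 2) / 2)) * Real.Gamma (2 - α))) ^ (2 / (3 - α))

/-- `R_{c1} = √(m_{c1} / π)`. -/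
def Rc1 (α : ℝ) : ℝ := √(mc1 α / Real.pi)

/-- `V₀(α) = V(B₁(0))`, a finite number for `0 < α < 2`. -/
def V0 (α : ℝ) : ℝ := (interaction α (Metric.ball 0 1)).toReal

/-- `E₁(R) = 2πR + V₀ R^{4-α}`, the energy of one disk of radius `R`. -/
def E1 (α R : ℝ) : ℝ := 2 * Real.pi * R + V0 α * R ^ (4 - α)

/-- `ρ_{c1} = E₁(R_{c1}) / (π R_{c1}²)`. -/
def rhoc1 (α : ℝ) : ℝ := E1 α (Rc1 α) / (Real.pi * Rc1 α ^ 2)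

/-- `ρ₀(R) = 2/R + 2^α π^{1-α} ρ_{c1}^{-α} R^{2-2α}`. -/
def rho0 (α R : ℝ) : ℝ :=
  2 / R + (2 : ℝ) ^ α * Real.pi ^ (1 - α) / rhoc1 α ^ α * R ^ (2 - 2 * α)

end NonlocalIsoperimetric

end

/-! The energy per unit mass of a hypothetical minimizer of mass m = πR² is bounded above by ρ_{c1}
and below by ρ₀(R). Beyond the root R₀ these bounds contradict each other.

Upper bound (`IsMinimizer.energy_le`). For m ≥ m_{c1}, cut the mass into N = ⌈m/m_{c1}⌉ equal disks
placed very far apart. Each disk has mass between m_{c1}/2 and m_{c1}. The energy density of a disk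
is convex in its radius and equals ρ_{c1} at both ends of this range, so it is at most ρ_{c1} in
between.

Lower bound (`IsMinimizer.le_energy`). The perimeter is controlled by the sharp isoperimetric
inequality, which yields 2/R per unit mass. For the interaction the goal is V ≥ m²/d^α with d =
ρ_{c1}m/2, the bound that a set of diameter d would satisfy. No diameter is estimated. Instead, cut
the minimizer along a line and move the two pieces far apart: the interaction across the line is at
most the length of the cut (`IsMinimizer.mutualInteraction_le`). Integrating over all lines
orthogonal to a direction, then summing over four directions, bounds the double integral of
|x-y|^{1-α} by 8(√2-1)m (`IsMinimizer.lintegral_edist_le`). Hölder's inequality (`volume_sq_le`)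
interpolates between this moment and V, and gives the lower bound as soon as m d^{1-α} ≥ 8(√2-1).
That condition is checked in `numerical_condition`, where α ≤ 1/2 enters.

The isoperimetric inequality is derived from Brunn-Minkowski through the sharp Sobolev inequality
for smooth functions and mollification. Reduced boundaries and the coarea formula never appear: cuts
are measured by a liminf of integrals of smooth cutoffs, whose integral over all levels is at most
the mass.

The root exists and is unique because r(ρ₀(r)-ρ_{c1}) is strictly convex in r and negative at
R_{c1}. As α → 0 the function ρ₀ becomes the disk density 2/r + πr², which takes the value ρ_{c1} at
R_{c1} and increases from there on; this squeezes R₀ onto R_{c1}(0). -/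

namespace NonlocalIsoperimetric

open scoped Pointwise

/-! ### The Brunn-Minkowski inequality in the plane -/

/-- The one-dimensional Brunn-Minkowski inequality. -/
theorem volume_add_volume_le_real {A B : Set ℝ} (hA : MeasurableSet A) (hB : MeasurableSet B)
    (hA' : A.Nonempty) (hB' : B.Nonempty) : volume A + volume B ≤ volume (A + B) := by
  obtain ⟨a₀, ha₀⟩ := hA'
  obtain ⟨b₀, hb₀⟩ := hB'
  have hBle : volume B ≤ volume (A + B) := by
    calc volume B = volume (a₀ +ᵥ B) := (measure_vadd _ _ _).symm
      _ ≤ _ := measure_mono (by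
        rintro _ ⟨b, hb, rfl⟩; exact add_mem_add ha₀ hb)
  have hAle : volume A ≤ volume (A + B) := by
    calc volume A = volume (b₀ +ᵥ A) := (measure_vadd _ _ _).symm
      _ ≤ _ := measure_mono (by
        rintro _ ⟨b, hb, rfl⟩
        exact ⟨b, hb, b₀, hb₀, add_comm _ _⟩)
  rw [hA.measure_eq_iSup_isCompact, hB.measure_eq_iSup_isCompact]
  simp only [iSup_and']
  refine ENNReal.biSup_add_biSup_le' (p := fun K => K ⊆ A ∧ IsCompact K)
    (q := fun K => K ⊆ B ∧ IsCompact K) ⟨∅, by simp⟩ ⟨∅, by simp⟩ ?_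
  rintro K ⟨hKA, hK⟩ T ⟨hTB, hT⟩
  rcases K.eq_empty_or_nonempty with rfl | hK0
  · simpa using (measure_mono hTB).trans hBle
  rcases T.eq_empty_or_nonempty with rfl | hT0
  · simpa using (measure_mono hKA).trans hAle
  obtain ⟨a, haK, ha⟩ := hK.exists_isGreatest hK0
  obtain ⟨b, hbT, hb⟩ := hT.exists_isLeast hT0
  have hdisj : volume ((b +ᵥ K) ∩ (a +ᵥ T)) = 0 := by
    refine measure_mono_null (t := {a + b}) ?_ (measure_singleton _)
    rintro _ ⟨⟨x, hx, rfl⟩, ⟨y, hy, hxy⟩⟩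
    simp only [vadd_eq_add] at hxy ⊢
    have h1 := ha hx
    have h2 := hb hy
    simp only [mem_singleton_iff]
    linarith
  calc volume K + volume T = volume (b +ᵥ K) + volume (a +ᵥ T) := by simp [measure_vadd]
    _ = volume ((b +ᵥ K) ∪ (a +ᵥ T)) := by
      rw [← measure_union_add_inter _ (hT.vadd a).measurableSet, hdisj, add_zero]
    _ ≤ volume (A + B) := by
      refine measure_mono (union_subset ?_ ?_)
      · rintro _ ⟨x, hx, rfl⟩
        exact ⟨x, hKA hx, b, hTB hbT, add_comm _ _⟩
      · rintro _ ⟨x, hx, rfl⟩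
        exact add_mem_add (hKA haK) (hTB hx)

/-- The length of the slices of a subset of `ℝ × ℝ`. -/
noncomputable def sliceLength (A : Set (ℝ × ℝ)) (s : ℝ) : ℝ := volume.real (Prod.mk s ⁻¹' A)

theorem volume_slice_lt_top {A : Set (ℝ × ℝ)} (hA : Bornology.IsBounded A) (s : ℝ) :
    volume (Prod.mk s ⁻¹' A) < ∞ := by
  refine Bornology.IsBounded.measure_lt_top ?_
  refine (hA.image_snd).subset ?_
  rintro t ht
  exact ⟨(s, t), ht, rfl⟩

theorem measurable_sliceLength {A : Set (ℝ × ℝ)} (hA : MeasurableSet A) :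
    Measurable (sliceLength A) :=
  (measurable_measure_prodMk_left hA).ennreal_toReal

theorem bddAbove_sliceLength {A : Set (ℝ × ℝ)} (hA : Bornology.IsBounded A) :
    BddAbove (range (sliceLength A)) := by
  refine ⟨volume.real (Prod.snd '' A), ?_⟩
  rintro _ ⟨s, rfl⟩
  refine measureReal_mono ?_ hA.image_snd.measure_lt_top.ne
  rintro t ht
  exact ⟨(s, t), ht, rfl⟩

theorem lintegral_sliceLength {A : Set (ℝ × ℝ)} (hA : MeasurableSet A)
    (hb : Bornology.IsBounded A) :
    ∫⁻ s, ENNReal.ofReal (sliceLength A s) = volume A := by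
  rw [Measure.volume_eq_prod, Measure.prod_apply hA]
  refine lintegral_congr fun s => ?_
  exact ENNReal.ofReal_toReal (volume_slice_lt_top hb s).ne

theorem iSup_sliceLength_pos {A : Set (ℝ × ℝ)} (hA : IsOpen A) (hb : Bornology.IsBounded A)
    (hne : A.Nonempty) : 0 < ⨆ s, sliceLength A s := by
  obtain ⟨⟨s, t⟩, hst⟩ := hne
  refine lt_of_lt_of_le ?_ (le_ciSup (bddAbove_sliceLength hb) s)
  have : IsOpen (Prod.mk s ⁻¹' A) := hA.preimage (by fun_prop)
  exact ENNReal.toReal_pos (this.measure_pos _ ⟨t, hst⟩).ne' (volume_slice_lt_top hb s).ne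

/-- Layer cake for the slice length divided by a. The scale a is free because A + B is normalized by
the sum of the two maximal slice lengths rather than by its own. -/
theorem volume_div_eq_lintegral {A : Set (ℝ × ℝ)} (hA : IsOpen A) (hb : Bornology.IsBounded A)
    {a : ℝ} (ha : 0 < a) :
    volume A / ENNReal.ofReal a =
      ∫⁻ θ in Ioi (0 : ℝ), volume {s | θ * a < sliceLength A s} := by
  have h := lintegral_eq_lintegral_meas_lt (volume : Measure ℝ) (f := fun s => sliceLength A s / a)
    (Eventually.of_forall fun s => div_nonneg measureReal_nonneg ha.le)
    ((measurable_sliceLength hA.measurableSet).div_const a).aemeasurable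
  simp only [ENNReal.ofReal_div_of_pos ha, lt_div_iff₀ ha] at h
  rw [← h, ← lintegral_sliceLength hA.measurableSet hb]
  simp only [div_eq_mul_inv]
  rw [lintegral_mul_const _ (measurable_sliceLength hA.measurableSet).ennreal_ofReal]

theorem sliceLength_add_le {A B : Set (ℝ × ℝ)} (hA : IsOpen A) (hB : IsOpen B)
    (hA' : Bornology.IsBounded A) (hB' : Bornology.IsBounded B) {s t : ℝ}
    (hs : 0 < sliceLength A s) (ht : 0 < sliceLength B t) :
    sliceLength A s + sliceLength B t ≤ sliceLength (A + B) (s + t) := by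
  have nonempty {C : Set (ℝ × ℝ)} {r : ℝ} (h : 0 < sliceLength C r) :
      (Prod.mk r ⁻¹' C).Nonempty := by
    by_contra hne
    rw [not_nonempty_iff_eq_empty] at hne
    simp [sliceLength, hne] at h
  have h1 := volume_add_volume_le_real (hA.preimage (f := Prod.mk s) (by fun_prop)).measurableSet
    (hB.preimage (f := Prod.mk t) (by fun_prop)).measurableSet (nonempty hs) (nonempty ht)
  have h2 := h1.trans (measure_mono (t := Prod.mk (s + t) ⁻¹' (A + B)) (by
    rintro _ ⟨x, hx, y, hy, rfl⟩
    exact ⟨(s, x), hx, (t, y), hy, rfl⟩))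
  have h3 := ENNReal.toReal_mono (volume_slice_lt_top (hA'.add hB') (s + t)).ne h2
  rwa [ENNReal.toReal_add (volume_slice_lt_top hA' s).ne (volume_slice_lt_top hB' t).ne] at h3

/-- Bonnesen's form of the planar Brunn-Minkowski inequality. -/
theorem volume_div_add_volume_div_le {A B : Set (ℝ × ℝ)} (hA : IsOpen A) (hB : IsOpen B)
    (hA' : Bornology.IsBounded A) (hB' : Bornology.IsBounded B) (hAne : A.Nonempty)
    (hBne : B.Nonempty) :
    volume A / ENNReal.ofReal (⨆ s, sliceLength A s) +
      volume B / ENNReal.ofReal (⨆ s, sliceLength B s) ≤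
    volume (A + B) / ENNReal.ofReal ((⨆ s, sliceLength A s) + ⨆ s, sliceLength B s) := by
  have ha := iSup_sliceLength_pos hA hA' hAne
  have hb := iSup_sliceLength_pos hB hB' hBne
  have hAb := bddAbove_sliceLength hA'
  have hBb := bddAbove_sliceLength hB'
  set a := ⨆ s, sliceLength A s with ha_def
  set b := ⨆ s, sliceLength B s with hb_def
  rw [volume_div_eq_lintegral hA hA' ha, volume_div_eq_lintegral hB hB' hb,
    volume_div_eq_lintegral hA.add_right (hA'.add hB') (add_pos ha hb), ← lintegral_add_left']
  · refine setLIntegral_mono' measurableSet_Ioi fun θ hθ => ?_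
    have hθ0 : 0 < θ := hθ
    -- For θ < 1 both superlevel sets are nonempty, since a and b are suprema, and their sum lies in
    -- the superlevel set of A + B at height θ(a + b). For θ ≥ 1 both are empty. Normalizing by the
    -- suprema is what makes the two sets become empty at the same θ.
    rcases lt_or_ge θ 1 with h1 | h1
    · have hAn : {s | θ * a < sliceLength A s}.Nonempty :=
        exists_lt_of_lt_ciSup (by nlinarith : θ * a < ⨆ s, sliceLength A s)
      have hBn : {s | θ * b < sliceLength B s}.Nonempty :=
        exists_lt_of_lt_ciSup (by nlinarith : θ * b < ⨆ s, sliceLength B s)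
      refine (volume_add_volume_le_real
        (measurableSet_lt measurable_const (measurable_sliceLength hA.measurableSet))
        (measurableSet_lt measurable_const (measurable_sliceLength hB.measurableSet))
        hAn hBn).trans (measure_mono ?_)
      rintro _ ⟨s, hs, t, ht, rfl⟩
      simp only [mem_ofPred_eq] at hs ht ⊢
      have := sliceLength_add_le hA hB hA' hB' ((by positivity : 0 < θ * a).trans hs)
        ((by positivity : 0 < θ * b).trans ht)
      linarith
    · have h1A : {s | θ * a < sliceLength A s} = ∅ := by
        ext s
        simp only [mem_ofPred_eq, mem_empty_iff_false, iff_false, not_lt]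
        have := le_ciSup hAb s
        nlinarith
      have h1B : {s | θ * b < sliceLength B s} = ∅ := by
        ext s
        simp only [mem_ofPred_eq, mem_empty_iff_false, iff_false, not_lt]
        have := le_ciSup hBb s
        nlinarith
      simp [h1A, h1B]
  · have : Antitone fun θ : ℝ => volume {s | θ * a < sliceLength A s} := by
      intro θ θ' h
      refine measure_mono fun s hs => ?_
      simp only [mem_ofPred_eq] at hs ⊢
      nlinarith
    exact this.measurable.aemeasurable

/-- The planar Brunn-Minkowski inequality for bounded open sets. -/
theorem sqrt_volume_add_sqrt_volume_le {A B : Set (ℝ × ℝ)} (hA : IsOpen A) (hB : IsOpen B)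
    (hA' : Bornology.IsBounded A) (hB' : Bornology.IsBounded B) (hAne : A.Nonempty)
    (hBne : B.Nonempty) :
    √(volume.real A) + √(volume.real B) ≤ √(volume.real (A + B)) := by
  have ha := iSup_sliceLength_pos hA hA' hAne
  have hb := iSup_sliceLength_pos hB hB' hBne
  have h := volume_div_add_volume_div_le hA hB hA' hB' hAne hBne
  set a := ⨆ s, sliceLength A s with ha_def
  set b := ⨆ s, sliceLength B s with hb_def
  have ne_top {C : Set (ℝ × ℝ)} {c : ℝ} (hC : Bornology.IsBounded C) (hc : 0 < c) :
      volume C / ENNReal.ofReal c ≠ ∞ :=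
    (ENNReal.div_lt_top hC.measure_lt_top.ne (by simpa using hc)).ne
  have h' := ENNReal.toReal_mono (ne_top (hA'.add hB') (add_pos ha hb)) h
  rw [ENNReal.toReal_add (ne_top hA' ha) (ne_top hB' hb)] at h'
  simp only [ENNReal.toReal_div, ENNReal.toReal_ofReal ha.le, ENNReal.toReal_ofReal hb.le,
    ENNReal.toReal_ofReal (add_pos ha hb).le, ← measureReal_def] at h'
  set u := volume.real A
  set v := volume.real B
  set w := volume.real (A + B)
  have hu : 0 ≤ u := measureReal_nonneg
  have hv : 0 ≤ v := measureReal_nonneg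
  refine Real.le_sqrt_of_sq_le ?_
  rw [le_div_iff₀ (add_pos ha hb)] at h'
  have h2 : (u / a + v / b) * (a + b) = u + v + (b * (u / a) + a * (v / b)) := by
    field_simp
    ring
  -- AM-GM removes the slice maxima a and b and leaves (√u + √v)² as the lower bound for w.
  have h3 : 2 * (√u * √v) ≤ b * (u / a) + a * (v / b) := by
    have e1 : b * (u / a) = (b * √u) ^ 2 / (a * b) := by
      rw [mul_pow, Real.sq_sqrt hu]; field_simp
    have e2 : a * (v / b) = (a * √v) ^ 2 / (a * b) := by
      rw [mul_pow, Real.sq_sqrt hv]; field_simp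
    rw [e1, e2, ← add_div, le_div_iff₀ (by positivity)]
    nlinarith [sq_nonneg (b * √u - a * √v)]
  nlinarith [Real.sq_sqrt hu, Real.sq_sqrt hv]

/-- The coordinates of a point of the plane, as a continuous linear equivalence. -/
noncomputable def coordEquiv : Plane ≃L[ℝ] ℝ × ℝ :=
  (EuclideanSpace.equiv (Fin 2) ℝ).trans (ContinuousLinearEquiv.finTwoArrow ℝ ℝ)

theorem measurePreserving_coordEquiv : MeasurePreserving coordEquiv := by
  have h1 := EuclideanSpace.volume_preserving_symm_measurableEquiv_toLp (Fin 2)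
  have h2 := volume_preserving_finTwoArrow ℝ
  exact h2.comp h1

theorem measurePreserving_coordEquiv_symm : MeasurePreserving coordEquiv.symm :=
  measurePreserving_coordEquiv.symm coordEquiv.toHomeomorph.toMeasurableEquiv

theorem volume_coordEquiv_symm_preimage (A : Set Plane) :
    volume (coordEquiv.symm ⁻¹' A) = volume A :=
  measurePreserving_coordEquiv_symm.measure_preimage_equiv
    (f := coordEquiv.symm.toHomeomorph.toMeasurableEquiv) A

theorem volume_real_ball {r : ℝ} (hr : 0 ≤ r) (x : Plane) :
    volume.real (Metric.ball x r) = Real.pi * r ^ 2 := by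
  rw [measureReal_def, EuclideanSpace.volume_ball_fin_two]
  simp [hr, mul_comm, Real.pi_pos.le]

/-- The Brunn-Minkowski inequality for a bounded open set of the plane and a disk. -/
theorem volume_add_le_volume_add_ball {A : Set Plane} (hA : IsOpen A)
    (hA' : Bornology.IsBounded A) {r : ℝ} (hr : 0 < r) :
    volume A + ENNReal.ofReal (2 * √Real.pi * r * √(volume.real A)) ≤
      volume (A + Metric.ball 0 r) := by
  rcases A.eq_empty_or_nonempty with rfl | hne
  · simp
  have hB : IsOpen (Metric.ball (0 : Plane) r) := Metric.isOpen_ball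
  have hB' : Bornology.IsBounded (Metric.ball (0 : Plane) r) := Metric.isBounded_ball
  have bdd {C : Set Plane} (hC : Bornology.IsBounded C) :
      Bornology.IsBounded (coordEquiv.symm ⁻¹' C) := by
    rw [← ContinuousLinearEquiv.image_eq_preimage_symm]
    exact coordEquiv.lipschitz.isBounded_image hC
  have h := sqrt_volume_add_sqrt_volume_le (hA.preimage coordEquiv.symm.continuous)
    (hB.preimage coordEquiv.symm.continuous) (bdd hA') (bdd hB')
    (hne.preimage coordEquiv.symm.surjective)
    ((Metric.nonempty_ball.2 hr).preimage coordEquiv.symm.surjective)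
  have hadd : coordEquiv.symm ⁻¹' A + coordEquiv.symm ⁻¹' (Metric.ball (0 : Plane) r) =
      coordEquiv.symm ⁻¹' (A + Metric.ball 0 r) := by
    simp only [← ContinuousLinearEquiv.image_eq_preimage_symm]
    exact (image_add coordEquiv).symm
  rw [hadd] at h
  simp only [measureReal_def, volume_coordEquiv_symm_preimage] at h
  simp only [← measureReal_def, volume_real_ball hr.le] at h
  rw [Real.sqrt_mul Real.pi_pos.le, Real.sqrt_sq hr.le] at h
  have hfin : volume (A + Metric.ball 0 r) ≠ ∞ := (hA'.add hB').measure_lt_top.ne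
  have hAfin : volume A ≠ ∞ := hA'.measure_lt_top.ne
  rw [← ENNReal.ofReal_toReal hfin, ← ENNReal.ofReal_toReal hAfin,
    ← ENNReal.ofReal_add ENNReal.toReal_nonneg (by positivity)]
  refine ENNReal.ofReal_le_ofReal ?_
  simp only [← measureReal_def]
  have h0 : 0 ≤ volume.real A := measureReal_nonneg
  have h1 : 0 ≤ volume.real (A + Metric.ball 0 r) := measureReal_nonneg
  have h2 := pow_le_pow_left₀ (by positivity) h 2
  rw [Real.sq_sqrt h1, add_sq, Real.sq_sqrt h0] at h2
  -- The term πr² is thrown away: only the first order in r is needed for the perimeter.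
  nlinarith [sq_nonneg (√Real.pi * r)]

/-! ### The sharp Sobolev inequality -/

/-- Second order Taylor estimate for a compactly supported function. -/
theorem exists_taylor_bound {f : Plane → ℝ} (hf : ContDiff ℝ 2 f) (hc : HasCompactSupport f) :
    ∃ C : ℝ, 0 ≤ C ∧ ∀ x z : Plane, ∀ r : ℝ, ‖x - z‖ ≤ r →
      f x ≤ f z + r * ‖fderiv ℝ f z‖ + C * r ^ 2 := by
  have h1 : ContDiff ℝ 1 (fderiv ℝ f) := hf.fderiv_right (by norm_num)
  obtain ⟨C, hC⟩ := h1.lipschitzWith_of_hasCompactSupport (hc.fderiv ℝ) one_ne_zero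
  refine ⟨C, C.2, fun x z r hr => ?_⟩
  have hr0 : 0 ≤ r := (norm_nonneg _).trans hr
  have hd : Differentiable ℝ f := hf.differentiable (by norm_num)
  have key := (convex_closedBall z r).norm_image_sub_le_of_norm_fderiv_le' (f := f)
    (φ := fderiv ℝ f z) (C := C * r) (x := z) (y := x) (fun y _ => hd y)
    (fun y hy => by
      have := hC.dist_le_mul y z
      rw [dist_eq_norm] at this
      refine this.trans ?_
      gcongr
      exact hy) (Metric.mem_closedBall_self hr0) (by simpa [dist_eq_norm] using hr)
  have h2 := (le_abs_self _).trans key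
  have h3 : (fderiv ℝ f z) (x - z) ≤ ‖fderiv ℝ f z‖ * r :=
    (le_abs_self _).trans (((fderiv ℝ f z).le_opNorm _).trans (by gcongr))
  have h4 : (C : ℝ) * r * ‖x - z‖ ≤ C * r * r := by gcongr
  nlinarith

/-- The `L²` norm is bounded by the integral of the square roots of the measures of the
superlevel sets. -/
theorem sqrt_lintegral_sq_le {f : Plane → ℝ} (hf : Continuous f) (hc : HasCompactSupport f)
    (h0 : ∀ x, 0 ≤ f x) :
    (∫⁻ x, ENNReal.ofReal (f x) ^ 2) ^ (1 / 2 : ℝ) ≤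
      ∫⁻ t in Ioi (0 : ℝ), volume {x | t < f x} ^ (1 / 2 : ℝ) := by
  set S := ∫⁻ x, ENNReal.ofReal (f x) ^ 2 with hS
  set N := ∫⁻ t in Ioi (0 : ℝ), volume {x | t < f x} ^ (1 / 2 : ℝ) with hN
  have hmeas : MeasurableSet {p : Plane × ℝ | p.2 < f p.1} :=
    measurableSet_lt measurable_snd (hf.measurable.comp measurable_fst)
  set I : Plane × ℝ → ℝ≥0∞ := {p : Plane × ℝ | p.2 < f p.1}.indicator 1 with hI
  have hIm : Measurable I := measurable_one.indicator hmeas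
  have hF : Measurable fun x => ENNReal.ofReal (f x) := hf.measurable.ennreal_ofReal
  have hlayer (x : Plane) : ENNReal.ofReal (f x) =
      ∫⁻ t in Ioi (0 : ℝ), I (x, t) := by
    have : (fun t => I (x, t)) = (Iio (f x)).indicator 1 := by
      ext t; simp [hI, indicator]
    rw [this, lintegral_indicator_one measurableSet_Iio, Measure.restrict_apply measurableSet_Iio,
      Iio_inter_Ioi, Real.volume_Ioo, sub_zero]
  have hSfin : S ≠ ∞ := by
    have hsq : Integrable (fun x => f x ^ 2) := by
      refine (hf.pow 2).integrable_of_hasCompactSupport ?_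
      refine hc.mono fun x hx => ?_
      rw [Function.mem_support] at hx ⊢
      exact fun h => hx (by rw [Pi.pow_apply, h]; exact zero_pow two_ne_zero)
    have := hsq.lintegral_lt_top
    simp only [ENNReal.ofReal_pow (h0 _)] at this
    exact this.ne
  -- One factor of f² is expanded into layers and Cauchy-Schwarz is applied on each layer.
  -- Cancelling the square root of S afterwards requires S to be finite.
  have h1 : S ≤ N * S ^ (1 / 2 : ℝ) := by
    calc S = ∫⁻ x, (∫⁻ t in Ioi (0 : ℝ), I (x, t)) *
          ENNReal.ofReal (f x) := by
          rw [hS]; refine lintegral_congr fun x => ?_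
          rw [← hlayer, sq]
      _ = ∫⁻ x, ∫⁻ t in Ioi (0 : ℝ), I (x, t) *
          ENNReal.ofReal (f x) := by
          refine lintegral_congr fun x => ?_
          rw [lintegral_mul_const']
          exact ENNReal.ofReal_ne_top
      _ = ∫⁻ t in Ioi (0 : ℝ), ∫⁻ x, I (x, t) *
          ENNReal.ofReal (f x) := by
          refine lintegral_lintegral_swap ?_
          exact (hIm.mul (hF.comp measurable_fst)).aemeasurable
      _ ≤ ∫⁻ t in Ioi (0 : ℝ), volume {x | t < f x} ^ (1 / 2 : ℝ) * S ^ (1 / 2 : ℝ) := by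
          refine lintegral_mono fun t => ?_
          have hm : MeasurableSet {x | t < f x} := measurableSet_lt measurable_const hf.measurable
          have := ENNReal.lintegral_mul_le_Lp_mul_Lq volume
            (Real.HolderConjugate.two_two)
            (f := fun x => I (x, t)) (g := fun x => ENNReal.ofReal (f x))
            (hIm.comp measurable_prodMk_right).aemeasurable hF.aemeasurable
          have e : ∀ x, I (x, t) ^ (2 : ℝ) = {x | t < f x}.indicator 1 x := by
            intro x; by_cases hx : t < f x <;> simp [hI, hx]
          simp only [e, lintegral_indicator_one hm, ENNReal.rpow_two, ← hS] at this
          exact this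
      _ = N * S ^ (1 / 2 : ℝ) := by
          rw [lintegral_mul_const']
          exact ENNReal.rpow_ne_top_of_nonneg (by norm_num) hSfin
  rcases eq_or_ne S 0 with hS0 | hS0
  · simp [hS0]
  have hhalf : S ^ (1 / 2 : ℝ) * S ^ (1 / 2 : ℝ) = S := by
    rw [← ENNReal.rpow_add _ _ hS0 hSfin]; norm_num
  have hne0 : S ^ (1 / 2 : ℝ) ≠ 0 := by
    intro h; rw [h] at hhalf; exact hS0 (by simpa using hhalf.symm)
  refine (ENNReal.mul_le_mul_iff_left hne0
    (ENNReal.rpow_ne_top_of_nonneg (by norm_num) hSfin)).1 ?_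
  rw [hhalf]
  exact h1

/-- A substitute for coarea plus isoperimetry. By Taylor, {f > t} thickened by r lies in {g > t}
with g = f + r|∇f| + Cr². Brunn-Minkowski bounds the area gained at each level from below.
Integrating over t, subtracting the integral of f, dividing by r and letting r → 0 gives the
inequality. -/
theorem sqrt_levels_le {f : Plane → ℝ} (hf : ContDiff ℝ 2 f) (hc : HasCompactSupport f)
    (h0 : ∀ x, 0 ≤ f x) :
    ENNReal.ofReal (2 * √Real.pi) * ∫⁻ t in Ioi (0 : ℝ), volume {x | t < f x} ^ (1 / 2 : ℝ) ≤
      ∫⁻ x, ENNReal.ofReal ‖fderiv ℝ f x‖ := by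
  obtain ⟨C, hC0, hC⟩ := exists_taylor_bound hf hc
  obtain ⟨R, hR⟩ := hc.isBounded.subset_closedBall 0
  -- K contains the r-neighbourhood of the support for every r ≤ 1. Restricting the error Cr² to K
  -- keeps its integral finite.
  set K : Set Plane := Metric.closedBall 0 (R + 1) with hK
  have hKm : MeasurableSet K := Metric.isClosed_closedBall.measurableSet
  have hKfin : volume K ≠ ∞ := Metric.isBounded_closedBall.measure_lt_top.ne
  have hfint : ∫⁻ x, ENNReal.ofReal (f x) ≠ ∞ :=
    (hf.continuous.integrable_of_hasCompactSupport hc).lintegral_lt_top.ne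
  have hdf : Continuous (fderiv ℝ f) := hf.continuous_fderiv (by norm_num)
  set M := ∫⁻ t in Ioi (0 : ℝ), volume {x | t < f x} ^ (1 / 2 : ℝ)
  set D := ∫⁻ x, ENNReal.ofReal ‖fderiv ℝ f x‖
  have step : ∀ r : ℝ, 0 < r → r ≤ 1 →
      ENNReal.ofReal (2 * √Real.pi) * M ≤ D + ENNReal.ofReal (C * r) * volume K := by
    intro r hr hr1
    set g : Plane → ℝ := K.indicator fun x => f x + r * ‖fderiv ℝ f x‖ + C * r ^ 2 with hg
    have hgm : Measurable g := by
      refine Measurable.indicator ?_ hKm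
      exact ((hf.continuous.add (continuous_const.mul hdf.norm)).add continuous_const).measurable
    have hg0 : ∀ x, 0 ≤ g x := fun x => indicator_nonneg (fun y _ => by
      have := h0 y; positivity) x
    have h1 := lintegral_eq_lintegral_meas_lt volume (Eventually.of_forall hg0) hgm.aemeasurable
    have h2 := lintegral_eq_lintegral_meas_lt volume (Eventually.of_forall h0)
      hf.continuous.measurable.aemeasurable
    have hlev : ∀ t ∈ Ioi (0 : ℝ), volume {x | t < f x} +
        ENNReal.ofReal (2 * √Real.pi * r) * volume {x | t < f x} ^ (1 / 2 : ℝ) ≤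
        volume {x | t < g x} := by
      intro t ht
      have ht0 : 0 < t := ht
      have hsub : {x | t < f x} ⊆ Metric.closedBall 0 R := by
        intro x hx
        refine hR (subset_tsupport f ?_)
        exact (ht0.trans hx).ne'
      have hbd : Bornology.IsBounded {x | t < f x} := Metric.isBounded_closedBall.subset hsub
      have hop : IsOpen {x | t < f x} := isOpen_lt continuous_const hf.continuous
      refine le_trans (le_of_eq ?_) ((volume_add_le_volume_add_ball hop hbd hr).trans
        (measure_mono ?_))
      · congr 1
        rw [ENNReal.ofReal_mul (p := 2 * √Real.pi * r) (by positivity),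
          Real.sqrt_eq_rpow (volume.real _),
          ← ENNReal.ofReal_rpow_of_nonneg measureReal_nonneg (by norm_num),
          ofReal_measureReal hbd.measure_lt_top.ne]
      · rintro _ ⟨x, hx, y, hy, rfl⟩
        have hx' : t < f x := hx
        have hxR := hsub hx
        simp only [Metric.mem_ball, Metric.mem_closedBall, dist_zero_right] at hy hxR
        have hmem : x + y ∈ K := by
          simp only [hK, Metric.mem_closedBall, dist_zero_right]
          exact (norm_add_le _ _).trans (by linarith)
        simp only [mem_ofPred_eq, hg, indicator_of_mem hmem]
        exact hx'.trans_le (hC x (x + y) r (by simpa using hy.le))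
    have hr' : ENNReal.ofReal r ≠ 0 := by simpa using hr
    have h3 : (∫⁻ x, ENNReal.ofReal (f x)) + ENNReal.ofReal r * (ENNReal.ofReal (2 * √Real.pi) * M) ≤
        ∫⁻ x, ENNReal.ofReal (g x) := by
      rw [h1, h2, ← mul_assoc, ← ENNReal.ofReal_mul hr.le, mul_comm r,
        ← lintegral_const_mul' _ _ ENNReal.ofReal_ne_top, ← lintegral_add_left]
      · exact setLIntegral_mono' measurableSet_Ioi hlev
      · refine Antitone.measurable fun t t' h => measure_mono fun x hx => ?_
        exact lt_of_le_of_lt h hx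
    have h4 : ∫⁻ x, ENNReal.ofReal (g x) ≤ (∫⁻ x, ENNReal.ofReal (f x)) +
        ENNReal.ofReal r * (D + ENNReal.ofReal (C * r) * volume K) := by
      calc ∫⁻ x, ENNReal.ofReal (g x) ≤ ∫⁻ x, (ENNReal.ofReal (f x) +
            ENNReal.ofReal r * (ENNReal.ofReal ‖fderiv ℝ f x‖ +
              K.indicator (fun _ => ENNReal.ofReal (C * r)) x)) := by
            refine lintegral_mono fun x => ?_
            by_cases hx : x ∈ K
            · simp only [hg, indicator_of_mem hx]
              rw [← ENNReal.ofReal_add (norm_nonneg _) (by positivity), ← ENNReal.ofReal_mul hr.le,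
                ← ENNReal.ofReal_add (h0 x) (by positivity)]
              exact ENNReal.ofReal_le_ofReal (by nlinarith)
            · simp [hg, indicator_of_notMem hx]
        _ = _ := by
            rw [lintegral_add_left hf.continuous.measurable.ennreal_ofReal,
              lintegral_const_mul' _ _ ENNReal.ofReal_ne_top,
              lintegral_add_left hdf.norm.measurable.ennreal_ofReal,
              lintegral_indicator_const hKm]
    have h5 := (ENNReal.add_le_add_iff_left hfint).1 (h3.trans h4)
    exact (ENNReal.mul_le_mul_iff_right hr' ENNReal.ofReal_ne_top).1 h5
  have hlim : Tendsto (fun r : ℝ => D + ENNReal.ofReal (C * r) * volume K) (𝓝[>] 0) (𝓝 D) := by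
    have h1 : Tendsto (fun r : ℝ => ENNReal.ofReal (C * r)) (𝓝[>] 0) (𝓝 0) := by
      have : Tendsto (fun r : ℝ => ENNReal.ofReal (C * r)) (𝓝 0) (𝓝 (ENNReal.ofReal (C * 0))) :=
        (ENNReal.continuous_ofReal.comp (continuous_const.mul continuous_id)).tendsto 0
      simp only [mul_zero, ENNReal.ofReal_zero] at this
      exact this.mono_left nhdsWithin_le_nhds
    have h2 := ENNReal.Tendsto.mul_const (b := volume K) h1 (Or.inr hKfin)
    simpa using h2.const_add D
  refine ge_of_tendsto hlim ?_
  filter_upwards [Ioc_mem_nhdsGT (zero_lt_one' ℝ)] with r hr using step r hr.1 hr.2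

/-- The sharp Sobolev inequality in the plane, for the exponent `1`. -/
theorem sobolev_inequality {f : Plane → ℝ} (hf : ContDiff ℝ 2 f) (hc : HasCompactSupport f)
    (h0 : ∀ x, 0 ≤ f x) :
    ENNReal.ofReal (2 * √Real.pi) * (∫⁻ x, ENNReal.ofReal (f x) ^ 2) ^ (1 / 2 : ℝ) ≤
      ∫⁻ x, ENNReal.ofReal ‖fderiv ℝ f x‖ :=
  (mul_le_mul_right (sqrt_lintegral_sq_le hf.continuous hc h0) _).trans (sqrt_levels_le hf hc h0)

end NonlocalIsoperimetric

namespace NonlocalIsoperimetric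

/-! ### Test fields -/

theorem fderiv_apply_eq_sum {g : Plane → ℝ} (x v : Plane) :
    fderiv ℝ g x v = ∑ i : Fin 2, fderiv ℝ g x (EuclideanSpace.single i 1) * v i := by
  have hv : v = ∑ i : Fin 2, v i • EuclideanSpace.single i (1 : ℝ) := by
    ext j
    fin_cases j <;> simp
  conv_lhs => rw [hv]
  simp [map_smul, mul_comm]

theorem contDiff_coord {φ : Plane → Plane} (h : ContDiff ℝ 1 φ) (i : Fin 2) :
    ContDiff ℝ 1 fun x => φ x i :=
  contDiff_euclidean.1 h i

theorem hasCompactSupport_coord {φ : Plane → Plane} (h : HasCompactSupport φ) (i : Fin 2) :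
    HasCompactSupport fun x => φ x i :=
  h.comp_left (g := fun y : Plane => y i) rfl

theorem divergence_eq {φ : Plane → Plane} (h : ContDiff ℝ 1 φ) (x : Plane) :
    divergence φ x = ∑ i : Fin 2, fderiv ℝ (fun y => φ y i) x (EuclideanSpace.single i 1) := by
  refine Finset.sum_congr rfl fun i _ => ?_
  have hd : DifferentiableAt ℝ φ x := h.differentiable one_ne_zero x
  have := (EuclideanSpace.proj (𝕜 := ℝ) i).hasFDerivAt.comp x hd.hasFDerivAt
  have h2 : fderiv ℝ (fun y => φ y i) x = (EuclideanSpace.proj (𝕜 := ℝ) i).comp (fderiv ℝ φ x) :=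
    this.fderiv
  rw [h2]; rfl

theorem continuous_divergence {φ : Plane → Plane} (h : ContDiff ℝ 1 φ) :
    Continuous (divergence φ) := by
  have : divergence φ = fun x => ∑ i : Fin 2,
      fderiv ℝ (fun y => φ y i) x (EuclideanSpace.single i 1) := funext (divergence_eq h)
  rw [this]
  refine continuous_finsetSum _ fun i _ => ?_
  exact ((contDiff_coord h i).continuous_fderiv one_ne_zero).clm_apply continuous_const

theorem hasCompactSupport_divergence {φ : Plane → Plane} (h : HasCompactSupport φ) :
    HasCompactSupport (divergence φ) := by
  refine (h.fderiv ℝ).mono fun x hx => ?_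
  rw [Function.mem_support] at hx ⊢
  exact fun h0 => hx (by simp [divergence, h0])

theorem integrable_divergence {φ : Plane → Plane} (h : ContDiff ℝ 1 φ) (hc : HasCompactSupport φ) :
    Integrable (divergence φ) :=
  (continuous_divergence h).integrable_of_hasCompactSupport (hasCompactSupport_divergence hc)

/-- The product rule for the divergence. -/
theorem divergence_smul {g : Plane → ℝ} {φ : Plane → Plane} (hg : ContDiff ℝ 1 g)
    (h : ContDiff ℝ 1 φ) (x : Plane) :
    divergence (fun y => g y • φ y) x = g x * divergence φ x + fderiv ℝ g x (φ x) := by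
  have hsm : ContDiff ℝ 1 fun y => g y • φ y := hg.smul h
  rw [divergence_eq hsm, divergence_eq h, fderiv_apply_eq_sum, Finset.mul_sum,
    ← Finset.sum_add_distrib]
  refine Finset.sum_congr rfl fun i _ => ?_
  have hgx : DifferentiableAt ℝ g x := hg.differentiable one_ne_zero x
  have hφx : DifferentiableAt ℝ (fun y => φ y i) x :=
    (contDiff_coord h i).differentiable one_ne_zero x
  have : (fun y => (g y • φ y) i) = fun y => g y * φ y i := by ext; simp
  rw [this, fderiv_fun_mul hgx hφx]
  simp [mul_comm]

theorem divergence_add {φ ψ : Plane → Plane} (hφ : ContDiff ℝ 1 φ)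
    (hψ : ContDiff ℝ 1 ψ) (x : Plane) :
    divergence (fun y => φ y + ψ y) x = divergence φ x + divergence ψ x := by
  simp only [divergence, ← Finset.sum_add_distrib]
  refine Finset.sum_congr rfl fun i _ => ?_
  rw [fderiv_fun_add (hφ.differentiable one_ne_zero x) (hψ.differentiable one_ne_zero x)]
  simp

/-- Integration by parts against a test field. -/
theorem integral_mul_divergence {g : Plane → ℝ} {φ : Plane → Plane} (hg : ContDiff ℝ 1 g)
    (h : ContDiff ℝ 1 φ) (hc : HasCompactSupport φ) :
    ∫ x, g x * divergence φ x = -∫ x, fderiv ℝ g x (φ x) := by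
  have hcont (i : Fin 2) := (contDiff_coord h i).continuous
  have hcs (i : Fin 2) := hasCompactSupport_coord hc i
  have hdg := hg.continuous_fderiv one_ne_zero
  have hdg' (i : Fin 2) : Continuous fun x => fderiv ℝ g x (EuclideanSpace.single i 1) :=
    hdg.clm_apply continuous_const
  have hdφ (i : Fin 2) :
      Continuous fun x => fderiv ℝ (fun y => φ y i) x (EuclideanSpace.single i 1) :=
    ((contDiff_coord h i).continuous_fderiv one_ne_zero).clm_apply continuous_const
  have hi1 (i : Fin 2) :
      Integrable fun x => fderiv ℝ g x (EuclideanSpace.single i 1) * φ x i :=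
    ((hdg' i).mul (hcont i)).integrable_of_hasCompactSupport (hcs i).mul_left
  have hi2 (i : Fin 2) :
      Integrable fun x => g x * fderiv ℝ (fun y => φ y i) x (EuclideanSpace.single i 1) :=
    (hg.continuous.mul (hdφ i)).integrable_of_hasCompactSupport
      (((hcs i).fderiv_apply ℝ _).mul_left)
  have e (x : Plane) : fderiv ℝ g x (φ x) =
      ∑ i : Fin 2, fderiv ℝ g x (EuclideanSpace.single i 1) * φ x i := fderiv_apply_eq_sum x (φ x)
  simp only [divergence_eq h, e, Finset.mul_sum]
  rw [integral_finsetSum _ fun i _ => hi2 i, integral_finsetSum _ fun i _ => hi1 i,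
    ← Finset.sum_neg_distrib]
  refine Finset.sum_congr rfl fun i _ => ?_
  refine integral_mul_fderiv_eq_neg_fderiv_mul_of_integrable (hi1 i) (hi2 i) ?_
    (fun x _ => hg.differentiable one_ne_zero x)
    (fun x _ => (contDiff_coord h i).differentiable one_ne_zero x)
  exact (hg.continuous.mul (hcont i)).integrable_of_hasCompactSupport (hcs i).mul_left

theorem IsTestField.integrable_divergence {φ : Plane → Plane} (h : IsTestField φ) :
    Integrable (divergence φ) :=
  NonlocalIsoperimetric.integrable_divergence h.1 h.2.1

theorem IsTestField.comp_add_right {φ : Plane → Plane} (h : IsTestField φ) (a : Plane) :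
    IsTestField fun x => φ (x + a) :=
  ⟨h.1.comp (contDiff_id.add contDiff_const), h.2.1.comp_homeomorph (Homeomorph.addRight a),
    fun _ => h.2.2 _⟩

theorem divergence_comp_add_right (φ : Plane → Plane) (a x : Plane) :
    divergence (fun y => φ (y + a)) x = divergence φ (x + a) := by
  simp only [divergence, fderiv_comp_add_right]

theorem isTestField_zero : IsTestField fun _ => 0 :=
  ⟨contDiff_const, HasCompactSupport.zero, by simp⟩

theorem ofReal_integral_le_perimeter {φ : Plane → Plane} (h : IsTestField φ) (F : Set Plane) :
    ENNReal.ofReal (∫ x in F, divergence φ x) ≤ perimeter F :=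
  le_iSup₂ (f := fun (φ : Plane → Plane) (_ : IsTestField φ) =>
    ENNReal.ofReal (∫ x in F, divergence φ x)) φ h

theorem integral_le_perimeter {φ : Plane → Plane} (h : IsTestField φ) {F : Set Plane}
    (hF : perimeter F ≠ ∞) : ∫ x in F, divergence φ x ≤ (perimeter F).toReal :=
  (ENNReal.ofReal_le_iff_le_toReal hF).1 (ofReal_integral_le_perimeter h F)

theorem perimeter_congr {F G : Set Plane} (h : F =ᵐ[volume] G) : perimeter F = perimeter G := by
  simp only [perimeter, Measure.restrict_congr_set h]

/-- Translation invariance of the perimeter, as an inequality for preimages. -/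
theorem perimeter_preimage_add_le (F : Set Plane) (a : Plane) :
    perimeter ((fun x => x + a) ⁻¹' F) ≤ perimeter F := by
  refine iSup₂_le fun φ hφ => ?_
  refine le_trans (le_of_eq ?_) (ofReal_integral_le_perimeter (hφ.comp_add_right (-a)) F)
  congr 1
  simp only [divergence_comp_add_right]
  have := (measurePreserving_add_right volume a).setIntegral_preimage_emb
    (measurableEmbedding_addRight a) (fun x => divergence φ (x + -a)) F
  simpa using this

/-! ### Mollification and the isoperimetric inequality -/

/-- The total variation of a smooth function is bounded by its weak formulation. -/
theorem lintegral_norm_fderiv_le {f : Plane → ℝ} (hf : ContDiff ℝ 2 f) (hc : HasCompactSupport f)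
    {P : ℝ} (hP : ∀ φ, IsTestField φ → ∫ x, f x * divergence φ x ≤ P) :
    ∫⁻ x, ENNReal.ofReal ‖fderiv ℝ f x‖ ≤ ENNReal.ofReal P := by
  have h1 : ContDiff ℝ 1 (fderiv ℝ f) := hf.fderiv_right (by norm_num)
  have hdc : HasCompactSupport (fderiv ℝ f) := hc.fderiv ℝ
  set v : Plane → Plane := fun x =>
    WithLp.toLp 2 fun i => fderiv ℝ f x (EuclideanSpace.single i 1) with hv
  have hvi (x : Plane) (i : Fin 2) : v x i = fderiv ℝ f x (EuclideanSpace.single i 1) := rfl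
  have hvc : ContDiff ℝ 1 v := contDiff_euclidean.2 fun i => h1.clm_apply contDiff_const
  have hv0 (x : Plane) (hx : fderiv ℝ f x = 0) : v x = 0 := by
    ext i; simp [hvi, hx]
  have hinner (x w : Plane) : fderiv ℝ f x w = inner ℝ (v x) w := by
    rw [fderiv_apply_eq_sum, PiLp.inner_apply]
    refine Finset.sum_congr rfl fun i _ => ?_
    rw [hvi]; simp [mul_comm]
  have hnorm (x : Plane) : ‖fderiv ℝ f x‖ ≤ ‖v x‖ :=
    ContinuousLinearMap.opNorm_le_bound _ (norm_nonneg _) fun w => by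
      rw [hinner]; exact norm_inner_le_norm _ _
  set K := tsupport (fderiv ℝ f) with hK
  have hKm : MeasurableSet K := (isClosed_tsupport _).measurableSet
  have hKfin : volume K ≠ ∞ := hdc.isCompact.measure_lt_top.ne
  have hint : Integrable fun x => ‖fderiv ℝ f x‖ :=
    h1.continuous.norm.integrable_of_hasCompactSupport hdc.norm
  rw [← ofReal_integral_eq_lintegral_ofReal hint (Eventually.of_forall fun _ => norm_nonneg _)]
  refine ENNReal.ofReal_le_ofReal ?_
  have step : ∀ δ : ℝ, 0 < δ → ∫ x, ‖fderiv ℝ f x‖ ≤ P + δ * volume.real K := by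
    intro δ hδ
    have hpos (x : Plane) : 0 < δ ^ 2 + ‖v x‖ ^ 2 := by positivity
    -- A regularization of -∇f/|∇f| that remains C¹ where the gradient vanishes; it loses at most δ
    -- pointwise on K.
    set φ : Plane → Plane := fun x => (-(√(δ ^ 2 + ‖v x‖ ^ 2))⁻¹) • v x with hφ
    have hφc : ContDiff ℝ 1 φ := by
      refine ContDiff.smul (ContDiff.neg (ContDiff.inv (ContDiff.sqrt ?_ fun x => (hpos x).ne')
        fun x => (Real.sqrt_pos.2 (hpos x)).ne')) hvc
      exact contDiff_const.add (hvc.norm_sq ℝ)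
    have hφs : HasCompactSupport φ := by
      refine hdc.mono fun x hx => ?_
      rw [Function.mem_support] at hx ⊢
      exact fun h0 => hx (by simp [hφ, hv0 x h0])
    have hle (x : Plane) : ‖v x‖ ≤ √(δ ^ 2 + ‖v x‖ ^ 2) :=
      Real.le_sqrt_of_sq_le (by nlinarith)
    have hφt : IsTestField φ := by
      refine ⟨hφc, hφs, fun x => ?_⟩
      have h3 := Real.sqrt_pos.2 (hpos x)
      rw [hφ, norm_smul, norm_neg, norm_inv, Real.norm_of_nonneg h3.le, inv_mul_le_iff₀ h3,
        mul_one]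
      exact hle x
    have h2 := hP φ hφt
    rw [integral_mul_divergence (hf.of_le (by norm_num)) hφc hφs] at h2
    have hint2 : Integrable fun x => fderiv ℝ f x (φ x) :=
      (h1.continuous.clm_apply hφc.continuous).integrable_of_hasCompactSupport
        (hdc.mono fun x hx => by
          rw [Function.mem_support] at hx ⊢
          exact fun h0 => hx (by simp [h0]))
    have hint3 : Integrable (K.indicator fun _ => δ) :=
      (integrable_indicator_iff hKm).2 (integrableOn_const hKfin)
    calc ∫ x, ‖fderiv ℝ f x‖ ≤ ∫ x, (-(fderiv ℝ f x (φ x)) + K.indicator (fun _ => δ) x) := by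
          refine integral_mono hint (hint2.neg.add hint3) fun x => ?_
          by_cases hx : x ∈ K
          · simp only [indicator_of_mem hx]
            refine (hnorm x).trans ?_
            have h3 := Real.sqrt_pos.2 (hpos x)
            rw [hinner, hφ, inner_smul_right, real_inner_self_eq_norm_sq]
            have h4 : √(δ ^ 2 + ‖v x‖ ^ 2) ≤ δ + ‖v x‖ := by
              rw [Real.sqrt_le_left (by positivity)]
              nlinarith [norm_nonneg (v x)]
            have h5 : ‖v x‖ - δ ≤ (√(δ ^ 2 + ‖v x‖ ^ 2))⁻¹ * ‖v x‖ ^ 2 := by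
              rw [inv_mul_eq_div, le_div_iff₀ h3]
              rcases le_or_gt ‖v x‖ δ with h6 | h6
              · nlinarith [norm_nonneg (v x)]
              · nlinarith [norm_nonneg (v x)]
            linarith
          · have : fderiv ℝ f x = 0 := image_eq_zero_of_notMem_tsupport hx
            simp [this, indicator_of_notMem hx]
      _ = (-∫ x, fderiv ℝ f x (φ x)) + δ * volume.real K := by
          rw [integral_add (f := fun x => -(fderiv ℝ f x (φ x))) hint2.neg hint3, integral_neg, integral_indicator_const _ hKm,
            smul_eq_mul, mul_comm]
      _ ≤ P + δ * volume.real K := by linarith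
  have hlim : Tendsto (fun δ : ℝ => P + δ * volume.real K) (𝓝[>] 0) (𝓝 P) := by
    have : Tendsto (fun δ : ℝ => P + δ * volume.real K) (𝓝 0) (𝓝 (P + 0 * volume.real K)) :=
      (continuous_const.add (continuous_id.mul continuous_const)).tendsto 0
    rw [zero_mul, add_zero] at this
    exact this.mono_left nhdsWithin_le_nhds
  exact ge_of_tendsto hlim (by filter_upwards [self_mem_nhdsWithin] with δ hδ using step δ hδ)

/-- The mollification of the indicator function of a set. -/
noncomputable def mollify (η : ContDiffBump (0 : Plane)) (F : Set Plane) : Plane → ℝ :=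
  convolution (η.normed volume) (F.indicator 1) (ContinuousLinearMap.lsmul ℝ ℝ) volume

/-- Fubini moves the mollifier onto the test field: the integral becomes an average, with weights of
total mass one, of integrals over F of divergences of translated test fields. -/
theorem integral_mollify_mul_divergence_le (η : ContDiffBump (0 : Plane)) {F : Set Plane}
    (hF : MeasurableSet F) (hP : perimeter F ≠ ∞) {φ : Plane → Plane} (hφ : IsTestField φ) :
    ∫ x, mollify η F x * divergence φ x ≤ (perimeter F).toReal := by
  have hηi : Integrable (η.normed volume) := η.integrable_normed
  have hdi := hφ.integrable_divergence
  have hmeas : Measurable fun p : Plane × Plane => F.indicator (1 : Plane → ℝ) (p.1 - p.2) :=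
    (measurable_one.indicator hF).comp (measurable_fst.sub measurable_snd)
  have hint : Integrable (fun p : Plane × Plane =>
      F.indicator (1 : Plane → ℝ) (p.1 - p.2) * (divergence φ p.1 * η.normed volume p.2))
      (volume.prod volume) := by
    refine (hdi.mul_prod hηi).bdd_mul (c := 1) hmeas.aestronglyMeasurable ?_
    refine Eventually.of_forall fun p => ?_
    by_cases hp : p.1 - p.2 ∈ F <;> simp [hp]
  have htrans (t : Plane) : ∫ x, F.indicator (1 : Plane → ℝ) (x - t) * divergence φ x =
      ∫ x in F, divergence (fun y => φ (y + t)) x := by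
    simp only [divergence_comp_add_right]
    rw [← integral_indicator hF, ← integral_add_right_eq_self _ t]
    refine integral_congr_ae (Eventually.of_forall fun x => ?_)
    by_cases hx : x ∈ F <;> simp [hx]
  calc ∫ x, mollify η F x * divergence φ x
      = ∫ x, ∫ t, F.indicator (1 : Plane → ℝ) (x - t) * (divergence φ x * η.normed volume t) := by
        refine integral_congr_ae (Eventually.of_forall fun x => ?_)
        simp only [mollify, convolution_def, ContinuousLinearMap.lsmul_apply, smul_eq_mul]
        rw [← integral_mul_const]
        refine integral_congr_ae (Eventually.of_forall fun t => ?_)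
        ring
    _ = ∫ t, ∫ x, F.indicator (1 : Plane → ℝ) (x - t) * (divergence φ x * η.normed volume t) :=
        integral_integral_swap hint
    _ = ∫ t, (∫ x in F, divergence (fun y => φ (y + t)) x) * η.normed volume t := by
        refine integral_congr_ae (Eventually.of_forall fun t => ?_)
        simp only [← mul_assoc]
        rw [integral_mul_const, htrans]
    _ ≤ ∫ t, (perimeter F).toReal * η.normed volume t := by
        refine integral_mono ?_ (hηi.const_mul _) fun t => ?_
        · refine (hint.integral_prod_right).congr (Eventually.of_forall fun t => ?_)
          simp only [← mul_assoc]
          rw [integral_mul_const, htrans]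
        · exact mul_le_mul_of_nonneg_right (integral_le_perimeter (hφ.comp_add_right t) hP)
            (η.nonneg_normed t)
    _ = (perimeter F).toReal := by rw [integral_const_mul, η.integral_normed, mul_one]

theorem locallyIntegrable_indicator_one {F : Set Plane} (hF : MeasurableSet F) :
    LocallyIntegrable (F.indicator (1 : Plane → ℝ)) volume := by
  refine (locallyIntegrable_const (1 : ℝ)).mono
    (measurable_one.indicator hF).aestronglyMeasurable (Eventually.of_forall fun x => ?_)
  by_cases hx : x ∈ F <;> simp [hx]

theorem contDiff_mollify (η : ContDiffBump (0 : Plane)) {F : Set Plane} (hF : MeasurableSet F) :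
    ContDiff ℝ 2 (mollify η F) :=
  η.hasCompactSupport_normed.contDiff_convolution_left _ η.contDiff_normed
    (locallyIntegrable_indicator_one hF)

theorem hasCompactSupport_mollify (η : ContDiffBump (0 : Plane)) {F : Set Plane}
    (hb : Bornology.IsBounded F) : HasCompactSupport (mollify η F) := by
  refine η.hasCompactSupport_normed.convolution _ ?_
  refine HasCompactSupport.of_support_subset_isCompact hb.isCompact_closure ?_
  intro x hx
  by_contra h
  exact hx (indicator_of_notMem (fun hxF => h (subset_closure hxF)) _)

theorem mollify_nonneg (η : ContDiffBump (0 : Plane)) (F : Set Plane) (x : Plane) :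
    0 ≤ mollify η F x := by
  refine integral_nonneg fun t => ?_
  simp only [ContinuousLinearMap.lsmul_apply, smul_eq_mul]
  exact mul_nonneg (η.nonneg_normed t) (indicator_nonneg (fun _ _ => zero_le_one) _)

/-- The isoperimetric inequality for bounded sets. -/
theorem isoperimetric_of_isBounded {F : Set Plane} (hF : MeasurableSet F)
    (hb : Bornology.IsBounded F) :
    ENNReal.ofReal (2 * √Real.pi) * volume F ^ (1 / 2 : ℝ) ≤ perimeter F := by
  rcases eq_or_ne (perimeter F) ∞ with hP | hP
  · simp [hP]
  -- The outer radius is a fixed multiple of the inner one; this is the hypothesis under which the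
  -- mollifications converge almost everywhere.
  let η : ℕ → ContDiffBump (0 : Plane) := fun n =>
    ⟨((n : ℝ) + 1)⁻¹, 2 * ((n : ℝ) + 1)⁻¹, by positivity, by
      have : 0 < ((n : ℝ) + 1)⁻¹ := by positivity
      linarith⟩
  have hsob (n : ℕ) : ENNReal.ofReal (2 * √Real.pi) *
      (∫⁻ x, ENNReal.ofReal (mollify (η n) F x) ^ 2) ^ (1 / 2 : ℝ) ≤ perimeter F := by
    refine (sobolev_inequality (contDiff_mollify _ hF) (hasCompactSupport_mollify _ hb)
      (mollify_nonneg _ _)).trans ?_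
    refine (lintegral_norm_fderiv_le (contDiff_mollify _ hF) (hasCompactSupport_mollify _ hb)
      fun φ hφ => integral_mollify_mul_divergence_le (η n) hF hP hφ).trans ?_
    rw [ENNReal.ofReal_toReal hP]
  have hae : ∀ᵐ x, Tendsto (fun n => mollify (η n) F x) atTop (𝓝 (F.indicator 1 x)) := by
    refine ContDiffBump.ae_convolution_tendsto_right_of_locallyIntegrable (K := 2) ?_ ?_
      (locallyIntegrable_indicator_one hF)
    · have : Tendsto (fun n : ℕ => 2 * ((n : ℝ) + 1)⁻¹) atTop (𝓝 (2 * 0)) :=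
        (tendsto_one_div_add_atTop_nhds_zero_nat.congr fun n => by rw [one_div]).const_mul 2
      simpa using this
    · exact Eventually.of_forall fun n => le_rfl
  -- Fatou suffices, as only a lower bound for the limiting L² norms is used.
  have hvol : volume F ≤ liminf (fun n => ∫⁻ x, ENNReal.ofReal (mollify (η n) F x) ^ 2) atTop := by
    calc volume F = ∫⁻ x, F.indicator 1 x := (lintegral_indicator_one hF).symm
      _ = ∫⁻ x, liminf (fun n => ENNReal.ofReal (mollify (η n) F x) ^ 2) atTop := by
          refine lintegral_congr_ae ?_
          filter_upwards [hae] with x hx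
          have h2 := (ENNReal.continuous_pow 2).tendsto _ |>.comp (ENNReal.tendsto_ofReal hx)
          refine Eq.trans ?_ h2.liminf_eq.symm
          by_cases hxF : x ∈ F <;> simp [hxF]
      _ ≤ _ := lintegral_liminf_le fun n =>
          ((contDiff_mollify (η n) hF).continuous.measurable.ennreal_ofReal).pow_const 2
  set c := ENNReal.ofReal (2 * √Real.pi) with hc
  have hc0 : c ≠ 0 := by
    have : 0 < √Real.pi := Real.sqrt_pos.2 Real.pi_pos
    simpa [hc] using Real.pi_pos
  have hbound (n : ℕ) :
      ∫⁻ x, ENNReal.ofReal (mollify (η n) F x) ^ 2 ≤ (perimeter F / c) ^ (2 : ℝ) := by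
    have h1 : (∫⁻ x, ENNReal.ofReal (mollify (η n) F x) ^ 2) ^ (1 / 2 : ℝ) ≤ perimeter F / c := by
      rw [ENNReal.le_div_iff_mul_le (Or.inl hc0) (Or.inl ENNReal.ofReal_ne_top), mul_comm]
      exact hsob n
    have h2 := ENNReal.rpow_le_rpow h1 (z := 2) (by norm_num)
    rwa [← ENNReal.rpow_mul, one_div, inv_mul_cancel₀ (by norm_num), ENNReal.rpow_one] at h2
  have h3 : volume F ≤ (perimeter F / c) ^ (2 : ℝ) :=
    hvol.trans (liminf_le_of_le (by isBoundedDefault) fun b hb => by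
      obtain ⟨n, hn⟩ := hb.exists
      exact hn.trans (hbound n))
  have h4 := ENNReal.rpow_le_rpow h3 (z := 1 / 2) (by norm_num)
  rw [← ENNReal.rpow_mul, one_div, mul_inv_cancel₀ (by norm_num), ENNReal.rpow_one,
    ENNReal.le_div_iff_mul_le (Or.inl hc0) (Or.inl ENNReal.ofReal_ne_top)] at h4
  rw [mul_comm, one_div]
  exact h4

/-! ### Smooth cutoffs of the Heaviside function -/

/-- Smooth approximations of the indicator function of the positive half-line. -/
noncomputable def cutoff (n : ℕ) (s : ℝ) : ℝ := Real.smoothTransition (((n : ℝ) + 1) * s)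

theorem contDiff_cutoff (n : ℕ) : ContDiff ℝ 1 (cutoff n) :=
  Real.smoothTransition.contDiff.comp (contDiff_const.mul contDiff_id)

theorem cutoff_nonneg (n : ℕ) (s : ℝ) : 0 ≤ cutoff n s := Real.smoothTransition.nonneg _

theorem cutoff_le_one (n : ℕ) (s : ℝ) : cutoff n s ≤ 1 := Real.smoothTransition.le_one _

theorem cutoff_of_nonpos (n : ℕ) {s : ℝ} (hs : s ≤ 0) : cutoff n s = 0 :=
  Real.smoothTransition.zero_of_nonpos (mul_nonpos_of_nonneg_of_nonpos (by positivity) hs)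

theorem monotone_cutoff (n : ℕ) : Monotone (cutoff n) := fun _ _ h =>
  Real.smoothTransition.monotone (mul_le_mul_of_nonneg_left h (by positivity))

theorem tendsto_cutoff (s : ℝ) :
    Tendsto (fun n => cutoff n s) atTop (𝓝 ((Ioi 0).indicator 1 s)) := by
  rcases le_or_gt s 0 with hs | hs
  · simp [cutoff_of_nonpos _ hs, hs]
  · rw [indicator_of_mem (show s ∈ Ioi 0 from hs), Pi.one_apply]
    refine tendsto_const_nhds.congr' ?_
    obtain ⟨N, hN⟩ := exists_nat_gt (1 / s)
    filter_upwards [eventually_ge_atTop N] with n hn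
    refine (Real.smoothTransition.one_of_one_le ?_).symm
    have h1 : (N : ℝ) ≤ n := by exact_mod_cast hn
    rw [div_lt_iff₀ hs] at hN
    nlinarith

theorem hasDerivAt_cutoff (n : ℕ) (s : ℝ) : HasDerivAt (cutoff n) (deriv (cutoff n) s) s :=
  ((contDiff_cutoff n).differentiable one_ne_zero s).hasDerivAt

theorem deriv_cutoff_nonneg (n : ℕ) (s : ℝ) : 0 ≤ deriv (cutoff n) s :=
  (monotone_cutoff n).deriv_nonneg

theorem continuous_deriv_cutoff (n : ℕ) : Continuous (deriv (cutoff n)) :=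
  (contDiff_cutoff n).continuous_deriv le_rfl

theorem deriv_cutoff_of_neg (n : ℕ) {s : ℝ} (hs : s < 0) : deriv (cutoff n) s = 0 := by
  have : cutoff n =ᶠ[𝓝 s] fun _ => 0 := by
    filter_upwards [Iio_mem_nhds hs] with t ht using cutoff_of_nonpos n (le_of_lt ht)
  rw [this.deriv_eq, deriv_const]

theorem tendsto_cutoff_atTop (n : ℕ) : Tendsto (cutoff n) atTop (𝓝 1) := by
  refine tendsto_const_nhds.congr' ?_
  filter_upwards [eventually_ge_atTop 1] with s hs
  refine (Real.smoothTransition.one_of_one_le ?_).symm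
  nlinarith [(Nat.cast_nonneg n : (0 : ℝ) ≤ n)]

theorem lintegral_deriv_cutoff_le (n : ℕ) :
    ∫⁻ s, ENNReal.ofReal (deriv (cutoff n) s) ≤ 1 := by
  have h1 := integral_Ioi_of_hasDerivAt_of_nonneg (a := 0) (l := 1)
    (contDiff_cutoff n).continuous.continuousWithinAt (fun x _ => hasDerivAt_cutoff n x)
    (fun x _ => deriv_cutoff_nonneg n x) (tendsto_cutoff_atTop n)
  have h2 := integrableOn_Ioi_deriv_of_nonneg (a := 0) (l := 1)
    (contDiff_cutoff n).continuous.continuousWithinAt (fun x _ => hasDerivAt_cutoff n x)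
    (fun x _ => deriv_cutoff_nonneg n x) (tendsto_cutoff_atTop n)
  have h3 : ∫⁻ s in Ioi (0 : ℝ), ENNReal.ofReal (deriv (cutoff n) s) = 1 := by
    rw [← ofReal_integral_eq_lintegral_ofReal h2
      (Eventually.of_forall fun x => deriv_cutoff_nonneg n x), h1, cutoff_of_nonpos n le_rfl]
    simp
  have h4 : ∫⁻ s in Iio (0 : ℝ), ENNReal.ofReal (deriv (cutoff n) s) = 0 := by
    rw [setLIntegral_congr_fun measurableSet_Iio (g := fun _ => 0)
      fun s hs => by simp [deriv_cutoff_of_neg n hs]]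
    simp
  rw [← lintegral_add_compl _ (measurableSet_Ioi (a := (0 : ℝ))), compl_Ioi, h3,
    setLIntegral_congr Iio_ae_eq_Iic.symm, h4, add_zero]

/-! ### Cutting a set along a level set -/

/-- `ENNReal.ofReal` is additive only on nonnegative numbers, so a field with negative integral is
first replaced by the zero field. This allows the two suprema to be tested by one pair of fields at
a time. -/
theorem perimeter_add_perimeter_le {A B : Set Plane} {c : ℝ≥0∞}
    (h : ∀ φ ψ, IsTestField φ → IsTestField ψ →
      ENNReal.ofReal ((∫ x in A, divergence φ x) + ∫ x in B, divergence ψ x) ≤ c) :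
    perimeter A + perimeter B ≤ c := by
  have aux (C : Set Plane) (φ : Plane → Plane) (hφ : IsTestField φ) : ∃ φ', IsTestField φ' ∧
      ENNReal.ofReal (∫ x in C, divergence φ x) = ENNReal.ofReal (∫ x in C, divergence φ' x) ∧
      0 ≤ ∫ x in C, divergence φ' x := by
    rcases le_or_gt 0 (∫ x in C, divergence φ x) with h0 | h0
    · exact ⟨φ, hφ, rfl, h0⟩
    · refine ⟨_, isTestField_zero, ?_⟩
      have : divergence (fun _ => (0 : Plane)) = fun _ => 0 := by
        ext x; simp [divergence]
      simp [this, ENNReal.ofReal_of_nonpos h0.le]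
  refine ENNReal.biSup_add_biSup_le' ⟨_, isTestField_zero⟩ ⟨_, isTestField_zero⟩ ?_
  intro φ hφ ψ hψ
  obtain ⟨φ', hφ', e1, n1⟩ := aux A φ hφ
  obtain ⟨ψ', hψ', e2, n2⟩ := aux B ψ hψ
  rw [e1, e2, ← ENNReal.ofReal_add n1 n2]
  exact h φ' ψ' hφ' hψ'

theorem fderiv_cutoff_comp (n : ℕ) {w : Plane → ℝ} (hw : ContDiff ℝ 1 w) (x v : Plane) :
    fderiv ℝ (fun y => cutoff n (w y)) x v = deriv (cutoff n) (w x) * fderiv ℝ w x v := by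
  have h1 : HasFDerivAt w (fderiv ℝ w x) x := (hw.differentiable one_ne_zero x).hasFDerivAt
  have h2 : HasFDerivAt (fun y => cutoff n (w y)) (deriv (cutoff n) (w x) • fderiv ℝ w x) x :=
    (hasDerivAt_cutoff n (w x)).comp_hasFDerivAt x h1
  rw [h2.fderiv]
  simp

/-- The cutoffs of the superlevel set `{0 < w}` converge. -/
theorem tendsto_integral_cutoff_mul {w : Plane → ℝ} (hw : ContDiff ℝ 1 w) {f : Plane → ℝ}
    {Ω : Set Plane} (hf : IntegrableOn f Ω) :
    Tendsto (fun n => ∫ x in Ω, cutoff n (w x) * f x) atTop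
      (𝓝 (∫ x in Ω ∩ {x | 0 < w x}, f x)) := by
  have hm : MeasurableSet {x | 0 < w x} := measurableSet_lt measurable_const hw.continuous.measurable
  have e : ∫ x in Ω ∩ {x | 0 < w x}, f x =
      ∫ x in Ω, (Ioi (0 : ℝ)).indicator 1 (w x) * f x := by
    rw [← setIntegral_indicator hm]
    refine integral_congr_ae (Eventually.of_forall fun x => ?_)
    by_cases hx : 0 < w x <;> simp [hx]
  rw [e]
  refine tendsto_integral_of_dominated_convergence (fun x => ‖f x‖) (fun n => ?_) hf.norm
    (fun n => Eventually.of_forall fun x => ?_) (Eventually.of_forall fun x => ?_)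
  · exact ((contDiff_cutoff n).continuous.comp hw.continuous).aestronglyMeasurable.mul
      hf.aestronglyMeasurable
  · rw [norm_mul, Real.norm_of_nonneg (cutoff_nonneg _ _)]
    exact mul_le_of_le_one_left (norm_nonneg _) (cutoff_le_one _ _)
  · exact (tendsto_cutoff _).mul_const _

/-- Cutting a set by a superlevel set of a `1`-Lipschitz `C¹` function. -/
theorem perimeter_cut_le {Ω : Set Plane} {w : Plane → ℝ}
    (hw : ContDiff ℝ 1 w) (hw1 : ∀ x, ‖fderiv ℝ w x‖ ≤ 1) :
    perimeter (Ω ∩ {x | 0 < w x}) + perimeter (Ω \ {x | 0 < w x}) ≤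
      perimeter Ω +
        2 * liminf (fun n => ∫⁻ x in Ω, ENNReal.ofReal (deriv (cutoff n) (w x))) atTop := by
  refine perimeter_add_perimeter_le fun φ ψ hφ hψ => ?_
  have hm : MeasurableSet {x | 0 < w x} := measurableSet_lt measurable_const hw.continuous.measurable
  have hiφ := hφ.integrable_divergence.integrableOn (s := Ω)
  have hiψ := hψ.integrable_divergence.integrableOn (s := Ω)
  have hgc (n : ℕ) : ContDiff ℝ 1 fun x => cutoff n (w x) := (contDiff_cutoff n).comp hw
  have hgi (n : ℕ) {φ : Plane → Plane} (hφ : IsTestField φ) :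
      IntegrableOn (fun x => cutoff n (w x) * divergence φ x) Ω := by
    refine (((hgc n).continuous.mul (continuous_divergence hφ.1)).integrable_of_hasCompactSupport
      ?_).integrableOn
    exact (hasCompactSupport_divergence hφ.2.1).mul_left
  have hlim : Tendsto (fun n => ENNReal.ofReal ((∫ x in Ω, cutoff n (w x) * divergence φ x) +
      ((∫ x in Ω, divergence ψ x) - ∫ x in Ω, cutoff n (w x) * divergence ψ x))) atTop
      (𝓝 (ENNReal.ofReal ((∫ x in Ω ∩ {x | 0 < w x}, divergence φ x) +
        ∫ x in Ω \ {x | 0 < w x}, divergence ψ x))) := by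
    refine ENNReal.tendsto_ofReal ?_
    have e : ∫ x in Ω \ {x | 0 < w x}, divergence ψ x =
        (∫ x in Ω, divergence ψ x) - ∫ x in Ω ∩ {x | 0 < w x}, divergence ψ x := by
      rw [← integral_inter_add_sdiff hm hiψ]; ring
    rw [e]
    exact (tendsto_integral_cutoff_mul hw hiφ).add
      (tendsto_const_nhds.sub (tendsto_integral_cutoff_mul hw hiψ))
  rw [← hlim.liminf_eq, ← ENNReal.liminf_const_mul_of_ne_top (by norm_num),
    ← liminf_const_add atTop _ (perimeter Ω) (by isBoundedDefault) (by isBoundedDefault)]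
  refine liminf_le_liminf (Eventually.of_forall fun n => ?_)
  -- Glue φ and ψ along the level set. Convexity keeps the norm at most 1. The divergence acquires
  -- the extra term cutoff'(w)·∇w·(φ-ψ); since |∇w| ≤ 1 and |φ-ψ| ≤ 2, this produces the factor 2.
  set χ : Plane → Plane := fun x =>
    cutoff n (w x) • φ x + (1 - cutoff n (w x)) • ψ x with hχ
  have hgc' : ContDiff ℝ 1 fun x => 1 - cutoff n (w x) := contDiff_const.sub (hgc n)
  have hχt : IsTestField χ := by
    refine ⟨((hgc n).smul hφ.1).add (hgc'.smul hψ.1), ?_, fun x => ?_⟩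
    · exact (HasCompactSupport.smul_left (f := fun x => cutoff n (w x)) hφ.2.1).add
        (HasCompactSupport.smul_left (f := fun x => 1 - cutoff n (w x)) hψ.2.1)
    · have h0 := cutoff_nonneg n (w x)
      have h1 := cutoff_le_one n (w x)
      calc ‖χ x‖ ≤ cutoff n (w x) * ‖φ x‖ + (1 - cutoff n (w x)) * ‖ψ x‖ := by
            refine (norm_add_le _ _).trans (le_of_eq ?_)
            rw [norm_smul, norm_smul, Real.norm_of_nonneg h0, Real.norm_of_nonneg (by linarith)]
        _ ≤ cutoff n (w x) * 1 + (1 - cutoff n (w x)) * 1 := by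
            have := hφ.2.2 x
            have := hψ.2.2 x
            gcongr
        _ = 1 := by ring
  have hdiv (x : Plane) : divergence χ x = cutoff n (w x) * divergence φ x +
      (divergence ψ x - cutoff n (w x) * divergence ψ x) +
      deriv (cutoff n) (w x) * fderiv ℝ w x (φ x - ψ x) := by
    have h1 : ContDiff ℝ 1 fun x => cutoff n (w x) • φ x := (hgc n).smul hφ.1
    have h2 : ContDiff ℝ 1 fun x => (1 - cutoff n (w x)) • ψ x := hgc'.smul hψ.1
    rw [hχ, divergence_add h1 h2, divergence_smul (hgc n) hφ.1,
      divergence_smul hgc' hψ.1, fderiv_const_sub, neg_apply,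
      fderiv_cutoff_comp n hw, fderiv_cutoff_comp n hw, map_sub]
    ring
  have hKc : Continuous fun x => deriv (cutoff n) (w x) * fderiv ℝ w x (φ x - ψ x) :=
    ((continuous_deriv_cutoff n).comp hw.continuous).mul
      ((hw.continuous_fderiv one_ne_zero).clm_apply (hφ.1.continuous.sub hψ.1.continuous))
  have hKi : Integrable fun x => deriv (cutoff n) (w x) * fderiv ℝ w x (φ x - ψ x) := by
    refine hKc.integrable_of_hasCompactSupport ((hφ.2.1.sub hψ.2.1).mono fun x hx => ?_)
    rw [Function.mem_support] at hx ⊢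
    intro h0
    rw [Pi.sub_apply] at h0
    exact hx (by simp [h0])
  have hsum : (∫ x in Ω, cutoff n (w x) * divergence φ x) +
      ((∫ x in Ω, divergence ψ x) - ∫ x in Ω, cutoff n (w x) * divergence ψ x) =
      (∫ x in Ω, divergence χ x) +
        -∫ x in Ω, deriv (cutoff n) (w x) * fderiv ℝ w x (φ x - ψ x) := by
    have h1 : ∫ x in Ω, divergence χ x = (∫ x in Ω, cutoff n (w x) * divergence φ x) +
      ((∫ x in Ω, divergence ψ x) - ∫ x in Ω, cutoff n (w x) * divergence ψ x) +
        ∫ x in Ω, deriv (cutoff n) (w x) * fderiv ℝ w x (φ x - ψ x) := by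
      simp only [hdiv]
      rw [integral_add _ hKi.integrableOn, integral_add (hgi n hφ), integral_sub hiψ (hgi n hψ)]
      · exact hiψ.sub (hgi n hψ)
      · exact (hgi n hφ).add (hiψ.sub (hgi n hψ))
    rw [h1]; ring
  rw [hsum]
  refine ENNReal.ofReal_add_le.trans (add_le_add (ofReal_integral_le_perimeter hχt Ω) ?_)
  calc ENNReal.ofReal (-∫ x in Ω, deriv (cutoff n) (w x) * fderiv ℝ w x (φ x - ψ x))
      ≤ ‖∫ x in Ω, deriv (cutoff n) (w x) * fderiv ℝ w x (φ x - ψ x)‖ₑ := by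
        rw [Real.enorm_eq_ofReal_abs]
        exact ENNReal.ofReal_le_ofReal (neg_le_abs _)
    _ ≤ ∫⁻ x in Ω, ‖deriv (cutoff n) (w x) * fderiv ℝ w x (φ x - ψ x)‖ₑ :=
        enorm_integral_le_lintegral_enorm _
    _ ≤ ∫⁻ x in Ω, 2 * ENNReal.ofReal (deriv (cutoff n) (w x)) := by
        refine lintegral_mono fun x => ?_
        have h2 : 2 * ENNReal.ofReal (deriv (cutoff n) (w x)) =
            ENNReal.ofReal (2 * deriv (cutoff n) (w x)) := by
          rw [ENNReal.ofReal_mul (by norm_num), ENNReal.ofReal_ofNat]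
        rw [Real.enorm_eq_ofReal_abs, h2]
        refine ENNReal.ofReal_le_ofReal ?_
        rw [abs_mul, abs_of_nonneg (deriv_cutoff_nonneg _ _), mul_comm]
        refine mul_le_mul_of_nonneg_right ?_ (deriv_cutoff_nonneg _ _)
        rw [← Real.norm_eq_abs]
        refine ((fderiv ℝ w x).le_opNorm _).trans ?_
        calc ‖fderiv ℝ w x‖ * ‖φ x - ψ x‖ ≤ 1 * (1 + 1) := by
              gcongr
              · exact hw1 x
              · exact (norm_sub_le _ _).trans (add_le_add (hφ.2.2 x) (hψ.2.2 x))
          _ = 2 := by norm_num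
    _ = 2 * ∫⁻ x in Ω, ENNReal.ofReal (deriv (cutoff n) (w x)) :=
        lintegral_const_mul' _ _ (by norm_num)

/-- The cutting terms along all the level sets of `w` add up to at most the mass. -/
theorem lintegral_liminf_cut_le (Ω : Set Plane) {w : Plane → ℝ}
    (hw : ContDiff ℝ 1 w) :
    ∫⁻ t, liminf (fun n => ∫⁻ x in Ω, ENNReal.ofReal (deriv (cutoff n) (w x - t))) atTop ≤
      volume Ω := by
  have hmeas (n : ℕ) :
      Measurable fun p : ℝ × Plane => ENNReal.ofReal (deriv (cutoff n) (w p.2 - p.1)) :=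
    ((continuous_deriv_cutoff n).comp
      ((hw.continuous.comp continuous_snd).sub continuous_fst)).measurable.ennreal_ofReal
  -- Fatou in t, then Tonelli: for each n, every point x contributes the integral of the derivative
  -- of one cutoff, at most 1.
  refine (lintegral_liminf_le fun n => (hmeas n).lintegral_prod_right').trans ?_
  refine liminf_le_of_le (by isBoundedDefault) fun b hb => ?_
  obtain ⟨n, hn⟩ := hb.exists
  refine hn.trans ?_
  rw [lintegral_lintegral_swap (hmeas n).aemeasurable]
  calc ∫⁻ x in Ω, ∫⁻ t, ENNReal.ofReal (deriv (cutoff n) (w x - t)) ≤ ∫⁻ x in Ω, 1 := by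
        refine lintegral_mono fun x => ?_
        rw [lintegral_sub_left_eq_self (fun t => ENNReal.ofReal (deriv (cutoff n) t)) (w x)]
        exact lintegral_deriv_cutoff_le n
    _ = volume Ω := by simp

/-! ### Truncation to bounded sets and the isoperimetric inequality for finite mass -/

theorem contDiff_sqrt_one_add_norm_sq : ContDiff ℝ 1 fun x : Plane => √(1 + ‖x‖ ^ 2) :=
  (contDiff_const.add (contDiff_norm_sq ℝ)).sqrt fun x => by positivity

theorem norm_fderiv_sqrt_one_add_norm_sq_le (x : Plane) :
    ‖fderiv ℝ (fun x : Plane => √(1 + ‖x‖ ^ 2)) x‖ ≤ 1 := by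
  refine norm_fderiv_le_of_lipschitz (C := 1) ℝ (LipschitzWith.of_dist_le_mul fun y z => ?_)
  rw [NNReal.coe_one, one_mul, Real.dist_eq, dist_eq_norm]
  have aux (y z : Plane) : √(1 + ‖y‖ ^ 2) ≤ √(1 + ‖z‖ ^ 2) + ‖y - z‖ := by
    rw [Real.sqrt_le_left (by positivity)]
    have h1 : ‖y‖ ≤ ‖z‖ + ‖y - z‖ := by
      have := norm_add_le z (y - z)
      simpa using this
    have h2 := Real.sq_sqrt (show 0 ≤ 1 + ‖z‖ ^ 2 by positivity)
    have h3 : ‖z‖ ≤ √(1 + ‖z‖ ^ 2) := Real.le_sqrt_of_sq_le (by linarith)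
    nlinarith [norm_nonneg (y - z), norm_nonneg y, norm_nonneg z]
  have h1 := aux y z
  have h2 := aux z y
  rw [norm_sub_rev] at h2
  rw [abs_le]
  constructor <;> linarith

/-- A set of finite measure is approximated by bounded subsets, without increasing the perimeter
by much. -/
theorem exists_isBounded_truncation {A : Set Plane} (hA : MeasurableSet A) (hfin : volume A ≠ ∞)
    {δ : ℝ≥0∞} (hδ : δ ≠ 0) :
    ∃ A' ⊆ A, MeasurableSet A' ∧ Bornology.IsBounded A' ∧ volume (A \ A') ≤ δ ∧
      perimeter A' ≤ perimeter A + δ := by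
  -- A smooth 1-Lipschitz replacement for the norm, so that its sublevel sets are bounded and the
  -- cutting inequality applies.
  set w : Plane → ℝ := fun x => √(1 + ‖x‖ ^ 2) with hw
  have hwc : ContDiff ℝ 1 w := contDiff_sqrt_one_add_norm_sq
  have htail : Tendsto (fun n : ℕ => volume (A ∩ {x | (n : ℝ) < w x})) atTop (𝓝 0) := by
    have hm (n : ℕ) : MeasurableSet (A ∩ {x | (n : ℝ) < w x}) :=
      hA.inter (measurableSet_lt measurable_const hwc.continuous.measurable)
    have h := tendsto_measure_iInter_atTop (μ := volume)
      (s := fun n : ℕ => A ∩ {x | (n : ℝ) < w x}) (fun n => (hm n).nullMeasurableSet)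
      (fun n k hnk x hx => ⟨hx.1, lt_of_le_of_lt (Nat.cast_le.2 hnk) hx.2.out⟩)
      ⟨0, measure_ne_top_of_subset inter_subset_left hfin⟩
    have he : ⋂ n : ℕ, A ∩ {x | (n : ℝ) < w x} = ∅ := by
      refine eq_empty_of_forall_notMem fun x hx => ?_
      obtain ⟨n, hn⟩ := exists_nat_gt (w x)
      exact lt_asymm hn (mem_iInter.1 hx n).2.out
    rw [he, measure_empty] at h
    exact h
  obtain ⟨N, hN⟩ := (htail.eventually_le_const (pos_iff_ne_zero.2 hδ)).exists
  set κ : ℝ → ℝ≥0∞ := fun t =>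
    liminf (fun n => ∫⁻ x in A, ENNReal.ofReal (deriv (cutoff n) (w x - t))) atTop with hκ
  -- If every cut beyond N cost more than δ/2, the total cost would be infinite, whereas it is at
  -- most the area of A.
  have hex : ∃ t : ℝ, (N : ℝ) < t ∧ κ t ≤ δ / 2 := by
    by_contra! hcon
    have h1 : ∫⁻ t in Ioi (N : ℝ), δ / 2 ≤ volume A := by
      calc ∫⁻ t in Ioi (N : ℝ), δ / 2 ≤ ∫⁻ t in Ioi (N : ℝ), κ t :=
            setLIntegral_mono' measurableSet_Ioi fun t ht => (hcon t ht).le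
        _ ≤ ∫⁻ t, κ t := setLIntegral_le_lintegral _ _
        _ ≤ volume A := lintegral_liminf_cut_le A hwc
    rw [setLIntegral_const, Real.volume_Ioi, ENNReal.mul_top (by simpa using hδ), top_le_iff] at h1
    exact hfin h1
  obtain ⟨t, ht, hκt⟩ := hex
  have hwt : ContDiff ℝ 1 fun x => w x - t := hwc.sub contDiff_const
  have hcut := perimeter_cut_le (Ω := A) hwt (fun x => by
    rw [fderiv_sub_const]; exact norm_fderiv_sqrt_one_add_norm_sq_le x)
  have hm : MeasurableSet {x | 0 < w x - t} :=
    measurableSet_lt measurable_const hwt.continuous.measurable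
  refine ⟨A \ {x | 0 < w x - t}, sdiff_subset, hA.diff hm, ?_, ?_, ?_⟩
  · refine (Metric.isBounded_closedBall (x := (0 : Plane)) (r := t)).subset fun x hx => ?_
    have h1 : w x ≤ t := by
      have := hx.2
      simp only [mem_ofPred_eq, not_lt] at this
      linarith
    rw [mem_closedBall_zero_iff]
    exact (Real.le_sqrt_of_sq_le (by linarith : ‖x‖ ^ 2 ≤ 1 + ‖x‖ ^ 2)).trans h1
  · refine (measure_mono fun x hx => ?_).trans hN
    have h2 : 0 < w x - t := by
      by_contra h
      exact hx.2 ⟨hx.1, h⟩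
    exact ⟨hx.1, by simp only [mem_ofPred_eq]; linarith⟩
  · refine (le_add_self).trans (hcut.trans ?_)
    gcongr
    calc 2 * κ t ≤ 2 * (δ / 2) := by gcongr
      _ = δ := ENNReal.mul_div_cancel (by norm_num) (by norm_num)

/-- The isoperimetric inequality in the plane. -/
theorem isoperimetric_inequality {F : Set Plane} (hF : MeasurableSet F) (hfin : volume F ≠ ∞) :
    ENNReal.ofReal (2 * √Real.pi) * volume F ^ (1 / 2 : ℝ) ≤ perimeter F := by
  set c := ENNReal.ofReal (2 * √Real.pi) with hc
  have step : ∀ δ : ℝ≥0∞, 0 < δ → c * volume F ^ (1 / 2 : ℝ) ≤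
      perimeter F + δ + c * δ ^ (1 / 2 : ℝ) := by
    intro δ hδ
    obtain ⟨F', hsub, hm, hb, hv, hp⟩ := exists_isBounded_truncation hF hfin hδ.ne'
    calc c * volume F ^ (1 / 2 : ℝ) ≤ c * (volume F' ^ (1 / 2 : ℝ) + δ ^ (1 / 2 : ℝ)) := by
          gcongr
          refine le_trans ?_ (ENNReal.rpow_add_le_add_rpow _ _ (by norm_num) (by norm_num))
          gcongr
          calc volume F ≤ volume F' + volume (F \ F') := by
                rw [← measure_union disjoint_sdiff_right (hF.diff hm), union_sdiff_cancel hsub]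
            _ ≤ _ := by gcongr
      _ = c * volume F' ^ (1 / 2 : ℝ) + c * δ ^ (1 / 2 : ℝ) := mul_add _ _ _
      _ ≤ _ := by
          gcongr
          exact (isoperimetric_of_isBounded hm hb).trans hp
  have hlim : Tendsto (fun δ : ℝ≥0∞ => perimeter F + δ + c * δ ^ (1 / 2 : ℝ)) (𝓝[>] 0)
      (𝓝 (perimeter F + 0 + c * 0 ^ (1 / 2 : ℝ))) := by
    refine Tendsto.mono_left ?_ nhdsWithin_le_nhds
    refine Tendsto.add (tendsto_const_nhds.add tendsto_id) ?_
    exact ENNReal.Tendsto.const_mul (ENNReal.continuous_rpow_const.tendsto 0)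
      (Or.inr ENNReal.ofReal_ne_top)
  rw [ENNReal.zero_rpow_of_pos (by norm_num), mul_zero, add_zero, add_zero] at hlim
  exact ge_of_tendsto hlim (by filter_upwards [self_mem_nhdsWithin] with δ hδ using step δ hδ)

/-! ### The perimeter of a disk -/

/-- In polar coordinates the weighted integrand is π times the derivative of -cutoff(R² - y²), so
the integral telescopes to π·cutoff(R²). -/
theorem integral_deriv_cutoff_radial_le (n : ℕ) (R : ℝ) :
    ∫⁻ x : Plane, ENNReal.ofReal (deriv (cutoff n) (R ^ 2 - ‖x‖ ^ 2)) ≤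
      ENNReal.ofReal Real.pi := by
  set g : ℝ → ℝ := fun y => deriv (cutoff n) (R ^ 2 - y ^ 2) with hg
  have hgc : Continuous g := (continuous_deriv_cutoff n).comp (by fun_prop)
  have hint : Integrable fun x : Plane => g ‖x‖ := by
    refine (hgc.comp continuous_norm).integrable_of_hasCompactSupport ?_
    refine HasCompactSupport.of_support_subset_isCompact
      (isCompact_closedBall (0 : Plane) |R|) fun x hx => ?_
    rw [mem_closedBall_zero_iff]
    by_contra! h
    refine hx (deriv_cutoff_of_neg n ?_)
    have := pow_lt_pow_left₀ h (abs_nonneg R) two_ne_zero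
    rw [sq_abs] at this
    linarith
  have hderiv (y : ℝ) : HasDerivAt (fun y => -cutoff n (R ^ 2 - y ^ 2)) (2 * (y * g y)) y := by
    have h1 : HasDerivAt (fun y : ℝ => R ^ 2 - y ^ 2) (-(2 * y)) y := by
      simpa using (hasDerivAt_pow 2 y).const_sub (R ^ 2)
    have := ((hasDerivAt_cutoff n (R ^ 2 - y ^ 2)).comp y h1).neg
    exact this.congr_deriv (by simp only [hg]; ring)
  have hrad : ∫ y in Ioi (0 : ℝ), 2 * (y * g y) = 0 - -cutoff n (R ^ 2 - 0 ^ 2) := by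
    refine integral_Ioi_of_hasDerivAt_of_nonneg ?_ (fun y _ => hderiv y) (fun y hy => ?_) ?_
    · exact (hderiv 0).continuousAt.continuousWithinAt
    · have hy0 : 0 < y := hy
      have := deriv_cutoff_nonneg n (R ^ 2 - y ^ 2)
      positivity
    · refine tendsto_const_nhds.congr' ?_
      filter_upwards [eventually_ge_atTop |R|] with y hy
      have := pow_le_pow_left₀ (abs_nonneg R) hy 2
      rw [sq_abs] at this
      rw [cutoff_of_nonpos n (by linarith), neg_zero]
  rw [← ofReal_integral_eq_lintegral_ofReal hint
    (Eventually.of_forall fun x => deriv_cutoff_nonneg n _)]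
  refine ENNReal.ofReal_le_ofReal ?_
  have h := integral_fun_norm_addHaar (volume : Measure Plane) g
  rw [volume_real_ball zero_le_one] at h
  simp only [finrank_euclideanSpace, Fintype.card_fin, Nat.add_one_sub_one, pow_one, smul_eq_mul,
    one_pow, mul_one, nsmul_eq_mul, Nat.cast_ofNat] at h
  rw [integral_const_mul] at hrad
  have h1 := cutoff_le_one n (R ^ 2 - 0 ^ 2)
  rw [h]
  nlinarith [Real.pi_pos]

/-- The perimeter of a disk is at most the length of the circle. -/
theorem perimeter_ball_le {R : ℝ} (hR : 0 ≤ R) (a : Plane) :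
    perimeter (Metric.ball a R) ≤ ENNReal.ofReal (2 * Real.pi * R) := by
  have key : perimeter (Metric.ball 0 R) ≤ ENNReal.ofReal (2 * Real.pi * R) := by
    refine iSup₂_le fun φ hφ => ?_
    -- This defining function is smooth at the centre, unlike R - ‖x‖. Its gradient has norm 2‖x‖ ≤
    -- 2R wherever the derivative of the cutoff is nonzero, and 2R times the radial bound π is the
    -- length of the circle.
    set w : Plane → ℝ := fun x => R ^ 2 - ‖x‖ ^ 2 with hw
    have hwc : ContDiff ℝ 1 w := contDiff_const.sub (contDiff_norm_sq ℝ)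
    have hball : Metric.ball (0 : Plane) R = univ ∩ {x | 0 < w x} := by
      ext x
      simp only [mem_ball_zero_iff, univ_inter, mem_ofPred_eq, hw, sub_pos]
      exact (pow_lt_pow_iff_left₀ (norm_nonneg x) hR two_ne_zero).symm
    have hlim := ENNReal.tendsto_ofReal
      (tendsto_integral_cutoff_mul (Ω := univ) hwc hφ.integrable_divergence.integrableOn)
    rw [← hball] at hlim
    refine le_of_tendsto hlim (Eventually.of_forall fun n => ?_)
    have hgc : ContDiff ℝ 1 fun x => cutoff n (w x) := (contDiff_cutoff n).comp hwc
    rw [setIntegral_univ, integral_mul_divergence hgc hφ.1 hφ.2.1]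
    have hdw (x v : Plane) : fderiv ℝ w x v = -(2 * inner ℝ x v) := by
      rw [hw, fderiv_const_sub, fderiv_norm_sq_apply]
      simp
    calc ENNReal.ofReal (-∫ x, fderiv ℝ (fun y => cutoff n (w y)) x (φ x))
        ≤ ‖∫ x, fderiv ℝ (fun y => cutoff n (w y)) x (φ x)‖ₑ := by
          rw [Real.enorm_eq_ofReal_abs]
          exact ENNReal.ofReal_le_ofReal (neg_le_abs _)
      _ ≤ ∫⁻ x, ‖fderiv ℝ (fun y => cutoff n (w y)) x (φ x)‖ₑ :=
          enorm_integral_le_lintegral_enorm _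
      _ ≤ ∫⁻ x, ENNReal.ofReal (2 * R) * ENNReal.ofReal (deriv (cutoff n) (w x)) := by
          refine lintegral_mono fun x => ?_
          rw [← ENNReal.ofReal_mul (by positivity), Real.enorm_eq_ofReal_abs]
          refine ENNReal.ofReal_le_ofReal ?_
          rw [fderiv_cutoff_comp n hwc, abs_mul, abs_of_nonneg (deriv_cutoff_nonneg _ _), mul_comm]
          rcases lt_or_ge (w x) 0 with h0 | h0
          · simp [deriv_cutoff_of_neg n h0]
          · refine mul_le_mul_of_nonneg_right ?_ (deriv_cutoff_nonneg _ _)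
            have hx : ‖x‖ ≤ R := by
              simp only [hw, sub_nonneg] at h0
              exact (pow_le_pow_iff_left₀ (norm_nonneg x) hR two_ne_zero).1 h0
            rw [hdw, abs_neg, abs_mul, abs_two]
            have := abs_real_inner_le_norm x (φ x)
            nlinarith [hφ.2.2 x, norm_nonneg x, norm_nonneg (φ x)]
      _ ≤ ENNReal.ofReal (2 * R) * ENNReal.ofReal Real.pi := by
          rw [lintegral_const_mul' _ _ ENNReal.ofReal_ne_top]
          gcongr
          exact integral_deriv_cutoff_radial_le n R
      _ = ENNReal.ofReal (2 * Real.pi * R) := by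
          rw [← ENNReal.ofReal_mul (by positivity)]; ring_nf
  refine le_trans (le_of_eq_of_le ?_ (perimeter_preimage_add_le _ (-a))) key
  congr 1
  ext x
  simp [dist_eq_norm, sub_eq_add_neg]

/-! ### Energy of disjoint unions and of distant sets -/

/-- The perimeter is subadditive on disjoint unions. -/
theorem perimeter_union_le {A B : Set Plane} (hB : MeasurableSet B) (h : Disjoint A B) :
    perimeter (A ∪ B) ≤ perimeter A + perimeter B := by
  refine iSup₂_le fun φ hφ => ?_
  rw [setIntegral_union h hB hφ.integrable_divergence.integrableOn
    hφ.integrable_divergence.integrableOn]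
  exact ENNReal.ofReal_add_le.trans (add_le_add (ofReal_integral_le_perimeter hφ A)
    (ofReal_integral_le_perimeter hφ B))

/-- The interaction between two sets. -/
noncomputable def mutualInteraction (α : ℝ) (A B : Set Plane) : ℝ≥0∞ :=
  ∫⁻ x in A, ∫⁻ y in B, (edist x y ^ α)⁻¹

theorem interaction_eq (α : ℝ) (A : Set Plane) : interaction α A = mutualInteraction α A A := rfl

theorem measurable_kernel (α : ℝ) :
    Measurable fun p : Plane × Plane => (edist p.1 p.2 ^ α)⁻¹ :=
  ((measurable_fst.edist measurable_snd).pow_const α).inv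

theorem mutualInteraction_comm (α : ℝ) (A B : Set Plane) :
    mutualInteraction α A B = mutualInteraction α B A := by
  unfold mutualInteraction
  rw [lintegral_lintegral_swap (measurable_kernel α).aemeasurable]
  simp only [edist_comm]

theorem mutualInteraction_union_left (α : ℝ) {A A' : Set Plane} (B : Set Plane)
    (hA' : MeasurableSet A') (h : Disjoint A A') :
    mutualInteraction α (A ∪ A') B = mutualInteraction α A B + mutualInteraction α A' B :=
  lintegral_union hA' h

theorem mutualInteraction_union_right (α : ℝ) (A : Set Plane) {B B' : Set Plane}
    (hB' : MeasurableSet B') (h : Disjoint B B') :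
    mutualInteraction α A (B ∪ B') = mutualInteraction α A B + mutualInteraction α A B' := by
  rw [mutualInteraction_comm, mutualInteraction_union_left α A hB' h, mutualInteraction_comm α B,
    mutualInteraction_comm α B']

theorem interaction_union (α : ℝ) {A B : Set Plane} (hB : MeasurableSet B) (h : Disjoint A B) :
    interaction α (A ∪ B) = interaction α A + interaction α B + 2 * mutualInteraction α A B := by
  simp only [interaction_eq]
  rw [mutualInteraction_union_left α _ hB h, mutualInteraction_union_right α _ hB h,
    mutualInteraction_union_right α _ hB h, mutualInteraction_comm α B A]
  ring

theorem interaction_mono (α : ℝ) {A B : Set Plane} (h : A ⊆ B) :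
    interaction α A ≤ interaction α B :=
  (lintegral_mono_set h).trans (lintegral_mono fun _ => lintegral_mono_set h)

theorem interaction_congr (α : ℝ) {A B : Set Plane} (h : A =ᵐ[volume] B) :
    interaction α A = interaction α B := by
  simp only [interaction, Measure.restrict_congr_set h]

theorem energy_congr (α : ℝ) {A B : Set Plane} (h : A =ᵐ[volume] B) :
    energy α A = energy α B := by
  rw [energy, energy, perimeter_congr h, interaction_congr α h]

theorem interaction_preimage_add (α : ℝ) (A : Set Plane) (a : Plane) :
    interaction α ((fun x => x + a) ⁻¹' A) = interaction α A := by
  have h := measurePreserving_add_right (volume : Measure Plane) a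
  have he := measurableEmbedding_addRight a
  unfold interaction
  rw [← h.setLIntegral_comp_preimage_emb he (fun x => ∫⁻ y in A, (edist x y ^ α)⁻¹) A]
  refine lintegral_congr fun x => ?_
  rw [← h.setLIntegral_comp_preimage_emb he (fun y => (edist (x + a) y ^ α)⁻¹) A]
  simp only [edist_add_right]

theorem energy_preimage_add_le (α : ℝ) (A : Set Plane) (a : Plane) :
    energy α ((fun x => x + a) ⁻¹' A) ≤ energy α A :=
  add_le_add (perimeter_preimage_add_le A a) (interaction_preimage_add α A a).le

theorem mutualInteraction_le_of_dist {α : ℝ} (hα : 0 ≤ α) {A B : Set Plane} (hA : MeasurableSet A)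
    (hB : MeasurableSet B) {D : ℝ} (h : ∀ x ∈ A, ∀ y ∈ B, D ≤ dist x y) :
    mutualInteraction α A B ≤ (ENNReal.ofReal D ^ α)⁻¹ * volume B * volume A := by
  calc mutualInteraction α A B ≤ ∫⁻ x in A, (ENNReal.ofReal D ^ α)⁻¹ * volume B := by
        refine setLIntegral_mono' hA fun x hx => ?_
        calc ∫⁻ y in B, (edist x y ^ α)⁻¹ ≤ ∫⁻ y in B, (ENNReal.ofReal D ^ α)⁻¹ := by
              refine setLIntegral_mono' hB fun y hy => ?_
              gcongr
              rw [edist_dist]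
              exact ENNReal.ofReal_le_ofReal (h x hx y hy)
          _ = _ := setLIntegral_const _ _
    _ = _ := setLIntegral_const _ _

/-- Two bounded sets can be put so far apart that their interaction is negligible. -/
theorem exists_energy_le_add {α : ℝ} (hα : 0 < α) {A B : Set Plane} (hA : MeasurableSet A)
    (hB : MeasurableSet B) (hA' : Bornology.IsBounded A) (hB' : Bornology.IsBounded B)
    {ε : ℝ≥0∞} (hε : ε ≠ 0) :
    ∃ G : Set Plane, MeasurableSet G ∧ Bornology.IsBounded G ∧
      volume G = volume A + volume B ∧ energy α G ≤ energy α A + energy α B + ε := by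
  obtain ⟨ρ, hρ⟩ := (hA'.union hB').subset_closedBall 0
  have hlim : Tendsto (fun D : ℝ => 2 * ((ENNReal.ofReal D ^ α)⁻¹ * volume B * volume A)) atTop
      (𝓝 0) := by
    have h1 : Tendsto (fun D : ℝ => (ENNReal.ofReal D ^ α)⁻¹) atTop (𝓝 0) := by
      rw [← ENNReal.inv_top]
      refine tendsto_inv_iff.2 ?_
      exact (ENNReal.tendsto_rpow_at_top hα).comp ENNReal.tendsto_ofReal_atTop
    have h2 := ENNReal.Tendsto.mul_const (b := volume B) h1 (Or.inr hB'.measure_lt_top.ne)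
    rw [zero_mul] at h2
    have h3 := ENNReal.Tendsto.mul_const (b := volume A) h2 (Or.inr hA'.measure_lt_top.ne)
    rw [zero_mul] at h3
    have h4 := ENNReal.Tendsto.const_mul (a := 2) h3 (Or.inr (by norm_num))
    rwa [mul_zero] at h4
  obtain ⟨D, hD, hD0⟩ := ((hlim.eventually_le_const (pos_iff_ne_zero.2 hε)).and
    (eventually_gt_atTop (max 0 (-ρ)))).exists
  have hDpos : 0 < D := (le_max_left _ _).trans_lt hD0
  -- Both sets lie in the closed ball of radius ρ about the origin, so a shift of length at least 2ρ
  -- + D leaves a gap of at least D.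
  set a : Plane := EuclideanSpace.single 0 (2 * ρ + D) with ha
  have hna : 2 * ρ + D ≤ ‖a‖ := by
    rw [ha, PiLp.norm_single, Real.norm_eq_abs]
    exact le_abs_self _
  set B₁ : Set Plane := (fun x => x + a) ⁻¹' B with hB₁
  have hB₁m : MeasurableSet B₁ := hB.preimage (measurable_add_const a)
  have hdist : ∀ x ∈ A, ∀ y ∈ B₁, D ≤ dist x y := by
    intro x hx y hy
    have h1 : ‖x‖ ≤ ρ := by simpa using hρ (Or.inl hx)
    have h2 : ‖y + a‖ ≤ ρ := by simpa using hρ (Or.inr hy)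
    have h3 : ‖a‖ ≤ ‖y + a‖ + ‖x‖ + ‖x - y‖ := by
      calc ‖a‖ = ‖(y + a) - x + (x - y)‖ := by congr 1; abel
        _ ≤ _ := (norm_add_le _ _).trans (by gcongr; exact norm_sub_le _ _)
    rw [dist_eq_norm]
    linarith
  have hdisj : Disjoint A B₁ := by
    rw [Set.disjoint_left]
    intro x hx hx'
    have := hdist x hx x hx'
    rw [dist_self] at this
    linarith
  have hvol : volume B₁ = volume B := measure_preimage_add_right _ _ _
  refine ⟨A ∪ B₁, hA.union hB₁m, hA'.union ?_, ?_, ?_⟩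
  · refine (Metric.isBounded_closedBall (x := -a) (r := ρ)).subset fun y hy => ?_
    have h2 : ‖y + a‖ ≤ ρ := by simpa using hρ (Or.inr hy)
    rw [Metric.mem_closedBall, dist_eq_norm, sub_neg_eq_add]
    exact h2
  · rw [measure_union hdisj hB₁m, hvol]
  · have h1 : 2 * mutualInteraction α A B₁ ≤ ε := by
      refine le_trans ?_ hD
      rw [← hvol]
      gcongr
      exact mutualInteraction_le_of_dist hα.le hA hB₁m hdist
    calc energy α (A ∪ B₁) ≤ (perimeter A + perimeter B₁) +
          (interaction α A + interaction α B₁ + 2 * mutualInteraction α A B₁) := by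
          rw [energy, interaction_union α hB₁m hdisj]
          gcongr
          exact perimeter_union_le hB₁m hdisj
      _ = energy α A + energy α B₁ + 2 * mutualInteraction α A B₁ := by
          simp only [energy]; ring
      _ ≤ _ := by
          gcongr
          exact energy_preimage_add_le α B a

/-! ### Scaling of the interaction -/

theorem lintegral_comp_smul {R : ℝ} (hR : 0 < R) (f : Plane → ℝ≥0∞) :
    ∫⁻ x, f x = ENNReal.ofReal (R ^ 2) * ∫⁻ x, f (R • x) := by
  have hemb : MeasurableEmbedding fun x : Plane => R • x :=
    (Homeomorph.smulOfNeZero R hR.ne').measurableEmbedding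
  rw [← hemb.lintegral_map, Measure.map_addHaar_smul volume hR.ne', lintegral_smul_measure,
    smul_eq_mul, ← mul_assoc, ← ENNReal.ofReal_mul (by positivity)]
  have : R ^ 2 * |(R ^ Module.finrank ℝ Plane)⁻¹| = 1 := by
    rw [finrank_euclideanSpace, Fintype.card_fin, abs_of_pos (by positivity)]
    field_simp
  rw [this, ENNReal.ofReal_one, one_mul]

theorem setLIntegral_ball_comp_smul {R : ℝ} (hR : 0 < R) (f : Plane → ℝ≥0∞) :
    ∫⁻ x in Metric.ball 0 R, f x =
      ENNReal.ofReal (R ^ 2) * ∫⁻ x in Metric.ball 0 1, f (R • x) := by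
  rw [← lintegral_indicator measurableSet_ball, ← lintegral_indicator measurableSet_ball,
    lintegral_comp_smul hR]
  congr 1
  refine lintegral_congr fun x => ?_
  have : R • x ∈ Metric.ball (0 : Plane) R ↔ x ∈ Metric.ball (0 : Plane) 1 := by
    rw [mem_ball_zero_iff, mem_ball_zero_iff, norm_smul, Real.norm_of_nonneg hR.le]
    constructor <;> intro h <;> nlinarith
  by_cases hx : x ∈ Metric.ball (0 : Plane) 1
  · rw [indicator_of_mem hx, indicator_of_mem (this.2 hx)]
  · rw [indicator_of_notMem hx, indicator_of_notMem (fun h => hx (this.1 h))]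

theorem interaction_ball_zero (α : ℝ) {R : ℝ} (hR : 0 < R) :
    interaction α (Metric.ball 0 R) =
      ENNReal.ofReal (R ^ (4 - α)) * interaction α (Metric.ball 0 1) := by
  have hpow : ENNReal.ofReal R ^ α = ENNReal.ofReal (R ^ α) := ENNReal.ofReal_rpow_of_pos hR
  have hne : ENNReal.ofReal (R ^ α) ≠ 0 := by
    rw [Ne, ENNReal.ofReal_eq_zero, not_le]; exact Real.rpow_pos_of_pos hR α
  have hker (x y : Plane) : (edist (R • x) (R • y) ^ α)⁻¹ =
      ENNReal.ofReal (R ^ (-α)) * (edist x y ^ α)⁻¹ := by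
    rw [edist_smul₀, ENNReal.smul_def, smul_eq_mul, ENNReal.mul_rpow_of_ne_top
      ENNReal.coe_ne_top (edist_ne_top _ _), ENNReal.mul_inv]
    · congr 1
      rw [Real.rpow_neg hR.le, ENNReal.ofReal_inv_of_pos (Real.rpow_pos_of_pos hR α), ← hpow]
      congr 2
      rw [← enorm_eq_nnnorm, Real.enorm_of_nonneg hR.le]
    · left
      rw [← enorm_eq_nnnorm, Real.enorm_of_nonneg hR.le, hpow]
      exact hne
    · left
      rw [← enorm_eq_nnnorm, Real.enorm_of_nonneg hR.le, hpow]
      exact ENNReal.ofReal_ne_top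
  unfold interaction
  rw [setLIntegral_ball_comp_smul hR]
  have h1 (x : Plane) : ∫⁻ y in Metric.ball 0 R, (edist (R • x) y ^ α)⁻¹ =
      ENNReal.ofReal (R ^ (2 - α)) * ∫⁻ y in Metric.ball 0 1, (edist x y ^ α)⁻¹ := by
    rw [setLIntegral_ball_comp_smul hR]
    simp only [hker]
    rw [lintegral_const_mul' _ _ ENNReal.ofReal_ne_top, ← mul_assoc,
      ← ENNReal.ofReal_mul (by positivity), ← Real.rpow_natCast R 2, ← Real.rpow_add hR]
    norm_num [sub_eq_add_neg]
  simp only [h1]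
  rw [lintegral_const_mul' _ _ ENNReal.ofReal_ne_top, ← mul_assoc,
    ← ENNReal.ofReal_mul (by positivity), ← Real.rpow_natCast R 2, ← Real.rpow_add hR]
  congr 3
  push_cast; ring

/-! ### The interaction of the unit disk -/

theorem edist_rpow_inv_eq (α : ℝ) {x y : Plane} (h : x ≠ y) :
    (edist x y ^ α)⁻¹ = ENNReal.ofReal (‖x - y‖ ^ (-α)) := by
  have hpos : 0 < ‖x - y‖ := norm_pos_iff.2 (sub_ne_zero.2 h)
  rw [edist_dist, dist_eq_norm, ENNReal.ofReal_rpow_of_pos hpos,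
    ← ENNReal.ofReal_inv_of_pos (Real.rpow_pos_of_pos hpos α), ← Real.rpow_neg hpos.le]

/-- The area of the intersection of two unit disks whose centers are at distance `r`. -/
noncomputable def lensArea (r : ℝ) : ℝ := 4 * ∫ u in Ioi (r / 2), √(1 - u ^ 2)

/-- `Real.sqrt` vanishes on negative numbers, so the integrand is supported in [-1, 1] and integrals
over half-lines need no upper limit. -/
theorem integrable_sqrt_one_sub_sq : Integrable fun u : ℝ => √(1 - u ^ 2) := by
  refine Continuous.integrable_of_hasCompactSupport (by fun_prop) ?_
  refine HasCompactSupport.of_support_subset_isCompact (isCompact_Icc (a := -1) (b := 1)) ?_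
  intro u hu
  by_contra h
  refine hu (Real.sqrt_eq_zero_of_nonpos ?_)
  rw [mem_Icc, ← abs_le, not_le] at h
  have := (one_lt_sq_iff_one_lt_abs u).2 h
  linarith

/-- When the centres sit on the first axis at distance r/2 on either side of the origin, the farther
centre decides membership; hence the single inequality in |x 0|. The slices are intervals. -/
theorem volume_lens_eq (r : ℝ) (hr : 0 ≤ r) :
    volume {x : Plane | (|x 0| + r / 2) ^ 2 + x 1 ^ 2 < 1} = ENNReal.ofReal (lensArea r) := by
  have hcont : Continuous fun p : ℝ × ℝ => (|p.1| + r / 2) ^ 2 + p.2 ^ 2 := by fun_prop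
  have hm : MeasurableSet {p : ℝ × ℝ | (|p.1| + r / 2) ^ 2 + p.2 ^ 2 < 1} :=
    (isOpen_lt hcont continuous_const).measurableSet
  have h1 : volume {x : Plane | (|x 0| + r / 2) ^ 2 + x 1 ^ 2 < 1} =
      volume {p : ℝ × ℝ | (|p.1| + r / 2) ^ 2 + p.2 ^ 2 < 1} :=
    measurePreserving_coordEquiv.measure_preimage hm.nullMeasurableSet
  have hslice (s : ℝ) : volume (Prod.mk s ⁻¹' {p : ℝ × ℝ | (|p.1| + r / 2) ^ 2 + p.2 ^ 2 < 1}) =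
      ENNReal.ofReal (2 * √(1 - (|s| + r / 2) ^ 2)) := by
    have : Prod.mk s ⁻¹' {p : ℝ × ℝ | (|p.1| + r / 2) ^ 2 + p.2 ^ 2 < 1} =
        Ioo (-√(1 - (|s| + r / 2) ^ 2)) (√(1 - (|s| + r / 2) ^ 2)) := by
      ext t
      rw [mem_Ioo, ← abs_lt, Real.lt_sqrt (abs_nonneg t), sq_abs]
      simp only [mem_preimage, mem_ofPred_eq]
      constructor <;> intro h <;> linarith
    rw [this, Real.volume_Ioo]
    congr 1; ring
  have hint : Integrable fun s : ℝ => 2 * √(1 - (|s| + r / 2) ^ 2) := by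
    refine Continuous.integrable_of_hasCompactSupport (by fun_prop) ?_
    refine HasCompactSupport.of_support_subset_isCompact (isCompact_Icc (a := -1) (b := 1)) ?_
    intro u hu
    by_contra h
    refine hu ?_
    rw [mem_Icc, ← abs_le, not_le] at h
    have h0 : √(1 - (|u| + r / 2) ^ 2) = 0 := Real.sqrt_eq_zero_of_nonpos (by nlinarith)
    simp [h0]
  rw [h1, Measure.volume_eq_prod, Measure.prod_apply hm]
  simp only [hslice]
  rw [← ofReal_integral_eq_lintegral_ofReal hint (Eventually.of_forall fun s => by positivity),
    integral_comp_abs (f := fun s => 2 * √(1 - (s + r / 2) ^ 2)), integral_const_mul, lensArea]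
  congr 1
  have h2 : ∫ s in Ioi (0 : ℝ), √(1 - (s + r / 2) ^ 2) = ∫ u in Ioi (r / 2), √(1 - u ^ 2) := by
    have := (measurePreserving_add_right (volume : Measure ℝ) (r / 2)).setIntegral_preimage_emb
      (measurableEmbedding_addRight (r / 2)) (fun u => √(1 - u ^ 2)) (Ioi (r / 2))
    rw [← this]
    congr 2
    ext s; simp
  rw [h2]; ring

/-- Only ‖z‖ matters: a reflection carries z onto the first axis, and a translation by half of it
moves the midpoint of the two centres to the origin. -/
theorem volume_ball_inter_ball (z : Plane) :
    volume {x : Plane | ‖x‖ < 1 ∧ ‖x + z‖ < 1} = ENNReal.ofReal (lensArea ‖z‖) := by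
  set r := ‖z‖ with hr
  set e : Plane := EuclideanSpace.single 0 r with he
  have hne : ‖z‖ = ‖e‖ := by
    rw [he, PiLp.norm_single, Real.norm_of_nonneg (norm_nonneg z)]
  set T := (ℝ ∙ (z - e))ᗮ.reflection with hT
  have hTz : T z = e := Submodule.reflection_sub hne
  have hopen (a b : Plane) : MeasurableSet {x : Plane | ‖x + a‖ < 1 ∧ ‖x + b‖ < 1} :=
    ((isOpen_lt (f := fun x : Plane => ‖x + a‖) (by fun_prop) continuous_const).inter
      (isOpen_lt (f := fun x : Plane => ‖x + b‖) (by fun_prop) continuous_const)).measurableSet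
  have h1 : volume {x : Plane | ‖x‖ < 1 ∧ ‖x + z‖ < 1} =
      volume {x : Plane | ‖x + 0‖ < 1 ∧ ‖x + e‖ < 1} := by
    rw [← T.measurePreserving.measure_preimage (hopen 0 e).nullMeasurableSet]
    congr 1
    ext x
    simp only [mem_preimage, mem_ofPred_eq, add_zero]
    rw [← hTz, ← map_add, T.norm_map, T.norm_map]
  set c : Plane := EuclideanSpace.single 0 (r / 2) with hc
  have h2 : volume {x : Plane | ‖x + 0‖ < 1 ∧ ‖x + e‖ < 1} =
      volume {x : Plane | (|x 0| + r / 2) ^ 2 + x 1 ^ 2 < 1} := by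
    rw [← (measurePreserving_add_right (volume : Measure Plane) (-c)).measure_preimage
      (hopen 0 e).nullMeasurableSet]
    congr 1
    ext x
    simp only [mem_preimage, mem_ofPred_eq]
    rw [← sq_lt_one_iff₀ (norm_nonneg _), ← sq_lt_one_iff₀ (norm_nonneg _),
      EuclideanSpace.norm_sq_eq, EuclideanSpace.norm_sq_eq]
    simp only [Fin.sum_univ_two, hc, he, PiLp.add_apply, PiLp.neg_apply, PiLp.zero_apply,
      PiLp.single_apply, Real.norm_eq_abs, sq_abs]
    norm_num
    have hr0 : 0 ≤ r := norm_nonneg z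
    rcases abs_cases (x 0) with ⟨h, h'⟩ | ⟨h, h'⟩ <;> rw [h]
    · constructor
      · rintro ⟨a, b⟩; nlinarith
      · intro a; constructor <;> nlinarith
    · constructor
      · rintro ⟨a, b⟩; nlinarith
      · intro a; constructor <;> nlinarith
  rw [h1, h2, volume_lens_eq r (norm_nonneg z)]

theorem ofReal_lensArea (r : ℝ) :
    ENNReal.ofReal (lensArea r) =
      4 * ∫⁻ u in Ioi (r / 2), ENNReal.ofReal √(1 - u ^ 2) := by
  rw [lensArea, ENNReal.ofReal_mul (by norm_num), ENNReal.ofReal_ofNat,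
    ofReal_integral_eq_lintegral_ofReal integrable_sqrt_one_sub_sq.integrableOn
      (Eventually.of_forall fun _ => Real.sqrt_nonneg _)]

theorem lintegral_ball_norm_rpow {α t : ℝ} (hα : α < 2) (ht : 0 < t) :
    ∫⁻ z in Metric.ball (0 : Plane) t, ENNReal.ofReal (‖z‖ ^ (-α)) =
      ENNReal.ofReal (2 * Real.pi * (t ^ (2 - α) / (2 - α))) := by
  set g : ℝ → ℝ := (Iio t).indicator fun y => y ^ (-α) with hg
  have hpow : EqOn (fun y => y ^ (Module.finrank ℝ Plane - 1) • g y)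
      ((Ioo 0 t).indicator fun y => y ^ (1 - α)) (Ioi 0) := by
    intro y hy
    have hy0 : 0 < y := hy
    simp only [hg, finrank_euclideanSpace, Fintype.card_fin, Nat.add_one_sub_one, pow_one,
      smul_eq_mul]
    by_cases h : y < t
    · rw [indicator_of_mem (show y ∈ Iio t from h), indicator_of_mem (show y ∈ Ioo 0 t from ⟨hy, h⟩),
        sub_eq_add_neg, Real.rpow_add hy0, Real.rpow_one]
    · rw [indicator_of_notMem (show y ∉ Iio t from h),
        indicator_of_notMem (show y ∉ Ioo 0 t from fun h' => h h'.2), mul_zero]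
  have hIoo : IntegrableOn (fun y : ℝ => y ^ (1 - α)) (Ioo 0 t) :=
    (intervalIntegral.integrableOn_Ioo_rpow_iff ht).2 (by linarith)
  have hint : Integrable fun z : Plane => g ‖z‖ := by
    rw [integrable_fun_norm_addHaar, integrableOn_congr_fun hpow measurableSet_Ioi]
    exact ((integrable_indicator_iff measurableSet_Ioo).2 hIoo).integrableOn
  have hg0 (y : ℝ) (hy : 0 ≤ y) : 0 ≤ g y := by
    by_cases h : y < t
    · simp only [hg, indicator_of_mem (show y ∈ Iio t from h)]; positivity
    · simp only [hg, indicator_of_notMem (show y ∉ Iio t from h)]; exact le_rfl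
  have h1 : ∫⁻ z in Metric.ball (0 : Plane) t, ENNReal.ofReal (‖z‖ ^ (-α)) =
      ∫⁻ z : Plane, ENNReal.ofReal (g ‖z‖) := by
    rw [← lintegral_indicator measurableSet_ball]
    refine lintegral_congr fun z => ?_
    by_cases h : ‖z‖ < t
    · rw [indicator_of_mem (mem_ball_zero_iff.2 h)]
      simp only [hg, indicator_of_mem (show ‖z‖ ∈ Iio t from h)]
    · rw [indicator_of_notMem (fun h' => h (mem_ball_zero_iff.1 h'))]
      simp only [hg, indicator_of_notMem (show ‖z‖ ∉ Iio t from h), ENNReal.ofReal_zero]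
  rw [h1, ← ofReal_integral_eq_lintegral_ofReal hint
    (Eventually.of_forall fun z => hg0 _ (norm_nonneg z)), integral_fun_norm_addHaar,
    setIntegral_congr_fun measurableSet_Ioi hpow, setIntegral_indicator measurableSet_Ioo,
    volume_real_ball zero_le_one]
  have h2 : Ioi (0 : ℝ) ∩ Ioo 0 t = Ioo 0 t := inter_eq_right.2 fun y hy => hy.1
  rw [h2, ← integral_Ioc_eq_integral_Ioo, ← intervalIntegral.integral_of_le ht.le,
    integral_rpow (Or.inl (by linarith))]
  have h3 : 1 - α + 1 = 2 - α := by ring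
  rw [h3, Real.zero_rpow (by linarith)]
  simp only [finrank_euclideanSpace, Fintype.card_fin, smul_eq_mul, nsmul_eq_mul]
  congr 1
  push_cast; ring

theorem interaction_ball_eq_lintegral (α : ℝ) :
    interaction α (Metric.ball 0 1) =
      ∫⁻ z : Plane, ENNReal.ofReal (‖z‖ ^ (-α)) * ENNReal.ofReal (lensArea ‖z‖) := by
  set B : Set Plane := Metric.ball 0 1 with hB
  have hBm : MeasurableSet B := measurableSet_ball
  have hk : Measurable fun z : Plane => (edist 0 z ^ α)⁻¹ :=
    ((measurable_const.edist measurable_id).pow_const α).inv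
  have h1 (x : Plane) : ∫⁻ y in B, (edist x y ^ α)⁻¹ =
      ∫⁻ z, B.indicator 1 (x + z) * (edist 0 z ^ α)⁻¹ := by
    rw [← lintegral_indicator hBm, ← lintegral_add_left_eq_self _ x]
    refine lintegral_congr fun z => ?_
    have : edist x (x + z) = edist 0 z := by simpa using edist_add_left x 0 z
    by_cases h : x + z ∈ B <;> simp [h, this]
  have hm : Measurable fun p : Plane × Plane =>
      (B.indicator 1 p.1 : ℝ≥0∞) * (B.indicator 1 (p.1 + p.2) * (edist 0 p.2 ^ α)⁻¹) := by
    have hI : Measurable (B.indicator (1 : Plane → ℝ≥0∞)) := measurable_one.indicator hBm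
    exact (hI.comp measurable_fst).mul
      ((hI.comp (measurable_fst.add measurable_snd)).mul (hk.comp measurable_snd))
  calc interaction α B
      = ∫⁻ x, ∫⁻ z, B.indicator 1 x * (B.indicator 1 (x + z) * (edist 0 z ^ α)⁻¹) := by
        unfold interaction
        rw [← lintegral_indicator hBm]
        refine lintegral_congr fun x => ?_
        by_cases h : x ∈ B
        · simp [h, h1]
        · simp [h]
    _ = ∫⁻ z, ∫⁻ x, B.indicator 1 x * (B.indicator 1 (x + z) * (edist 0 z ^ α)⁻¹) :=
        lintegral_lintegral_swap hm.aemeasurable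
    _ = ∫⁻ z : Plane, ENNReal.ofReal (‖z‖ ^ (-α)) * ENNReal.ofReal (lensArea ‖z‖) := by
        refine lintegral_congr_ae ?_
        -- At z = 0 the extended kernel and the real power may differ, being ∞ and 0 for positive α.
        filter_upwards [compl_mem_ae_iff.2 (measure_singleton (0 : Plane))] with z hz
        rw [edist_rpow_inv_eq α (Ne.symm hz), zero_sub, norm_neg, ← volume_ball_inter_ball,
          mul_comm]
        simp only [← mul_assoc]
        rw [lintegral_mul_const' _ _ ENNReal.ofReal_ne_top]
        congr 1
        have hlm : MeasurableSet {x : Plane | ‖x‖ < 1 ∧ ‖x + z‖ < 1} :=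
          ((isOpen_lt (f := fun x : Plane => ‖x‖) (by fun_prop) continuous_const).inter
            (isOpen_lt (f := fun x : Plane => ‖x + z‖) (by fun_prop)
              continuous_const)).measurableSet
        rw [← lintegral_indicator_one hlm]
        refine lintegral_congr fun x => ?_
        by_cases hx : ‖x‖ < 1 <;> by_cases hxz : ‖x + z‖ < 1 <;> simp [hB, hx, hxz]

/-- The substitution s = u² turns the normalized beta density with parameters (3-α)/2 and 3/2 into
this integrand, up to the factor 2/b with b the beta value. -/
theorem lintegral_rpow_mul_sqrt {α : ℝ} (hα : α < 2) :
    ∫⁻ u in Ioi (0 : ℝ), ENNReal.ofReal (√(1 - u ^ 2) * u ^ (2 - α)) =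
      ENNReal.ofReal (ProbabilityTheory.beta ((3 - α) / 2) (3 / 2) / 2) := by
  set b := ProbabilityTheory.beta ((3 - α) / 2) (3 / 2) with hb
  have hb0 : 0 < b := ProbabilityTheory.beta_pos (by linarith) (by norm_num)
  have h1 := ProbabilityTheory.lintegral_betaPDF_eq_one (α := (3 - α) / 2) (β := 3 / 2)
    (by linarith) (by norm_num)
  rw [ProbabilityTheory.lintegral_betaPDF, ← hb] at h1
  have himage : (fun u : ℝ => u ^ 2) '' Ioo 0 1 = Ioo 0 1 := by
    ext s
    constructor
    · rintro ⟨u, hu, rfl⟩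
      exact ⟨by have := hu.1; positivity, pow_lt_one₀ hu.1.le hu.2 two_ne_zero⟩
    · intro hs
      refine ⟨√s, ⟨Real.sqrt_pos.2 hs.1, ?_⟩, Real.sq_sqrt hs.1.le⟩
      rw [Real.sqrt_lt' one_pos, one_pow]
      exact hs.2
  have hinj : InjOn (fun u : ℝ => u ^ 2) (Ioo 0 1) := fun u hu v hv h =>
    (pow_left_inj₀ hu.1.le hv.1.le two_ne_zero).1 h
  have h2 := lintegral_image_eq_lintegral_abs_deriv_mul (measurableSet_Ioo (a := (0 : ℝ)) (b := 1))
    (f := fun u => u ^ 2) (f' := fun u => 2 * u)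
    (fun u _ => by simpa using (hasDerivAt_pow 2 u).hasDerivWithinAt) hinj
    (fun s => ENNReal.ofReal (1 / b * s ^ ((3 - α) / 2 - 1) * (1 - s) ^ ((3 / 2 : ℝ) - 1)))
  rw [himage, h1] at h2
  have h3 : ∀ u ∈ Ioo (0 : ℝ) 1, ENNReal.ofReal |2 * u| *
      ENNReal.ofReal (1 / b * (u ^ 2) ^ ((3 - α) / 2 - 1) * (1 - u ^ 2) ^ ((3 / 2 : ℝ) - 1)) =
      ENNReal.ofReal (2 / b) * ENNReal.ofReal (√(1 - u ^ 2) * u ^ (2 - α)) := by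
    intro u hu
    have hu0 : 0 < u := hu.1
    rw [← ENNReal.ofReal_mul (abs_nonneg _), ← ENNReal.ofReal_mul (by positivity)]
    congr 1
    have e1 : (u ^ 2) ^ ((3 - α) / 2 - 1) = u ^ (1 - α) := by
      rw [← Real.rpow_natCast, ← Real.rpow_mul hu0.le]
      congr 1; push_cast; ring
    have e2 : u ^ (2 - α) = u * u ^ (1 - α) := by
      rw [← Real.rpow_one_add' hu0.le (by linarith)]; congr 1; ring
    have e3 : (3 / 2 : ℝ) - 1 = 1 / 2 := by norm_num
    rw [abs_of_pos (by positivity), e1, e2, e3, ← Real.sqrt_eq_rpow]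
    ring
  rw [setLIntegral_congr_fun measurableSet_Ioo h3,
    lintegral_const_mul' _ _ ENNReal.ofReal_ne_top] at h2
  have h4 : ∫⁻ u in Ioi (0 : ℝ), ENNReal.ofReal (√(1 - u ^ 2) * u ^ (2 - α)) =
      ∫⁻ u in Ioo (0 : ℝ) 1, ENNReal.ofReal (√(1 - u ^ 2) * u ^ (2 - α)) := by
    rw [← lintegral_indicator measurableSet_Ioi, ← lintegral_indicator measurableSet_Ioo]
    refine lintegral_congr fun u => ?_
    by_cases h : u ∈ Ioo (0 : ℝ) 1
    · rw [indicator_of_mem h, indicator_of_mem (show u ∈ Ioi (0 : ℝ) from h.1)]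
    · rw [indicator_of_notMem h]
      by_cases h0 : u ∈ Ioi (0 : ℝ)
      · have hu1 : 1 ≤ u := by
          by_contra! h1
          exact h ⟨h0, h1⟩
        rw [indicator_of_mem h0, Real.sqrt_eq_zero_of_nonpos (by nlinarith), zero_mul,
          ENNReal.ofReal_zero]
      · rw [indicator_of_notMem h0]
  have h5 : ENNReal.ofReal (b / 2) * ENNReal.ofReal (2 / b) = 1 := by
    rw [← ENNReal.ofReal_mul (by positivity)]
    have : b / 2 * (2 / b) = 1 := by field_simp
    rw [this, ENNReal.ofReal_one]
  rw [h4, ← mul_one (ENNReal.ofReal (b / 2)), h2, ← mul_assoc, h5, one_mul]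

/-- Write the lens area as an integral over u > ‖z‖/2 and exchange the order: the z-integral now
runs over the disk of radius 2u and gives a power of u, which leaves a beta integral. -/
theorem interaction_ball_eq {α : ℝ} (hα : α < 2) :
    interaction α (Metric.ball 0 1) = ENNReal.ofReal (4 * (2 * Real.pi * (2 ^ (2 - α) / (2 - α))) *
      (ProbabilityTheory.beta ((3 - α) / 2) (3 / 2) / 2)) := by
  have hmeas : MeasurableSet {p : Plane × ℝ | ‖p.1‖ / 2 < p.2} :=
    measurableSet_lt (by fun_prop) measurable_snd
  set J : Plane × ℝ → ℝ≥0∞ := {p : Plane × ℝ | ‖p.1‖ / 2 < p.2}.indicator 1 with hJ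
  have hJm : Measurable J := measurable_one.indicator hmeas
  have hs : Measurable fun u : ℝ => ENNReal.ofReal √(1 - u ^ 2) := by fun_prop
  have hk : Measurable fun z : Plane => ENNReal.ofReal (‖z‖ ^ (-α)) :=
    (measurable_norm.pow_const _).ennreal_ofReal
  rw [interaction_ball_eq_lintegral]
  have h1 (z : Plane) : ENNReal.ofReal (‖z‖ ^ (-α)) * ENNReal.ofReal (lensArea ‖z‖) =
      ∫⁻ u in Ioi (0 : ℝ), J (z, u) * (4 * ENNReal.ofReal √(1 - u ^ 2)) *
        ENNReal.ofReal (‖z‖ ^ (-α)) := by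
    rw [lintegral_mul_const' _ _ ENNReal.ofReal_ne_top, mul_comm, ofReal_lensArea,
      ← lintegral_const_mul' _ _ (by norm_num)]
    congr 1
    rw [← lintegral_indicator measurableSet_Ioi, ← lintegral_indicator measurableSet_Ioi]
    refine lintegral_congr fun u => ?_
    by_cases hu : ‖z‖ / 2 < u
    · have hu0 : 0 < u := by have := norm_nonneg z; linarith
      rw [indicator_of_mem (show u ∈ Ioi (‖z‖ / 2) from hu),
        indicator_of_mem (show u ∈ Ioi (0 : ℝ) from hu0)]
      simp [hJ, hu]
    · rw [indicator_of_notMem (show u ∉ Ioi (‖z‖ / 2) from hu)]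
      by_cases hu0 : u ∈ Ioi (0 : ℝ)
      · rw [indicator_of_mem hu0]; simp [hJ, hu]
      · rw [indicator_of_notMem hu0]
  simp only [h1]
  rw [lintegral_lintegral_swap]
  · have h2 : ∀ u ∈ Ioi (0 : ℝ), ∫⁻ z : Plane, J (z, u) * (4 * ENNReal.ofReal √(1 - u ^ 2)) *
        ENNReal.ofReal (‖z‖ ^ (-α)) = ENNReal.ofReal (4 * (2 * Real.pi * (2 ^ (2 - α) / (2 - α)))) *
          ENNReal.ofReal (√(1 - u ^ 2) * u ^ (2 - α)) := by
      intro u hu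
      have hu0 : 0 < u := hu
      have h3 : ∫⁻ z : Plane, J (z, u) * (4 * ENNReal.ofReal √(1 - u ^ 2)) *
          ENNReal.ofReal (‖z‖ ^ (-α)) = (4 * ENNReal.ofReal √(1 - u ^ 2)) *
          ∫⁻ z in Metric.ball (0 : Plane) (2 * u), ENNReal.ofReal (‖z‖ ^ (-α)) := by
        rw [← lintegral_const_mul' _ _ (by finiteness), ← lintegral_indicator measurableSet_ball]
        refine lintegral_congr fun z => ?_
        have hz : z ∈ Metric.ball (0 : Plane) (2 * u) ↔ ‖z‖ / 2 < u := by
          rw [mem_ball_zero_iff, div_lt_iff₀ two_pos, mul_comm]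
        by_cases h : ‖z‖ / 2 < u
        · rw [indicator_of_mem (hz.2 h)]; simp [hJ, h]
        · rw [indicator_of_notMem (fun h' => h (hz.1 h'))]; simp [hJ, h]
      rw [h3, lintegral_ball_norm_rpow hα (by positivity), ← ENNReal.ofReal_ofNat 4,
        ← ENNReal.ofReal_mul (by norm_num), ← ENNReal.ofReal_mul (by positivity),
        ← ENNReal.ofReal_mul (by have : 0 < 2 - α := by linarith
                                 positivity), Real.mul_rpow (by norm_num) hu0.le]
      congr 1; ring
    rw [setLIntegral_congr_fun measurableSet_Ioi h2, lintegral_const_mul' _ _ ENNReal.ofReal_ne_top,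
      lintegral_rpow_mul_sqrt hα, ← ENNReal.ofReal_mul]
    have : 0 < 2 - α := by linarith
    positivity
  · refine Measurable.aemeasurable ?_
    exact (hJm.mul ((hs.comp measurable_snd).const_mul 4)).mul (hk.comp measurable_fst)

/-- The explicit value of the interaction of the unit disk. -/
theorem interaction_ball_eq_Gamma {α : ℝ} (hα : α < 2) :
    interaction α (Metric.ball 0 1) = ENNReal.ofReal (2 * Real.pi ^ 2 * Real.Gamma (2 - α) /
      (Real.Gamma (2 - α / 2) * Real.Gamma (3 - α / 2))) := by
  rw [interaction_ball_eq hα, ProbabilityTheory.beta]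
  congr 1
  -- Legendre duplication trades Γ((3-α)/2) for Γ(3-α)/Γ(2-α/2), the form in which m_{c1} is stated.
  have h1 := Real.Gamma_mul_Gamma_add_half ((3 - α) / 2)
  have h2 : Real.Gamma (3 / 2) = √Real.pi / 2 := by
    have := Real.Gamma_add_one (s := 1 / 2) (by norm_num)
    rw [Real.Gamma_one_half_eq] at this
    norm_num at this
    rw [this]; ring
  have h3 : Real.Gamma (3 - α) = (2 - α) * Real.Gamma (2 - α) := by
    rw [← Real.Gamma_add_one (by linarith)]; congr 1; ring
  have e1 : (3 - α) / 2 + 1 / 2 = 2 - α / 2 := by ring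
  have e2 : 2 * ((3 - α) / 2) = 3 - α := by ring
  have e3 : (3 - α) / 2 + 3 / 2 = 3 - α / 2 := by ring
  have e4 : (2 : ℝ) ^ (1 - (3 - α)) = (2 ^ (2 - α))⁻¹ := by
    rw [← Real.rpow_neg (by norm_num)]; congr 1; ring
  rw [e1, e2, h3, e4] at h1
  rw [h2, e3]
  have hA : 0 < Real.Gamma (2 - α / 2) := Real.Gamma_pos_of_pos (by linarith)
  have hB : 0 < Real.Gamma (3 - α / 2) := Real.Gamma_pos_of_pos (by linarith)
  have hp : (0 : ℝ) < 2 ^ (2 - α) := Real.rpow_pos_of_pos two_pos _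
  have h2α : 0 < 2 - α := by linarith
  have hsq := Real.mul_self_sqrt Real.pi_pos.le
  have h4 : Real.Gamma ((3 - α) / 2) =
      (2 - α) * Real.Gamma (2 - α) * (2 ^ (2 - α))⁻¹ * √Real.pi / Real.Gamma (2 - α / 2) := by
    rw [eq_div_iff hA.ne', h1]
  rw [h4]
  field_simp
  rw [Real.sq_sqrt Real.pi_pos.le]
  ring

theorem V0_eq {α : ℝ} (hα : α < 2) :
    V0 α = 2 * Real.pi ^ 2 * Real.Gamma (2 - α) /
      (Real.Gamma (2 - α / 2) * Real.Gamma (3 - α / 2)) := by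
  have h1 : 0 < Real.Gamma (2 - α) := Real.Gamma_pos_of_pos (by linarith)
  have h2 : 0 < Real.Gamma (2 - α / 2) := Real.Gamma_pos_of_pos (by linarith)
  have h3 : 0 < Real.Gamma (3 - α / 2) := Real.Gamma_pos_of_pos (by linarith)
  rw [V0, interaction_ball_eq_Gamma hα, ENNReal.toReal_ofReal (by positivity)]

theorem V0_pos {α : ℝ} (hα : α < 2) : 0 < V0 α := by
  have h1 : 0 < Real.Gamma (2 - α) := Real.Gamma_pos_of_pos (by linarith)
  have h2 : 0 < Real.Gamma (2 - α / 2) := Real.Gamma_pos_of_pos (by linarith)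
  have h3 : 0 < Real.Gamma (3 - α / 2) := Real.Gamma_pos_of_pos (by linarith)
  rw [V0_eq hα]
  positivity

theorem interaction_ball_eq_V0 {α R : ℝ} (hα : α < 2) (hR : 0 < R) :
    interaction α (Metric.ball 0 R) = ENNReal.ofReal (V0 α * R ^ (4 - α)) := by
  rw [interaction_ball_zero α hR, mul_comm, ENNReal.ofReal_mul (V0_pos hα).le, V0,
    ENNReal.ofReal_toReal]
  rw [interaction_ball_eq_Gamma hα]
  exact ENNReal.ofReal_ne_top

/-- The diameter bound for the interaction of the unit disk. -/
theorem le_V0 {α : ℝ} (h0 : 0 ≤ α) (hα : α < 2) : Real.pi ^ 2 / 2 ^ α ≤ V0 α := by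
  have hfin : interaction α (Metric.ball 0 1) ≠ ∞ := by
    rw [interaction_ball_eq_Gamma hα]
    exact ENNReal.ofReal_ne_top
  rw [V0, ← ENNReal.ofReal_le_iff_le_toReal hfin]
  have hvol : volume (Metric.ball (0 : Plane) 1) = ENNReal.ofReal Real.pi := by
    rw [← ofReal_measureReal Metric.isBounded_ball.measure_lt_top.ne, volume_real_ball zero_le_one]
    simp
  calc ENNReal.ofReal (Real.pi ^ 2 / 2 ^ α)
      = ∫⁻ x in Metric.ball (0 : Plane) 1, ∫⁻ y in Metric.ball (0 : Plane) 1,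
          ENNReal.ofReal (2 ^ α)⁻¹ := by
        rw [setLIntegral_const, setLIntegral_const, hvol, ← ENNReal.ofReal_mul (by positivity),
          ← ENNReal.ofReal_mul (by positivity)]
        congr 1
        field_simp
    _ ≤ interaction α (Metric.ball 0 1) := by
        refine setLIntegral_mono' measurableSet_ball fun x hx => ?_
        refine setLIntegral_mono' measurableSet_ball fun y hy => ?_
        rw [ENNReal.ofReal_inv_of_pos (by positivity), ← ENNReal.ofReal_rpow_of_pos two_pos]
        gcongr
        rw [edist_dist]
        refine ENNReal.ofReal_le_ofReal ?_
        rw [Metric.mem_ball] at hx hy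
        have := dist_triangle_right x y 0
        linarith

/-! ### Competitors made of disks -/

theorem energy_ball_le {α R : ℝ} (hα : α < 2) (hR : 0 < R) :
    energy α (Metric.ball 0 R) ≤ ENNReal.ofReal (E1 α R) := by
  have hV := V0_pos hα
  have := Real.pi_pos
  rw [E1, ENNReal.ofReal_add (by positivity) (by positivity), energy,
    interaction_ball_eq_V0 hα hR]
  gcongr
  exact perimeter_ball_le hR.le 0

theorem volume_ball_zero {R : ℝ} (hR : 0 ≤ R) :
    volume (Metric.ball (0 : Plane) R) = ENNReal.ofReal (Real.pi * R ^ 2) := by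
  rw [← ofReal_measureReal Metric.isBounded_ball.measure_lt_top.ne, volume_real_ball hR]

theorem energy_empty (α : ℝ) : energy α ∅ = 0 := by
  simp [energy, perimeter, interaction]

/-- Disjoint distant copies of a disk. -/
theorem exists_disks {α R : ℝ} (h0 : 0 < α) (hα : α < 2) (hR : 0 < R) (N : ℕ) :
    ∀ ε : ℝ≥0∞, ε ≠ 0 → ∃ G : Set Plane, MeasurableSet G ∧ Bornology.IsBounded G ∧
      volume G = N * ENNReal.ofReal (Real.pi * R ^ 2) ∧
      energy α G ≤ N * ENNReal.ofReal (E1 α R) + ε := by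
  induction N with
  | zero =>
    intro ε _
    exact ⟨∅, MeasurableSet.empty, Bornology.isBounded_empty, by simp, by simp [energy_empty]⟩
  | succ N ih =>
    intro ε hε
    have hε2 : ε / 2 ≠ 0 := by simpa using hε
    obtain ⟨G, hG, hGb, hGv, hGE⟩ := ih (ε / 2) hε2
    obtain ⟨G', hG', hGb', hGv', hGE'⟩ := exists_energy_le_add h0 hG
      (measurableSet_ball (x := (0 : Plane)) (ε := R)) hGb Metric.isBounded_ball hε2
    refine ⟨G', hG', hGb', ?_, ?_⟩
    · rw [hGv', hGv, volume_ball_zero hR.le]; push_cast; ring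
    · calc energy α G' ≤ (N * ENNReal.ofReal (E1 α R) + ε / 2) + ENNReal.ofReal (E1 α R) +
            ε / 2 := by
            refine hGE'.trans ?_
            gcongr
            exact energy_ball_le hα hR
        _ = N * ENNReal.ofReal (E1 α R) + ENNReal.ofReal (E1 α R) + (ε / 2 + ε / 2) := by ring
        _ = _ := by rw [ENNReal.add_halves]; push_cast; ring

/-- The bound is approached, as the disks move apart, by competitors whose mutual interaction tends
to zero. -/
theorem IsMinimizer.energy_le_disks {α m R : ℝ} {Ω : Set Plane} (h : IsMinimizer α m Ω)
    (h0 : 0 < α) (hα : α < 2) (hR : 0 < R) {N : ℕ} (hN : N * (Real.pi * R ^ 2) = m) :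
    energy α Ω ≤ ENNReal.ofReal (N * E1 α R) := by
  refine ENNReal.le_of_forall_pos_le_add fun ε hε _ => ?_
  obtain ⟨G, hG, -, hGv, hGE⟩ := exists_disks h0 hα hR N ε (by simpa using hε.ne')
  rw [ENNReal.ofReal_mul (by positivity), ENNReal.ofReal_natCast]
  refine (h.2.2 G hG.nullMeasurableSet ?_).trans hGE
  rw [hGv, ← hN, ENNReal.ofReal_mul (p := (N : ℝ)) (by positivity), ENNReal.ofReal_natCast]

/-- Sets of small mass and small energy. -/
theorem exists_small_energy {α : ℝ} (hα : α < 2) {ε : ℝ≥0∞} (hε : ε ≠ 0) :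
    ∃ δ : ℝ≥0∞, δ ≠ 0 ∧ ∀ d ≤ δ, ∃ G : Set Plane, MeasurableSet G ∧ Bornology.IsBounded G ∧
      volume G = d ∧ energy α G ≤ ε := by
  have hlim : Tendsto (fun R : ℝ => ENNReal.ofReal (E1 α R)) (𝓝 0) (𝓝 0) := by
    have h1 : Tendsto (fun R : ℝ => ENNReal.ofReal (E1 α R)) (𝓝 0)
        (𝓝 (ENNReal.ofReal (E1 α 0))) := by
      refine ENNReal.tendsto_ofReal (ContinuousAt.tendsto ?_)
      unfold E1
      refine (continuousAt_const.mul continuousAt_id).add (continuousAt_const.mul ?_)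
      exact Real.continuousAt_rpow_const 0 _ (Or.inr (by linarith))
    rwa [E1, Real.zero_rpow (by linarith), mul_zero, mul_zero, add_zero, ENNReal.ofReal_zero] at h1
  obtain ⟨r, hr, hball⟩ := Metric.eventually_nhds_iff.1
    (hlim.eventually_le_const (pos_iff_ne_zero.2 hε))
  have hδ : 0 < Real.pi * (r / 2) ^ 2 := by have := Real.pi_pos; positivity
  refine ⟨ENNReal.ofReal (Real.pi * (r / 2) ^ 2), by simpa using hδ, fun d hd => ?_⟩
  rcases eq_or_ne d 0 with rfl | hd0
  · exact ⟨∅, MeasurableSet.empty, Bornology.isBounded_empty, by simp, by simp [energy_empty]⟩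
  have hdtop : d ≠ ∞ := ne_top_of_le_ne_top ENNReal.ofReal_ne_top hd
  have hdpos : 0 < d.toReal := ENNReal.toReal_pos hd0 hdtop
  have hpi := Real.pi_pos
  set R := √(d.toReal / Real.pi) with hRdef
  have hR : 0 < R := Real.sqrt_pos.2 (by positivity)
  have hRsq : Real.pi * R ^ 2 = d.toReal := by
    rw [hRdef, Real.sq_sqrt (by positivity)]; field_simp
  refine ⟨Metric.ball 0 R, measurableSet_ball, Metric.isBounded_ball, ?_, ?_⟩
  · rw [volume_ball_zero hR.le, hRsq, ENNReal.ofReal_toReal hdtop]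
  · refine (energy_ball_le hα hR).trans (hball ?_)
    have h1 : d.toReal ≤ Real.pi * (r / 2) ^ 2 := ENNReal.toReal_le_of_le_ofReal hδ.le hd
    have h2 : R ≤ r / 2 := by
      rw [← hRsq] at h1
      have := le_of_mul_le_mul_left h1 hpi
      exact (pow_le_pow_iff_left₀ hR.le (by positivity) two_ne_zero).1 this
    rw [Real.dist_eq, sub_zero, abs_of_pos hR]
    linarith

/-! ### Cutting a minimizer -/

/-- The energy of a minimizer is subadditive under splitting. -/
theorem IsMinimizer.energy_le_split {α m : ℝ} {A B : Set Plane} (h0 : 0 < α) (hα : α < 2)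
    (hA : MeasurableSet A) (hB : MeasurableSet B) (hdisj : Disjoint A B)
    (h : IsMinimizer α m (A ∪ B)) :
    energy α (A ∪ B) ≤ energy α A + energy α B := by
  have hfin : volume (A ∪ B) ≠ ∞ := by rw [h.2.1]; exact ENNReal.ofReal_ne_top
  have hAfin : volume A ≠ ∞ := measure_ne_top_of_subset subset_union_left hfin
  have hBfin : volume B ≠ ∞ := measure_ne_top_of_subset subset_union_right hfin
  refine ENNReal.le_of_forall_pos_le_add fun ε hε _ => ?_
  -- Five errors: truncating A, truncating B, the small set restoring the mass, and two placements
  -- of distant pieces.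
  set η : ℝ≥0∞ := (ε : ℝ≥0∞) / 5 with hη
  have hη0 : η ≠ 0 := by simpa [hη] using hε.ne'
  obtain ⟨δ, hδ0, hδ⟩ := exists_small_energy hα hη0
  set δ' : ℝ≥0∞ := min η (δ / 2) with hδ'
  have hδ'0 : δ' ≠ 0 := by
    have h2 : δ / 2 ≠ 0 := by simpa using hδ0
    rcases min_choice η (δ / 2) with h | h <;> rw [hδ', h] <;> assumption
  obtain ⟨A', hA's, hA'm, hA'b, hA'v, hA'P⟩ := exists_isBounded_truncation hA hAfin hδ'0
  obtain ⟨B', hB's, hB'm, hB'b, hB'v, hB'P⟩ := exists_isBounded_truncation hB hBfin hδ'0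
  have hE {C C' : Set Plane} (hs : C' ⊆ C) (hP : perimeter C' ≤ perimeter C + δ') :
      energy α C' ≤ energy α C + η := by
    calc energy α C' ≤ (perimeter C + η) + interaction α C :=
          add_le_add (hP.trans (by gcongr; exact min_le_left _ _)) (interaction_mono α hs)
      _ = _ := by rw [energy]; ring
  -- Truncation loses a little mass; D puts back exactly that amount, so that the competitor is
  -- admissible.
  obtain ⟨D, hDm, hDb, hDv, hDE⟩ := hδ (volume (A \ A') + volume (B \ B')) (by
    calc volume (A \ A') + volume (B \ B') ≤ δ / 2 + δ / 2 :=
          add_le_add (hA'v.trans (min_le_right _ _)) (hB'v.trans (min_le_right _ _))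
      _ = δ := ENNReal.add_halves δ)
  obtain ⟨G, hGm, hGb, hGv, hGE⟩ := exists_energy_le_add h0 hA'm hB'm hA'b hB'b hη0
  obtain ⟨H, hHm, hHb, hHv, hHE⟩ := exists_energy_le_add h0 hGm hDm hGb hDb hη0
  have hvol : volume H = ENNReal.ofReal m := by
    rw [← h.2.1, measure_union hdisj hB, hHv, hGv, hDv]
    have e1 : volume A = volume A' + volume (A \ A') := by
      rw [← measure_union disjoint_sdiff_right (hA.diff hA'm), union_sdiff_cancel hA's]
    have e2 : volume B = volume B' + volume (B \ B') := by
      rw [← measure_union disjoint_sdiff_right (hB.diff hB'm), union_sdiff_cancel hB's]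
    rw [e1, e2]; ring
  calc energy α (A ∪ B) ≤ energy α H := h.2.2 H hHm.nullMeasurableSet hvol
    _ ≤ (((energy α A + η) + (energy α B + η)) + η) + η + η := by
        refine hHE.trans ?_
        gcongr
        refine hGE.trans ?_
        gcongr
        · exact hE hA's hA'P
        · exact hE hB's hB'P
    _ = energy α A + energy α B + 5 * η := by ring
    _ = energy α A + energy α B + ε := by
        rw [hη, ENNReal.mul_div_cancel (by norm_num) (by norm_num)]

/-- The interaction across a line is controlled by the length of the cut. -/
theorem IsMinimizer.mutualInteraction_le {α m : ℝ} {Ω : Set Plane} (h0 : 0 < α) (hα : α < 2)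
    (hΩ : MeasurableSet Ω) (h : IsMinimizer α m Ω) (hE : energy α Ω ≠ ∞) {w : Plane → ℝ}
    (hw : ContDiff ℝ 1 w) (hw1 : ∀ x, ‖fderiv ℝ w x‖ ≤ 1) :
    mutualInteraction α (Ω ∩ {x | 0 < w x}) (Ω \ {x | 0 < w x}) ≤
      liminf (fun n => ∫⁻ x in Ω, ENNReal.ofReal (deriv (cutoff n) (w x))) atTop := by
  have hm : MeasurableSet {x | 0 < w x} := measurableSet_lt measurable_const hw.continuous.measurable
  set A := Ω ∩ {x | 0 < w x} with hA
  set B := Ω \ {x | 0 < w x} with hB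
  have hAB : A ∪ B = Ω := inter_union_sdiff Ω _
  have hdisj : Disjoint A B := disjoint_sdiff_inter.symm
  have hAm : MeasurableSet A := hΩ.inter hm
  have hBm : MeasurableSet B := hΩ.diff hm
  have hcut := perimeter_cut_le (Ω := Ω) hw hw1
  set κ := liminf (fun n => ∫⁻ x in Ω, ENNReal.ofReal (deriv (cutoff n) (w x))) atTop
  have hsplit := IsMinimizer.energy_le_split h0 hα hAm hBm hdisj (hAB.symm ▸ h)
  have hV := interaction_union α hBm hdisj
  rw [hAB] at hsplit hV
  have hPfin : perimeter Ω ≠ ∞ := ne_top_of_le_ne_top hE le_self_add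
  have hVfin : interaction α Ω ≠ ∞ := ne_top_of_le_ne_top hE le_add_self
  have hfin : perimeter Ω + (interaction α A + interaction α B) ≠ ∞ := by
    refine ENNReal.add_ne_top.2 ⟨hPfin, ne_top_of_le_ne_top hVfin ?_⟩
    rw [hV]; exact le_self_add
  -- Separating the halves saves twice their mutual interaction and costs at most 2κ of new
  -- perimeter. The common terms cancel because the energy is finite.
  have h1 : (perimeter Ω + (interaction α A + interaction α B)) + 2 * mutualInteraction α A B ≤
      (perimeter Ω + (interaction α A + interaction α B)) + 2 * κ := by
    calc _ = energy α Ω := by rw [energy, hV]; ring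
      _ ≤ energy α A + energy α B := hsplit
      _ = (perimeter A + perimeter B) + (interaction α A + interaction α B) := by
          simp only [energy]; ring
      _ ≤ (perimeter Ω + 2 * κ) + (interaction α A + interaction α B) := by gcongr
      _ = _ := by ring
  have h2 := (ENNReal.add_le_add_iff_left hfin).1 h1
  exact (ENNReal.mul_le_mul_iff_right (by norm_num) (by norm_num)).1 h2

/-- Averaging the cuts of a minimizer over all the lines with a given direction. -/
theorem IsMinimizer.lintegral_inner_le {α m : ℝ} {Ω : Set Plane} (h0 : 0 < α) (hα : α < 2)
    (hΩ : MeasurableSet Ω) (h : IsMinimizer α m Ω) (hE : energy α Ω ≠ ∞) {v : Plane}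
    (hv : ‖v‖ ≤ 1) :
    ∫⁻ x in Ω, ∫⁻ y in Ω, ENNReal.ofReal (inner ℝ v (x - y)) * (edist x y ^ α)⁻¹ ≤ volume Ω := by
  set w : Plane → ℝ := fun x => inner ℝ v x with hw
  have hwc : ContDiff ℝ 1 w := contDiff_const.inner ℝ contDiff_id
  have hw1 (t : ℝ) (x : Plane) : ‖fderiv ℝ (fun x => w x - t) x‖ ≤ 1 := by
    have : HasFDerivAt w (innerSL ℝ v) x := (innerSL ℝ v).hasFDerivAt
    rw [fderiv_sub_const, this.fderiv, innerSL_apply_norm]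
    exact hv
  -- The indicator that the line at level t separates x from y, with x on the upper side. Its
  -- integral over t is the positive part of the inner product of v with x - y.
  set J : ℝ → Plane → Plane → ℝ≥0∞ := fun t x y =>
    {p : ℝ × Plane × Plane | w p.2.2 ≤ p.1 ∧ p.1 < w p.2.1}.indicator 1 (t, x, y) with hJ
  clear_value J
  have hJm : Measurable fun p : ℝ × Plane × Plane => J p.1 p.2.1 p.2.2 := by
    rw [hJ]
    refine measurable_one.indicator ((measurableSet_le ?_ measurable_fst).inter
      (measurableSet_lt measurable_fst ?_))
    · exact hwc.continuous.measurable.comp (measurable_snd.comp measurable_snd)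
    · exact hwc.continuous.measurable.comp (measurable_fst.comp measurable_snd)
  have hint (x y : Plane) : ∫⁻ t, J t x y = ENNReal.ofReal (inner ℝ v (x - y)) := by
    have : (fun t => J t x y) = (Ico (w y) (w x)).indicator 1 := by
      ext t; simp [hJ, indicator]
    rw [this, lintegral_indicator_one measurableSet_Ico, Real.volume_Ico, inner_sub_right]
  have hmut (t : ℝ) : ∫⁻ x in Ω, ∫⁻ y in Ω, J t x y * (edist x y ^ α)⁻¹ =
      mutualInteraction α (Ω ∩ {x | 0 < w x - t}) (Ω \ {x | 0 < w x - t}) := by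
    have hm : MeasurableSet {x | 0 < w x - t} :=
      measurableSet_lt measurable_const (hwc.continuous.sub continuous_const).measurable
    unfold mutualInteraction
    rw [inter_comm, ← Measure.restrict_restrict hm, ← lintegral_indicator hm]
    refine lintegral_congr fun x => ?_
    rw [sdiff_eq, inter_comm Ω, ← Measure.restrict_restrict hm.compl]
    by_cases hx : t < w x
    · rw [indicator_of_mem (show x ∈ {x | 0 < w x - t} from sub_pos.2 hx),
        ← lintegral_indicator hm.compl]
      refine lintegral_congr fun y => ?_
      by_cases hy : w y ≤ t <;> simp [hJ, hx, hy]
    · rw [indicator_of_notMem (fun h' : x ∈ {x | 0 < w x - t} => hx (sub_pos.1 h'))]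
      simp [hJ, hx]
  calc ∫⁻ x in Ω, ∫⁻ y in Ω, ENNReal.ofReal (inner ℝ v (x - y)) * (edist x y ^ α)⁻¹
      = ∫⁻ x in Ω, ∫⁻ y in Ω, ∫⁻ t, J t x y * (edist x y ^ α)⁻¹ := by
        refine lintegral_congr fun x => lintegral_congr fun y => ?_
        rw [lintegral_mul_const, hint]
        exact hJm.comp (measurable_id.prodMk (measurable_const (a := (x, y))))
    _ = ∫⁻ t, ∫⁻ x in Ω, ∫⁻ y in Ω, J t x y * (edist x y ^ α)⁻¹ := by
        have hm3 : Measurable fun p : ℝ × Plane × Plane =>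
            J p.1 p.2.1 p.2.2 * (edist p.2.1 p.2.2 ^ α)⁻¹ :=
          hJm.mul ((measurable_kernel α).comp measurable_snd)
        have hsw (x : Plane) : ∫⁻ y in Ω, ∫⁻ t, J t x y * (edist x y ^ α)⁻¹ =
            ∫⁻ t, ∫⁻ y in Ω, J t x y * (edist x y ^ α)⁻¹ := by
          refine lintegral_lintegral_swap (Measurable.aemeasurable ?_)
          exact hm3.comp (measurable_snd.prodMk (measurable_const.prodMk measurable_fst))
        simp only [hsw]
        refine lintegral_lintegral_swap (Measurable.aemeasurable ?_)
        refine Measurable.lintegral_prod_right' (f := fun q : (Plane × ℝ) × Plane =>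
          J q.1.2 q.1.1 q.2 * (edist q.1.1 q.2 ^ α)⁻¹) ?_
        exact hm3.comp ((measurable_snd.comp measurable_fst).prodMk
          ((measurable_fst.comp measurable_fst).prodMk measurable_snd))
    _ ≤ ∫⁻ t, liminf (fun n => ∫⁻ x in Ω, ENNReal.ofReal (deriv (cutoff n) (w x - t))) atTop := by
        refine lintegral_mono fun t => ?_
        rw [hmut]
        exact h.mutualInteraction_le h0 hα hΩ hE (hwc.sub contDiff_const) (hw1 t)
    _ ≤ volume Ω := lintegral_liminf_cut_le Ω hwc

theorem measurable_inner_mul_kernel (α : ℝ) (v : Plane) : Measurable fun p : Plane × Plane =>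
    ENNReal.ofReal (inner ℝ v (p.1 - p.2)) * (edist p.1 p.2 ^ α)⁻¹ := by
  have : Continuous fun p : Plane × Plane => (inner ℝ v (p.1 - p.2) : ℝ) :=
    continuous_const.inner (continuous_fst.sub continuous_snd)
  exact this.measurable.ennreal_ofReal.mul (measurable_kernel α)

theorem measurable_abs_inner_mul_kernel (α : ℝ) (v : Plane) : Measurable fun p : Plane × Plane =>
    ENNReal.ofReal |inner ℝ v (p.1 - p.2)| * (edist p.1 p.2 ^ α)⁻¹ := by
  have : Continuous fun p : Plane × Plane => |(inner ℝ v (p.1 - p.2) : ℝ)| :=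
    (continuous_const.inner (continuous_fst.sub continuous_snd)).abs
  exact this.measurable.ennreal_ofReal.mul (measurable_kernel α)

theorem measurable_inner_mul_kernel_right (α : ℝ) (v x : Plane) : Measurable fun y : Plane =>
    ENNReal.ofReal (inner ℝ v (x - y)) * (edist x y ^ α)⁻¹ := by
  have : Continuous fun y : Plane => (inner ℝ v (x - y) : ℝ) :=
    continuous_const.inner (continuous_const.sub continuous_id)
  exact this.measurable.ennreal_ofReal.mul ((measurable_const.edist measurable_id).pow_const α).inv

theorem measurable_abs_inner_mul_kernel_right (α : ℝ) (v x : Plane) : Measurable fun y : Plane =>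
    ENNReal.ofReal |inner ℝ v (x - y)| * (edist x y ^ α)⁻¹ := by
  have : Continuous fun y : Plane => |(inner ℝ v (x - y) : ℝ)| :=
    (continuous_const.inner (continuous_const.sub continuous_id)).abs
  exact this.measurable.ennreal_ofReal.mul ((measurable_const.edist measurable_id).pow_const α).inv

/-- The directions v and -v account for the positive and the negative part respectively; hence the
factor 2. -/
theorem IsMinimizer.lintegral_abs_inner_le {α m : ℝ} {Ω : Set Plane} (h0 : 0 < α) (hα : α < 2)
    (hΩ : MeasurableSet Ω) (h : IsMinimizer α m Ω) (hE : energy α Ω ≠ ∞) {v : Plane}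
    (hv : ‖v‖ ≤ 1) :
    ∫⁻ x in Ω, ∫⁻ y in Ω, ENNReal.ofReal |inner ℝ v (x - y)| * (edist x y ^ α)⁻¹ ≤
      2 * volume Ω := by
  have h1 := h.lintegral_inner_le h0 hα hΩ hE hv
  have h2 := h.lintegral_inner_le h0 hα hΩ hE (v := -v) (by rwa [norm_neg])
  have habs (a : ℝ) : ENNReal.ofReal |a| = ENNReal.ofReal a + ENNReal.ofReal (-a) := by
    rcases le_total 0 a with ha | ha
    · rw [abs_of_nonneg ha, ENNReal.ofReal_of_nonpos (neg_nonpos.2 ha), add_zero]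
    · rw [abs_of_nonpos ha, ENNReal.ofReal_of_nonpos ha, zero_add]
  calc ∫⁻ x in Ω, ∫⁻ y in Ω, ENNReal.ofReal |inner ℝ v (x - y)| * (edist x y ^ α)⁻¹
      = ∫⁻ x in Ω, ((∫⁻ y in Ω, ENNReal.ofReal (inner ℝ v (x - y)) * (edist x y ^ α)⁻¹) +
          ∫⁻ y in Ω, ENNReal.ofReal (inner ℝ (-v) (x - y)) * (edist x y ^ α)⁻¹) := by
        refine lintegral_congr fun x => ?_
        rw [← lintegral_add_left]
        · simp only [habs, inner_neg_left, add_mul]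
        · exact measurable_inner_mul_kernel_right α v x
    _ = (∫⁻ x in Ω, ∫⁻ y in Ω, ENNReal.ofReal (inner ℝ v (x - y)) * (edist x y ^ α)⁻¹) +
          ∫⁻ x in Ω, ∫⁻ y in Ω, ENNReal.ofReal (inner ℝ (-v) (x - y)) * (edist x y ^ α)⁻¹ :=
        lintegral_add_left (measurable_inner_mul_kernel α v).lintegral_prod_right' _
    _ ≤ volume Ω + volume Ω := add_le_add h1 h2
    _ = 2 * volume Ω := (two_mul _).symm

/-! ### Averaging over directions and the bound for the interaction -/

/-- Four unit vectors which are equidistributed among the directions. -/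
noncomputable def direction : Fin 4 → Plane :=
  ![!₂[1, 0], !₂[0, 1], !₂[1 / √2, 1 / √2], !₂[1 / √2, -(1 / √2)]]

theorem norm_direction (i : Fin 4) : ‖direction i‖ = 1 := by
  have h2 : (√2)⁻¹ ^ 2 = 1 / 2 := by rw [inv_pow, Real.sq_sqrt (by norm_num)]; norm_num
  rw [EuclideanSpace.norm_eq, Real.sqrt_eq_one]
  fin_cases i <;> simp [direction, Fin.sum_univ_two] <;> norm_num

/-- Let c ≥ d be the larger and the smaller of |a|, |b|. Since |a+b| + |a-b| = 2c and (√2-1)(√2+1) =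
1, the right side collapses to c + (√2-1)d. Its square exceeds c² + d² by 2(√2-1)d(c-d), with
equality at d = 0 and at d = c. -/
theorem abs_add_abs_add_le {a b : ℝ} :
    √(a ^ 2 + b ^ 2) ≤ (√2 - 1) * (|a| + |b| + |a + b| / √2 + |a - b| / √2) := by
  have hs : √2 * √2 = 2 := Real.mul_self_sqrt (by norm_num)
  have hs0 : 0 < √2 := Real.sqrt_pos.2 two_pos
  have hs1 : 1 < √2 := by nlinarith
  have aux (c d : ℝ) (hc : 0 ≤ d) (hcd : d ≤ c) : √(c ^ 2 + d ^ 2) ≤ c + (√2 - 1) * d := by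
    rw [Real.sqrt_le_left (by nlinarith)]
    nlinarith [mul_nonneg hc (sub_nonneg.2 hcd)]
  have hdiv (x : ℝ) : x / √2 = x * √2 / 2 := by
    rw [div_eq_iff hs0.ne']
    linear_combination (-x / 2) * hs
  rw [← sq_abs a, ← sq_abs b]
  have hsum : |a + b| + |a - b| = 2 * max |a| |b| := by
    rcases abs_cases a with ⟨h1, h1'⟩ | ⟨h1, h1'⟩ <;>
    rcases abs_cases b with ⟨h2, h2'⟩ | ⟨h2, h2'⟩ <;>
    rcases abs_cases (a + b) with ⟨h3, h3'⟩ | ⟨h3, h3'⟩ <;>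
    rcases abs_cases (a - b) with ⟨h4, h4'⟩ | ⟨h4, h4'⟩ <;>
    rcases max_cases |a| |b| with ⟨h5, h5'⟩ | ⟨h5, h5'⟩ <;> linarith
  have h1 : |a + b| / √2 + |a - b| / √2 = √2 * max |a| |b| := by
    rw [← add_div, hsum, hdiv]; ring
  have h2 : |a| + |b| + |a + b| / √2 + |a - b| / √2 = |a| + |b| + √2 * max |a| |b| := by
    rw [← h1]; ring
  rw [h2]
  rcases le_total |a| |b| with h | h
  · rw [max_eq_right h, add_comm (|a| ^ 2)]
    refine (aux |b| |a| (abs_nonneg a) h).trans (le_of_eq ?_)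
    linear_combination (-|b|) * hs
  · rw [max_eq_left h]
    refine (aux |a| |b| (abs_nonneg b) h).trans (le_of_eq ?_)
    linear_combination (-|a|) * hs

theorem norm_le_sum_abs_inner (z : Plane) :
    ‖z‖ ≤ (√2 - 1) * ∑ i, |inner ℝ (direction i) z| := by
  have h := abs_add_abs_add_le (a := z 0) (b := z 1)
  have hs0 : 0 < √2 := Real.sqrt_pos.2 two_pos
  have e0 : inner ℝ (direction 0) z = z 0 := by
    simp [direction, PiLp.inner_apply, Fin.sum_univ_two]
  have e1 : inner ℝ (direction 1) z = z 1 := by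
    simp [direction, PiLp.inner_apply, Fin.sum_univ_two]
  have e2 : inner ℝ (direction 2) z = (z 0 + z 1) / √2 := by
    simp [direction, PiLp.inner_apply, Fin.sum_univ_two]; ring
  have e3 : inner ℝ (direction 3) z = (z 0 - z 1) / √2 := by
    simp [direction, PiLp.inner_apply, Fin.sum_univ_two]; ring
  rw [EuclideanSpace.norm_eq, Fin.sum_univ_four, e0, e1, e2, e3]
  simp only [Fin.sum_univ_two, Real.norm_eq_abs, sq_abs, abs_div, abs_of_pos hs0]
  exact h

/-- The averaged cutting inequality. -/
theorem IsMinimizer.lintegral_edist_le {α m : ℝ} {Ω : Set Plane} (h0 : 0 < α) (hα : α < 2)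
    (hΩ : MeasurableSet Ω) (h : IsMinimizer α m Ω) (hE : energy α Ω ≠ ∞) :
    ∫⁻ x in Ω, ∫⁻ y in Ω, edist x y * (edist x y ^ α)⁻¹ ≤
      ENNReal.ofReal (8 * (√2 - 1)) * volume Ω := by
  have hs : 0 ≤ √2 - 1 := by
    rw [sub_nonneg, Real.one_le_sqrt]; norm_num
  calc ∫⁻ x in Ω, ∫⁻ y in Ω, edist x y * (edist x y ^ α)⁻¹
      ≤ ∫⁻ x in Ω, ∫⁻ y in Ω, ENNReal.ofReal (√2 - 1) *
          ∑ i, ENNReal.ofReal |inner ℝ (direction i) (x - y)| * (edist x y ^ α)⁻¹ := by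
        refine lintegral_mono fun x => lintegral_mono fun y => ?_
        rw [← Finset.sum_mul, ← mul_assoc, ← ENNReal.ofReal_sum_of_nonneg fun i _ => abs_nonneg _,
          ← ENNReal.ofReal_mul hs]
        gcongr
        rw [edist_dist, dist_eq_norm]
        exact ENNReal.ofReal_le_ofReal (norm_le_sum_abs_inner _)
    _ = ENNReal.ofReal (√2 - 1) * ∑ i, ∫⁻ x in Ω, ∫⁻ y in Ω,
          ENNReal.ofReal |inner ℝ (direction i) (x - y)| * (edist x y ^ α)⁻¹ := by
        rw [← lintegral_finsetSum _ fun i _ =>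
          (measurable_abs_inner_mul_kernel α (direction i)).lintegral_prod_right',
          ← lintegral_const_mul' _ _ ENNReal.ofReal_ne_top]
        refine lintegral_congr fun x => ?_
        rw [lintegral_const_mul' _ _ ENNReal.ofReal_ne_top, lintegral_finsetSum _ fun i _ =>
          measurable_abs_inner_mul_kernel_right α (direction i) x]
    -- Four directions at cost 2 each yield 8(√2-1) ≈ 3.31. Averaging over the whole circle would
    -- give π; the loss is affordable and no integral over directions is needed.
    _ ≤ ENNReal.ofReal (√2 - 1) * ∑ _i : Fin 4, 2 * volume Ω := by
        gcongr with i
        exact h.lintegral_abs_inner_le h0 hα hΩ hE (norm_direction i).le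
    _ = ENNReal.ofReal (8 * (√2 - 1)) * volume Ω := by
        rw [ENNReal.ofReal_mul (by norm_num), ENNReal.ofReal_ofNat, Finset.sum_const,
          Finset.card_univ, Fintype.card_fin, nsmul_eq_mul]
        push_cast; ring

/-- Hölder with weights 1-α and α: off the diagonal, |x-y|^{-α} to the power 1-α times |x-y|^{1-α}
to the power α is 1. -/
theorem volume_sq_le (Ω : Set Plane) {α : ℝ} (h0 : 0 < α) (hα : α < 1) :
    volume Ω * volume Ω ≤ interaction α Ω ^ (1 - α) *
      (∫⁻ x in Ω, ∫⁻ y in Ω, edist x y * (edist x y ^ α)⁻¹) ^ α := by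
  have hk := measurable_kernel α
  have hk' : Measurable fun p : Plane × Plane => edist p.1 p.2 * (edist p.1 p.2 ^ α)⁻¹ :=
    (measurable_fst.edist measurable_snd).mul hk
  set μ : Measure Plane := volume.restrict Ω
  have hV : interaction α Ω = ∫⁻ p, (edist p.1 p.2 ^ α)⁻¹ ∂(μ.prod μ) :=
    (lintegral_prod _ hk.aemeasurable).symm
  have hM : ∫⁻ x in Ω, ∫⁻ y in Ω, edist x y * (edist x y ^ α)⁻¹ =
      ∫⁻ p, edist p.1 p.2 * (edist p.1 p.2 ^ α)⁻¹ ∂(μ.prod μ) :=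
    (lintegral_prod _ hk'.aemeasurable).symm
  have hdiag : ∀ᵐ p ∂(μ.prod μ), p.1 ≠ p.2 := by
    have hm : MeasurableSet {p : Plane × Plane | p.1 = p.2} :=
      measurableSet_eq_fun measurable_fst measurable_snd
    rw [ae_iff]
    simp only [ne_eq, not_not]
    rw [Measure.measure_prod_null hm]
    refine Eventually.of_forall fun x => ?_
    have : Prod.mk x ⁻¹' {p : Plane × Plane | p.1 = p.2} = {x} := by
      ext y; simp [eq_comm]
    simp only [this, Pi.zero_apply]
    exact measure_singleton x
  rw [hV, hM]
  calc volume Ω * volume Ω = ∫⁻ _, 1 ∂(μ.prod μ) := by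
        rw [lintegral_one, ← univ_prod_univ, Measure.prod_prod]
        simp [μ]
    _ = ∫⁻ p, ((edist p.1 p.2 ^ α)⁻¹) ^ (1 - α) *
          (edist p.1 p.2 * (edist p.1 p.2 ^ α)⁻¹) ^ α ∂(μ.prod μ) := by
        refine lintegral_congr_ae ?_
        filter_upwards [hdiag] with p hp
        have hp0 : edist p.1 p.2 ≠ 0 := fun h => hp (edist_eq_zero.1 h)
        have hpt : edist p.1 p.2 ≠ ∞ := edist_ne_top _ _
        set d := edist p.1 p.2
        have e1 : d * (d ^ α)⁻¹ = d ^ (1 - α) := by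
          rw [← ENNReal.rpow_neg, sub_eq_add_neg, ENNReal.rpow_add _ _ hp0 hpt, ENNReal.rpow_one]
        rw [e1, ← ENNReal.rpow_neg, ← ENNReal.rpow_mul, ← ENNReal.rpow_mul,
          ← ENNReal.rpow_add _ _ hp0 hpt]
        have e2 : -α * (1 - α) + (1 - α) * α = 0 := by ring
        rw [e2, ENNReal.rpow_zero]
    _ ≤ _ := ENNReal.lintegral_mul_norm_pow_le hk.aemeasurable hk'.aemeasurable (by linarith)
        h0.le (by ring)

/-- A lower bound for the interaction of a minimizer. -/
theorem IsMinimizer.le_interaction {α m : ℝ} {Ω : Set Plane} (h0 : 0 < α) (hα : α < 1)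
    (hΩ : MeasurableSet Ω) (h : IsMinimizer α m Ω) (hE : energy α Ω ≠ ∞) (hm : 0 < m) {d : ℝ}
    (hd : 0 < d) (hmd : 8 * (√2 - 1) ≤ m * d ^ (1 - α)) :
    ENNReal.ofReal (m ^ 2 / d ^ α) ≤ interaction α Ω := by
  have hVfin : interaction α Ω ≠ ∞ := ne_top_of_le_ne_top hE le_add_self
  have hs : 0 ≤ 8 * (√2 - 1) := by
    have : 1 ≤ √2 := by rw [Real.one_le_sqrt]; norm_num
    linarith
  rw [ENNReal.ofReal_le_iff_le_toReal hVfin]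
  set V := (interaction α Ω).toReal with hV
  have hV0 : 0 ≤ V := ENNReal.toReal_nonneg
  have h1 := volume_sq_le Ω h0 hα
  have h2 := h1.trans (mul_le_mul_right (ENNReal.rpow_le_rpow
    (h.lintegral_edist_le h0 (by linarith) hΩ hE) h0.le) _)
  rw [h.2.1, ← ENNReal.ofReal_toReal hVfin, ← hV, ← ENNReal.ofReal_mul hs, ← ENNReal.ofReal_mul hm.le,
    ENNReal.ofReal_rpow_of_nonneg hV0 (by linarith),
    ENNReal.ofReal_rpow_of_nonneg (by positivity) h0.le, ← ENNReal.ofReal_mul (by positivity),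
    ENNReal.ofReal_le_ofReal_iff (by positivity)] at h2
  -- The hypothesis on d bounds the moment by m²d^{1-α}. In the Hölder estimate the powers of m²
  -- then combine into (m²/d^α)^{1-α} ≤ V^{1-α}.
  have h3 : (8 * (√2 - 1) * m) ^ α ≤ (m * m) ^ α * (d ^ α) ^ (1 - α) := by
    rw [← Real.rpow_mul hd.le, mul_comm α, Real.rpow_mul hd.le,
      ← Real.mul_rpow (by positivity) (by positivity)]
    refine Real.rpow_le_rpow (by positivity) ?_ h0.le
    nlinarith
  have hdα : 0 < d ^ α := Real.rpow_pos_of_pos hd α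
  have h4 : (m ^ 2 / d ^ α) ^ (1 - α) ≤ V ^ (1 - α) := by
    rw [Real.div_rpow (by positivity) hdα.le, div_le_iff₀ (by positivity)]
    have hmm : 0 < (m * m) ^ α := by positivity
    refine le_of_mul_le_mul_left ?_ hmm
    calc (m * m) ^ α * (m ^ 2) ^ (1 - α) = m * m := by
          rw [sq, ← Real.rpow_add (by positivity)]
          norm_num
      _ ≤ V ^ (1 - α) * ((m * m) ^ α * (d ^ α) ^ (1 - α)) :=
          h2.trans (mul_le_mul_of_nonneg_left h3 (by positivity))
      _ = _ := by ring
  exact (Real.rpow_le_rpow_iff (by positivity) hV0 (by linarith)).1 h4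

/-! ### The critical radius -/

/-- The ratio of the interaction and half the perimeter terms at the critical radius. -/
noncomputable def criticalRatio (α : ℝ) : ℝ := (√2 - 1) / (1 - (2 : ℝ) ^ ((α - 2) / 2))

/-- The base of the power in the formula for the critical mass. -/
noncomputable def criticalBase (α : ℝ) : ℝ :=
  ((√2 - 1) * Real.Gamma (2 - α / 2) * Real.Gamma (3 - α / 2)) /
    (Real.pi * (1 - (2 : ℝ) ^ ((α - 2) / 2)) * Real.Gamma (2 - α))

theorem mc1_eq (α : ℝ) : mc1 α = Real.pi * criticalBase α ^ (2 / (3 - α)) := rfl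

theorem sqrt_two_sub_one_pos : 0 < √2 - 1 := by
  rw [sub_pos, Real.lt_sqrt] <;> norm_num

theorem one_sub_rpow_pos {α : ℝ} (hα : α < 2) : 0 < 1 - (2 : ℝ) ^ ((α - 2) / 2) :=
  sub_pos.2 (Real.rpow_lt_one_of_one_lt_of_neg one_lt_two (by linarith))

theorem criticalRatio_pos {α : ℝ} (hα : α < 2) : 0 < criticalRatio α :=
  div_pos sqrt_two_sub_one_pos (one_sub_rpow_pos hα)

theorem criticalBase_pos {α : ℝ} (hα : α < 2) : 0 < criticalBase α := by
  have h1 : 0 < Real.Gamma (2 - α) := Real.Gamma_pos_of_pos (by linarith)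
  have h2 : 0 < Real.Gamma (2 - α / 2) := Real.Gamma_pos_of_pos (by linarith)
  have h3 : 0 < Real.Gamma (3 - α / 2) := Real.Gamma_pos_of_pos (by linarith)
  have h4 := one_sub_rpow_pos hα
  have h5 := sqrt_two_sub_one_pos
  have h6 := Real.pi_pos
  unfold criticalBase
  positivity

theorem mc1_pos {α : ℝ} (hα : α < 2) : 0 < mc1 α :=
  mul_pos Real.pi_pos (Real.rpow_pos_of_pos (criticalBase_pos hα) _)

theorem Rc1_pos {α : ℝ} (hα : α < 2) : 0 < Rc1 α :=
  Real.sqrt_pos.2 (div_pos (mc1_pos hα) Real.pi_pos)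

theorem pi_mul_Rc1_sq {α : ℝ} (hα : α < 2) : Real.pi * Rc1 α ^ 2 = mc1 α := by
  have := Real.pi_pos
  rw [Rc1, Real.sq_sqrt (div_pos (mc1_pos hα) Real.pi_pos).le]
  field_simp

theorem Rc1_rpow {α : ℝ} (hα : α < 2) : Rc1 α ^ (3 - α) = criticalBase α := by
  have hb := criticalBase_pos hα
  have : Rc1 α = criticalBase α ^ (1 / (3 - α)) := by
    rw [Rc1, mc1_eq, mul_div_cancel_left₀ _ Real.pi_pos.ne', Real.sqrt_eq_rpow,
      ← Real.rpow_mul hb.le]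
    congr 1
    field_simp
  rw [this, ← Real.rpow_mul hb.le, one_div, inv_mul_cancel₀ (by linarith), Real.rpow_one]

/-- At the critical radius, one disk and two disks of half the mass have the same energy. -/
theorem V0_mul_Rc1_rpow {α : ℝ} (hα : α < 2) :
    V0 α * Rc1 α ^ (3 - α) = 2 * Real.pi * criticalRatio α := by
  have h1 : 0 < Real.Gamma (2 - α) := Real.Gamma_pos_of_pos (by linarith)
  have h2 : 0 < Real.Gamma (2 - α / 2) := Real.Gamma_pos_of_pos (by linarith)
  have h3 : 0 < Real.Gamma (3 - α / 2) := Real.Gamma_pos_of_pos (by linarith)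
  have h4 := one_sub_rpow_pos hα
  have h6 := Real.pi_pos
  rw [Rc1_rpow hα, V0_eq hα, criticalBase, criticalRatio]
  generalize Real.Gamma (2 - α / 2) = a at *
  generalize Real.Gamma (3 - α / 2) = b at *
  field_simp

/-- The energy per unit mass of a disk. -/
noncomputable def diskDensity (α r : ℝ) : ℝ := 2 / r + V0 α / Real.pi * r ^ (2 - α)

theorem E1_eq {α r : ℝ} (hr : 0 < r) : E1 α r = Real.pi * r ^ 2 * diskDensity α r := by
  have h6 := Real.pi_pos
  have : r ^ (4 - α) = r ^ 2 * r ^ (2 - α) := by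
    rw [← Real.rpow_natCast r 2, ← Real.rpow_add hr]
    congr 1; push_cast; ring
  rw [E1, diskDensity, this]
  field_simp

theorem rhoc1_eq_diskDensity {α : ℝ} (hα : α < 2) : rhoc1 α = diskDensity α (Rc1 α) := by
  have hR := Rc1_pos hα
  have h6 := Real.pi_pos
  rw [rhoc1, E1_eq hR, mul_div_cancel_left₀ _ (by positivity)]

theorem V0_div_pi_mul_Rc1_rpow {α : ℝ} (hα : α < 2) :
    V0 α / Real.pi * Rc1 α ^ (2 - α) = 2 * criticalRatio α / Rc1 α := by
  have hR := Rc1_pos hα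
  have h6 := Real.pi_pos
  have h1 := V0_mul_Rc1_rpow hα
  have h2 : Rc1 α ^ (3 - α) = Rc1 α ^ (2 - α) * Rc1 α := by
    rw [← Real.rpow_add_one hR.ne']; congr 1; ring
  rw [h2] at h1
  field_simp
  linarith

theorem rhoc1_eq {α : ℝ} (hα : α < 2) : rhoc1 α = 2 * (1 + criticalRatio α) / Rc1 α := by
  rw [rhoc1_eq_diskDensity hα, diskDensity, V0_div_pi_mul_Rc1_rpow hα]
  ring

theorem rhoc1_pos {α : ℝ} (hα : α < 2) : 0 < rhoc1 α := by
  rw [rhoc1_eq hα]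
  have := criticalRatio_pos hα
  have := Rc1_pos hα
  positivity

/-- Splitting a disk into two equal distant disks multiplies the perimeter by √2 and the interaction
by 2^{(α-2)/2}. At R_{c1} the loss √2-1 and the gain 1-2^{(α-2)/2} balance; their quotient is
`criticalRatio`. -/
theorem diskDensity_half_mass {α : ℝ} (hα : α < 2) :
    diskDensity α (Rc1 α / √2) = rhoc1 α := by
  have hR := Rc1_pos hα
  have hs : 0 < √2 := Real.sqrt_pos.2 two_pos
  have hq : criticalRatio α * (1 - (2 : ℝ) ^ ((α - 2) / 2)) = √2 - 1 :=
    div_mul_cancel₀ _ (one_sub_rpow_pos hα).ne'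
  have hp : (Rc1 α / √2) ^ (2 - α) = Rc1 α ^ (2 - α) * 2 ^ ((α - 2) / 2) := by
    rw [Real.div_rpow hR.le hs.le, Real.sqrt_eq_rpow, ← Real.rpow_mul (by norm_num), div_eq_mul_inv,
      ← Real.rpow_neg (by norm_num)]
    congr 2; ring
  rw [diskDensity, hp, ← mul_assoc, V0_div_pi_mul_Rc1_rpow hα, rhoc1_eq hα]
  field_simp
  linarith

/-- Disks whose mass is between half the critical mass and the critical mass have energy density
at most the critical one. -/
theorem diskDensity_le {α r : ℝ} (hα : α ≤ 1) (h1 : Rc1 α / √2 ≤ r) (h2 : r ≤ Rc1 α) :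
    diskDensity α r ≤ rhoc1 α := by
  have hα2 : α < 2 := by linarith
  have hR := Rc1_pos hα2
  have hs : 0 < √2 := Real.sqrt_pos.2 two_pos
  -- Here α ≤ 1 makes the exponent 2-α at least 1.
  have hconv : ConvexOn ℝ (Ioi 0) (diskDensity α) := by
    have c1 : ConvexOn ℝ (Ioi 0) fun r : ℝ => 2 / r := by
      have := (convexOn_zpow (𝕜 := ℝ) (-1)).smul (c := (2 : ℝ)) (by norm_num)
      refine this.congr fun r _ => ?_
      simp [div_eq_mul_inv]
    have c2 : ConvexOn ℝ (Ioi 0) fun r : ℝ => V0 α / Real.pi * r ^ (2 - α) :=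
      ((convexOn_rpow (by linarith : 1 ≤ 2 - α)).subset Ioi_subset_Ici_self (convex_Ioi 0)).smul
        (div_pos (V0_pos hα2) Real.pi_pos).le
    exact c1.add c2
  have := hconv.le_max_of_mem_Icc (x := Rc1 α / √2) (y := Rc1 α) (z := r)
    (div_pos hR hs) hR ⟨h1, h2⟩
  rwa [diskDensity_half_mass hα2, ← rhoc1_eq_diskDensity hα2, max_self] at this

/-- Rounding m/m_{c1} ≥ 1 up to N at most doubles it, so N equal disks have radii between R_{c1}/√2
and R_{c1}, where the density is at most ρ_{c1}. -/
theorem IsMinimizer.energy_le {α m : ℝ} {Ω : Set Plane} (h0 : 0 < α) (hα : α ≤ 1)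
    (hm : mc1 α ≤ m) (h : IsMinimizer α m Ω) :
    energy α Ω ≤ ENNReal.ofReal (rhoc1 α * m) := by
  have hα2 : α < 2 := by linarith
  have hc := mc1_pos hα2
  have hm0 : 0 < m := hc.trans_le hm
  have hR := Rc1_pos hα2
  have hpi := Real.pi_pos
  set N := ⌈m / mc1 α⌉₊ with hN
  have hN1 : m / mc1 α ≤ N := Nat.le_ceil _
  have hN2 : (N : ℝ) < m / mc1 α + 1 := Nat.ceil_lt_add_one (by positivity)
  have hge : 1 ≤ m / mc1 α := (one_le_div hc).2 hm
  have hN0 : (0 : ℝ) < N := by linarith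
  have hmN : m ≤ N * mc1 α := (div_le_iff₀ hc).1 hN1
  have hNm : N * mc1 α ≤ 2 * m := by
    have : N * mc1 α ≤ (m / mc1 α + m / mc1 α) * mc1 α := by gcongr; linarith
    rw [add_mul, div_mul_cancel₀ _ hc.ne'] at this
    linarith
  set s := √(m / (N * Real.pi)) with hs
  have hs0 : 0 < s := Real.sqrt_pos.2 (by positivity)
  have hs2 : s ^ 2 = m / (N * Real.pi) := Real.sq_sqrt (by positivity)
  have hsm : N * (Real.pi * s ^ 2) = m := by rw [hs2]; field_simp
  have hRm := pi_mul_Rc1_sq hα2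
  have h1 : s ≤ Rc1 α := by
    refine (pow_le_pow_iff_left₀ hs0.le hR.le two_ne_zero).1 ?_
    rw [hs2, div_le_iff₀ (by positivity)]
    calc m ≤ N * mc1 α := hmN
      _ = _ := by rw [← hRm]; ring
  have h2 : Rc1 α / √2 ≤ s := by
    refine (pow_le_pow_iff_left₀ (by positivity) hs0.le two_ne_zero).1 ?_
    rw [hs2, div_pow, Real.sq_sqrt (by norm_num), div_le_div_iff₀ (by norm_num) (by positivity)]
    calc Rc1 α ^ 2 * (N * Real.pi) = N * mc1 α := by rw [← hRm]; ring
      _ ≤ m * 2 := by linarith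
  refine (h.energy_le_disks h0 hα2 hs0 hsm).trans (ENNReal.ofReal_le_ofReal ?_)
  rw [E1_eq hs0]
  calc N * (Real.pi * s ^ 2 * diskDensity α s) = m * diskDensity α s := by
        rw [← mul_assoc, hsm]
    _ ≤ m * rhoc1 α := by gcongr; exact diskDensity_le hα h2 h1
    _ = rhoc1 α * m := mul_comm _ _

/-! ### The numerical condition -/

/-- Log-convexity of Γ: the points 2 and 3-α are convex combinations of 2-α/2 and 3-α/2 with swapped
weights, so Γ(2)Γ(3-α) ≤ Γ(2-α/2)Γ(3-α/2). -/
theorem le_criticalBase {α : ℝ} (h0 : 0 < α) (hα : α < 2) :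
    criticalRatio α * (2 - α) / Real.pi ≤ criticalBase α := by
  have h1 : 0 < Real.Gamma (2 - α) := Real.Gamma_pos_of_pos (by linarith)
  have h2 : 0 < Real.Gamma (2 - α / 2) := Real.Gamma_pos_of_pos (by linarith)
  have h3 : 0 < Real.Gamma (3 - α / 2) := Real.Gamma_pos_of_pos (by linarith)
  have h4 := one_sub_rpow_pos hα
  have h5 := sqrt_two_sub_one_pos
  have h6 := Real.pi_pos
  have e3 : Real.Gamma (3 - α) = (2 - α) * Real.Gamma (2 - α) := by
    rw [← Real.Gamma_add_one (by linarith)]; congr 1; ring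
  set a := Real.Gamma (2 - α / 2)
  set b := Real.Gamma (3 - α / 2)
  have g1 : (1 : ℝ) ≤ a ^ (1 - α / 2) * b ^ (α / 2) := by
    have := Real.Gamma_mul_add_mul_le_rpow_Gamma_mul_rpow_Gamma (s := 2 - α / 2) (t := 3 - α / 2)
      (a := 1 - α / 2) (b := α / 2) (by linarith) (by linarith) (by linarith) (by linarith)
      (by ring)
    have e : (1 - α / 2) * (2 - α / 2) + α / 2 * (3 - α / 2) = 2 := by ring
    rwa [e, Real.Gamma_two] at this
  have g2 : Real.Gamma (3 - α) ≤ a ^ (α / 2) * b ^ (1 - α / 2) := by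
    have := Real.Gamma_mul_add_mul_le_rpow_Gamma_mul_rpow_Gamma (s := 2 - α / 2) (t := 3 - α / 2)
      (a := α / 2) (b := 1 - α / 2) (by linarith) (by linarith) (by linarith) (by linarith)
      (by ring)
    have e : α / 2 * (2 - α / 2) + (1 - α / 2) * (3 - α / 2) = 3 - α := by ring
    rwa [e] at this
  have g3 : (2 - α) * Real.Gamma (2 - α) ≤ a * b := by
    have hG : 0 < Real.Gamma (3 - α) := Real.Gamma_pos_of_pos (by linarith)
    calc (2 - α) * Real.Gamma (2 - α) = 1 * Real.Gamma (3 - α) := by rw [e3, one_mul]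
      _ ≤ (a ^ (1 - α / 2) * b ^ (α / 2)) * (a ^ (α / 2) * b ^ (1 - α / 2)) := by
          gcongr
      _ = (a ^ (1 - α / 2) * a ^ (α / 2)) * (b ^ (α / 2) * b ^ (1 - α / 2)) := by ring
      _ = a * b := by
          rw [← Real.rpow_add h2, ← Real.rpow_add h3]
          norm_num
  rw [criticalBase, criticalRatio, div_mul_eq_mul_div, div_div, div_le_div_iff₀ (by positivity)
    (by positivity)]
  have := mul_le_mul_of_nonneg_left g3 (show 0 ≤ (√2 - 1) * (1 - (2 : ℝ) ^ ((α - 2) / 2)) *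
    Real.pi by positivity)
  linarith

/-- The tangent at α = 0 has slope (log 2)/4, which exceeds 3/20. -/
theorem two_rpow_lower {α : ℝ} (h0 : 0 ≤ α) : 1 / 2 + 3 / 20 * α ≤ (2 : ℝ) ^ ((α - 2) / 2) := by
  have h1 : (2 : ℝ) ^ ((α - 2) / 2) = 1 / 2 * Real.exp (Real.log 2 * (α / 2)) := by
    rw [← Real.rpow_def_of_pos two_pos, sub_div, div_self two_ne_zero, Real.rpow_sub two_pos,
      Real.rpow_one]
    ring
  have h2 := Real.add_one_le_exp (Real.log 2 * (α / 2))
  have h3 := Real.log_two_gt_d9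
  rw [h1]
  nlinarith

/-- By monotonicity m = m_{c1} is the worst case. There ρ_{c1}m/2 = π(1+q)R_{c1} with q the critical
ratio, and the right side is at least q(2-α)(π(1+q))^{1-α}. As 1-α ≥ 1/2, the last power is at least
√5.73 > 2.39. Dividing by q, it remains to see that 8(1-2^{(α-2)/2}), at most 4 - 1.2α, does not
exceed 2.39(2-α). -/
theorem numerical_condition {α : ℝ} (h0 : 0 < α) (hα : α ≤ 1 / 2) {m : ℝ} (hm : mc1 α ≤ m) :
    8 * (√2 - 1) ≤ m * (rhoc1 α * m / 2) ^ (1 - α) := by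
  have hα2 : α < 2 := by linarith
  have hR := Rc1_pos hα2
  have hq := criticalRatio_pos hα2
  have hρ := rhoc1_pos hα2
  have hc := mc1_pos hα2
  have hpi := Real.pi_pos
  have hs := sqrt_two_sub_one_pos
  have hp := one_sub_rpow_pos hα2
  set q := criticalRatio α with hqdef
  set R := Rc1 α with hRdef
  have hqp : q * (1 - (2 : ℝ) ^ ((α - 2) / 2)) = √2 - 1 :=
    div_mul_cancel₀ _ (one_sub_rpow_pos hα2).ne'
  have hlow := two_rpow_lower h0.le
  have hq2 : 2 * (√2 - 1) ≤ q := by nlinarith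
  have hsq2 : 1.414 ≤ √2 := Real.le_sqrt_of_sq_le (by norm_num)
  have hbase : 5.73 ≤ Real.pi * (1 + q) := by
    have := Real.pi_gt_d2
    nlinarith
  have hroot : 2.39 ≤ (Real.pi * (1 + q)) ^ (1 - α) := by
    calc (2.39 : ℝ) ≤ √5.73 := Real.le_sqrt_of_sq_le (by norm_num)
      _ = 5.73 ^ (1 / 2 : ℝ) := Real.sqrt_eq_rpow _
      _ ≤ 5.73 ^ (1 - α) := Real.rpow_le_rpow_of_exponent_le (by norm_num) (by linarith)
      _ ≤ _ := Real.rpow_le_rpow (by norm_num) hbase (by linarith)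
  have hmain : 8 * (√2 - 1) ≤ q * (2 - α) * 2.39 := by
    rw [← hqp]
    nlinarith
  have hmR : Real.pi * R ^ 2 = mc1 α := pi_mul_Rc1_sq hα2
  have hρm : Real.pi * (1 + q) * R = rhoc1 α * mc1 α / 2 := by
    rw [← hmR, rhoc1_eq hα2, ← hqdef, ← hRdef]
    field_simp
  calc 8 * (√2 - 1) ≤ q * (2 - α) * 2.39 := hmain
    _ ≤ (Real.pi * criticalBase α) * (Real.pi * (1 + q)) ^ (1 - α) := by
        have h1 := le_criticalBase h0 hα2
        rw [div_le_iff₀ hpi] at h1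
        have h2 : 0 < 2 - α := by linarith
        refine mul_le_mul ?_ hroot (by norm_num) (by have := criticalBase_pos hα2; positivity)
        linarith
    _ = mc1 α * (Real.pi * (1 + q) * R) ^ (1 - α) := by
        rw [Real.mul_rpow (by positivity) hR.le, ← hmR, ← Rc1_rpow hα2, ← hRdef]
        have : R ^ (3 - α) = R ^ 2 * R ^ (1 - α) := by
          rw [← Real.rpow_natCast R 2, ← Real.rpow_add hR]
          congr 1; push_cast; ring
        rw [this]; ring
    _ = mc1 α * (rhoc1 α * mc1 α / 2) ^ (1 - α) := by rw [hρm]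
    _ ≤ m * (rhoc1 α * m / 2) ^ (1 - α) := by
        have h1 : 0 ≤ 1 - α := by linarith
        have h2 : 0 ≤ m := hc.le.trans hm
        gcongr

/-! ### The auxiliary root -/

/-- Multiplying by r turns the equation into g(r) = Kr^{p+1} - ρr + 2 = 0. This g is strictly
convex, negative at R and positive far out, so beyond R it vanishes exactly once and changes sign
there. The last two clauses record the sign on either side, for nonexistence and for the limit. -/
theorem exists_unique_root {K ρ p R : ℝ} (hK : 0 < K) (hp : 1 ≤ p) (hR : 0 < R)
    (h : 2 / R + K * R ^ p < ρ) :
    ∃ R₀, R < R₀ ∧ 2 / R₀ + K * R₀ ^ p = ρ ∧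
      (∀ r, R ≤ r → 2 / r + K * r ^ p = ρ → r = R₀) ∧
      (∀ r, R₀ < r → ρ < 2 / r + K * r ^ p) ∧
      ∀ r, R ≤ r → ρ < 2 / r + K * r ^ p → R₀ < r := by
  set g : ℝ → ℝ := fun r => K * r ^ (p + 1) + (-ρ * r + 2) with hg
  have hconv : StrictConvexOn ℝ (Ici 0) g := by
    have c1 : StrictConvexOn ℝ (Ici 0) fun r : ℝ => K * r ^ (p + 1) := by
      refine ⟨convex_Ici 0, fun x hx y hy hxy a b ha hb hab => ?_⟩
      have := (strictConvexOn_rpow (by linarith : 1 < p + 1)).2 hx hy hxy ha hb hab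
      simp only [smul_eq_mul] at this ⊢
      nlinarith
    have c2 : ConvexOn ℝ (Ici 0) fun r : ℝ => -ρ * r + 2 := by
      refine ⟨convex_Ici 0, fun x _ y _ a b _ _ hab => le_of_eq ?_⟩
      simp only [smul_eq_mul]
      linear_combination (-2) * hab
    exact c1.add_convexOn c2
  have hgf (r : ℝ) (hr : 0 < r) : g r = r * (2 / r + K * r ^ p - ρ) := by
    simp only [hg]
    rw [Real.rpow_add_one hr.ne']
    field_simp
    ring
  have hgR : g R < 0 := by
    rw [hgf R hR]
    exact mul_neg_of_pos_of_neg hR (by linarith)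
  have hbetween (x y z : ℝ) (hx : 0 < x) (hxy : x < y) (hyz : y < z) :
      g y < max (g x) (g z) :=
    hconv.lt_on_openSegment hx.le (by simp only [mem_Ici]; linarith) (by linarith)
      (by rw [openSegment_eq_Ioo (by linarith)]; exact ⟨hxy, hyz⟩)
  have hgcont : Continuous g :=
    (continuous_const.mul (Real.continuous_rpow_const (by linarith))).add (by fun_prop)
  -- Beyond 1 one has r^p ≥ r, and beyond ρ/K one has Kr ≥ ρ; so g is positive at r₁.
  set r₁ := max (R + 1) (max 1 (ρ / K)) with hr₁
  have hr₁R : R < r₁ := by have := le_max_left (R + 1) (max 1 (ρ / K)); linarith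
  have hr₁1 : 1 ≤ r₁ := (le_max_left _ _).trans (le_max_right _ _)
  have hr₁ρ : ρ / K ≤ r₁ := (le_max_right _ _).trans (le_max_right _ _)
  have hr₁0 : 0 < r₁ := by linarith
  have hgr₁ : 0 < g r₁ := by
    rw [hgf r₁ hr₁0]
    have h1 : r₁ ≤ r₁ ^ p := by
      simpa using Real.rpow_le_rpow_of_exponent_le hr₁1 hp
    have h2 : ρ ≤ K * r₁ ^ p := by
      rw [div_le_iff₀ hK] at hr₁ρ
      nlinarith
    have h3 : 0 < 2 / r₁ := by positivity
    exact mul_pos hr₁0 (by linarith)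
  obtain ⟨R₀, ⟨hR₀, -⟩, hgR₀⟩ := intermediate_value_Icc hr₁R.le hgcont.continuousOn
    (show (0 : ℝ) ∈ Icc (g R) (g r₁) from ⟨hgR.le, hgr₁.le⟩)
  have hlt : R < R₀ := lt_of_le_of_ne hR₀ fun h => by rw [h] at hgR; linarith
  have hR₀0 : 0 < R₀ := hR.trans hlt
  have hroot (r : ℝ) (hr : 0 < r) (he : 2 / r + K * r ^ p = ρ) : g r = 0 := by
    rw [hgf r hr, he, sub_self, mul_zero]
  refine ⟨R₀, hlt, ?_, fun r hr he => ?_, fun r hr => ?_, fun r hr hρr => ?_⟩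
  · have := hgf R₀ hR₀0
    rw [hgR₀] at this
    rcases mul_eq_zero.1 this.symm with h0 | h0
    · exact absurd h0 hR₀0.ne'
    · linarith
  · have hr0 : 0 < r := hR.trans_le hr
    have hgr := hroot r hr0 he
    have hrR : R < r := lt_of_le_of_ne hr fun h => by rw [← h] at hgr; linarith
    rcases lt_trichotomy r R₀ with h1 | h1 | h1
    · have := hbetween R r R₀ hR hrR h1
      rw [hgR₀, hgr, max_eq_right hgR.le] at this
      exact absurd this (lt_irrefl _)
    · exact h1
    · have := hbetween R R₀ r hR hlt h1
      rw [hgR₀, hgr, max_eq_right hgR.le] at this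
      exact absurd this (lt_irrefl _)
  · have h1 := hbetween R R₀ r hR hlt hr
    rw [hgR₀] at h1
    have h2 : 0 < g r := (lt_max_iff.1 h1).resolve_left (by linarith)
    rw [hgf r (hR₀0.trans hr)] at h2
    have := pos_of_mul_pos_right h2 (hR₀0.trans hr).le
    linarith
  · by_contra! hcon
    have hr0 : 0 < r := hR.trans_le hr
    have hgr : 0 < g r := by
      rw [hgf r hr0]
      exact mul_pos hr0 (by linarith)
    have hrR : R < r := lt_of_le_of_ne hr fun h => by rw [← h] at hgr; linarith
    rcases hcon.lt_or_eq with h1 | h1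
    · have := hbetween R r R₀ hR hrR h1
      rw [hgR₀, max_eq_right hgR.le] at this
      linarith
    · rw [h1, hgR₀] at hgr
      exact lt_irrefl _ hgr

/-- The perimeter terms agree. The interaction of the critical disk is at least m²/(2R_{c1})^α by
its diameter, and the diameter is smaller than ρ_{c1}m/2 because πρ_{c1}R_{c1} = 2π(1+q) > 4, where
q is the critical ratio. -/
theorem rho0_Rc1_lt {α : ℝ} (h0 : 0 < α) (hα : α < 2) : rho0 α (Rc1 α) < rhoc1 α := by
  have hR := Rc1_pos hα
  have hq := criticalRatio_pos hα
  have hρ := rhoc1_pos hα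
  have hpi := Real.pi_pos
  have hd : rhoc1 α = 2 / Rc1 α + V0 α / Real.pi * Rc1 α ^ (2 - α) := rhoc1_eq_diskDensity hα
  suffices h : 2 ^ α * Real.pi ^ (1 - α) / rhoc1 α ^ α * Rc1 α ^ (2 - 2 * α) <
      V0 α / Real.pi * Rc1 α ^ (2 - α) by
    rw [rho0]
    linarith
  have hV : Real.pi ^ 2 / 2 ^ α ≤ V0 α := le_V0 h0.le hα
  have h1 : Rc1 α ^ (2 - α) = Rc1 α ^ α * Rc1 α ^ (2 - 2 * α) := by
    rw [← Real.rpow_add hR]; congr 1; ring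
  have h2 : (4 : ℝ) ^ α < (Real.pi * rhoc1 α * Rc1 α) ^ α := by
    refine Real.rpow_lt_rpow (by norm_num) ?_ h0
    rw [rhoc1_eq hα]
    have e : Real.pi * (2 * (1 + criticalRatio α) / Rc1 α) * Rc1 α =
      2 * (1 + criticalRatio α) * Real.pi := by field_simp
    rw [e]
    nlinarith [Real.pi_gt_three]
  rw [Real.mul_rpow (by positivity) hR.le, Real.mul_rpow hpi.le hρ.le] at h2
  have h4 : (4 : ℝ) ^ α = 2 ^ α * 2 ^ α := by
    rw [← Real.mul_rpow (by norm_num) (by norm_num)]; norm_num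
  have hpα : Real.pi ^ (1 - α) * Real.pi ^ α = Real.pi := by
    rw [← Real.rpow_add hpi]; norm_num
  have h5 : 2 ^ α * Real.pi ^ (1 - α) / rhoc1 α ^ α < V0 α / Real.pi * Rc1 α ^ α := by
    have h6 : Real.pi / 2 ^ α * Rc1 α ^ α ≤ V0 α / Real.pi * Rc1 α ^ α := by
      refine mul_le_mul_of_nonneg_right ?_ (by positivity)
      rw [le_div_iff₀ hpi]
      calc Real.pi / 2 ^ α * Real.pi = Real.pi ^ 2 / 2 ^ α := by ring
        _ ≤ V0 α := hV
    refine lt_of_lt_of_le ?_ h6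
    rw [div_mul_eq_mul_div, div_lt_div_iff₀ (by positivity) (by positivity)]
    calc 2 ^ α * Real.pi ^ (1 - α) * 2 ^ α = Real.pi ^ (1 - α) * 4 ^ α := by rw [h4]; ring
      _ < Real.pi ^ (1 - α) * (Real.pi ^ α * rhoc1 α ^ α * Rc1 α ^ α) := by gcongr
      _ = (Real.pi ^ (1 - α) * Real.pi ^ α) * Rc1 α ^ α * rhoc1 α ^ α := by ring
      _ = Real.pi * Rc1 α ^ α * rhoc1 α ^ α := by rw [hpα]
  rw [h1, ← mul_assoc]
  gcongr

theorem exists_unique_root_rho0 {α : ℝ} (h0 : 0 < α) (hα : α ≤ 1 / 2) :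
    ∃ R₀, Rc1 α < R₀ ∧ rho0 α R₀ = rhoc1 α ∧
      (∀ r, Rc1 α ≤ r → rho0 α r = rhoc1 α → r = R₀) ∧
      (∀ r, R₀ < r → rhoc1 α < rho0 α r) ∧
      ∀ r, Rc1 α ≤ r → rhoc1 α < rho0 α r → R₀ < r := by
  have hα2 : α < 2 := by linarith
  have hρ := rhoc1_pos hα2
  have hpi := Real.pi_pos
  exact exists_unique_root (by positivity) (by linarith) (Rc1_pos hα2) (rho0_Rc1_lt h0 hα2)

/-! ### Nonexistence -/

theorem IsMinimizer.congr {α m : ℝ} {Ω Ω' : Set Plane} (h : IsMinimizer α m Ω)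
    (hΩ : Ω' =ᵐ[volume] Ω) : IsMinimizer α m Ω' :=
  ⟨h.1.congr hΩ.symm, by rw [measure_congr hΩ, h.2.1], by rw [energy_congr α hΩ]; exact h.2.2⟩

/-- The lower bound for the energy of a minimizer. -/
theorem IsMinimizer.le_energy {α R : ℝ} {Ω : Set Plane} (h0 : 0 < α) (hα : α ≤ 1 / 2)
    (hΩ : MeasurableSet Ω) (hR : Rc1 α ≤ R) (h : IsMinimizer α (Real.pi * R ^ 2) Ω)
    (hE : energy α Ω ≠ ∞) :
    ENNReal.ofReal (rho0 α R * (Real.pi * R ^ 2)) ≤ energy α Ω := by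
  have hα2 : α < 2 := by linarith
  have hR1 := Rc1_pos hα2
  have hR0 : 0 < R := hR1.trans_le hR
  have hρ := rhoc1_pos hα2
  have hpi := Real.pi_pos
  set m := Real.pi * R ^ 2 with hm
  have hm0 : 0 < m := by positivity
  have hmc : mc1 α ≤ m := by
    rw [← pi_mul_Rc1_sq hα2, hm]
    gcongr
  -- With this d, the quantity m²/d^α is exactly m times the second term of ρ₀(R).
  have hV := h.le_interaction h0 (by linarith) hΩ hE hm0 (d := rhoc1 α * m / 2) (by positivity)
    (numerical_condition h0 hα hmc)
  have hP := isoperimetric_inequality hΩ (by rw [h.2.1]; exact ENNReal.ofReal_ne_top)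
  rw [h.2.1, ENNReal.ofReal_rpow_of_nonneg hm0.le (by norm_num),
    ← ENNReal.ofReal_mul (by positivity), ← Real.sqrt_eq_rpow] at hP
  have e1 : 2 * √Real.pi * √m = 2 / R * m := by
    rw [hm, Real.sqrt_mul hpi.le, Real.sqrt_sq hR0.le]
    field_simp
    rw [Real.sq_sqrt hpi.le]
  have e2 : m ^ 2 / (rhoc1 α * m / 2) ^ α =
      2 ^ α * Real.pi ^ (1 - α) / rhoc1 α ^ α * R ^ (2 - 2 * α) * m := by
    have h1 : m ^ (1 - α) = Real.pi ^ (1 - α) * R ^ (2 - 2 * α) := by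
      rw [hm, Real.mul_rpow hpi.le (by positivity), ← Real.rpow_natCast R 2,
        ← Real.rpow_mul hR0.le]
      congr 2; push_cast; ring
    have h2 : m ^ (1 - α) * m ^ α = m := by
      rw [← Real.rpow_add hm0]; norm_num
    have h3 : 0 < m ^ α := by positivity
    rw [Real.div_rpow (by positivity) two_pos.le, Real.mul_rpow hρ.le hm0.le]
    have h4 : 2 ^ α * Real.pi ^ (1 - α) / rhoc1 α ^ α * R ^ (2 - 2 * α) * m =
        2 ^ α * m ^ (1 - α) / rhoc1 α ^ α * m := by rw [h1]; ring
    rw [h4, eq_div_of_mul_eq h3.ne' h2]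
    field_simp
  calc ENNReal.ofReal (rho0 α R * m)
      = ENNReal.ofReal (2 / R * m) +
          ENNReal.ofReal (2 ^ α * Real.pi ^ (1 - α) / rhoc1 α ^ α * R ^ (2 - 2 * α) * m) := by
        rw [← ENNReal.ofReal_add (by positivity) (by positivity), rho0]
        ring_nf
    _ ≤ energy α Ω := by
        rw [← e1, ← e2]
        exact add_le_add hP hV

/-- The upper bound ρ_{c1}m and the lower bound ρ₀(R)m for the energy are incompatible when R > R₀.
-/
theorem not_exists_isMinimizer {α R₀ : ℝ} (h0 : 0 < α) (hα : α ≤ 1 / 2) (hR₀ : Rc1 α ≤ R₀)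
    (hroot : ∀ r, R₀ < r → rhoc1 α < rho0 α r) {m : ℝ} (hm : Real.pi * R₀ ^ 2 < m) :
    ¬ ∃ Ω : Set Plane, IsMinimizer α m Ω := by
  rintro ⟨Ω, hΩ⟩
  have hα2 : α < 2 := by linarith
  have hR := Rc1_pos hα2
  have hpi := Real.pi_pos
  have hm0 : 0 < m := lt_of_le_of_lt (by positivity) hm
  set R := √(m / Real.pi) with hRdef
  have hRm : Real.pi * R ^ 2 = m := by
    rw [hRdef, Real.sq_sqrt (by positivity)]; field_simp
  have hR₀R : R₀ < R := by
    rw [← hRm] at hm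
    exact lt_of_pow_lt_pow_left₀ 2 (Real.sqrt_nonneg _) (lt_of_mul_lt_mul_left hm hpi.le)
  obtain ⟨Ω', -, hΩ'm, hΩ'⟩ := hΩ.1.exists_measurable_superset_ae_eq
  have hmin := hΩ.congr hΩ'
  have hmc : mc1 α ≤ m := by
    rw [← pi_mul_Rc1_sq hα2, ← hRm]
    gcongr
    exact hR₀.trans hR₀R.le
  have h1 := hmin.energy_le h0 (by linarith) hmc
  have hE : energy α Ω' ≠ ∞ := ne_top_of_le_ne_top ENNReal.ofReal_ne_top h1
  rw [← hRm] at hmin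
  have h2 := (hmin.le_energy h0 hα hΩ'm (hR₀.trans hR₀R.le) hE).trans h1
  rw [hRm] at h2
  have hρ := rhoc1_pos hα2
  rw [ENNReal.ofReal_le_ofReal_iff (by positivity)] at h2
  exact absurd (le_of_mul_le_mul_right h2 hm0) (not_le.2 (hroot R hR₀R))

/-! ### The limit of small exponents -/

theorem continuousAt_criticalRatio : ContinuousAt criticalRatio 0 := by
  unfold criticalRatio
  refine continuousAt_const.div (continuousAt_const.sub ?_) (one_sub_rpow_pos two_pos).ne'
  exact (Real.continuousAt_const_rpow two_ne_zero).comp (by fun_prop)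

theorem continuousAt_criticalBase : ContinuousAt criticalBase 0 := by
  have hΓ {f : ℝ → ℝ} (hf : Continuous f) (h0 : 0 < f 0) :
      ContinuousAt (fun α => Real.Gamma (f α)) 0 := by
    refine ContinuousAt.comp (g := Real.Gamma) ?_ hf.continuousAt
    refine (Real.differentiableAt_Gamma fun n => ?_).continuousAt
    have : (0 : ℝ) ≤ n := n.cast_nonneg
    linarith
  have hrpow : ContinuousAt (fun α : ℝ => (2 : ℝ) ^ ((α - 2) / 2)) 0 :=
    (Real.continuousAt_const_rpow two_ne_zero).comp (by fun_prop)
  have h4 := one_sub_rpow_pos two_pos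
  have h5 : 0 < Real.Gamma (2 - 0) := Real.Gamma_pos_of_pos (by norm_num)
  have h6 := Real.pi_pos
  unfold criticalBase
  refine ((continuousAt_const.mul (hΓ (by fun_prop) (by norm_num))).mul
    (hΓ (by fun_prop) (by norm_num))).div ((continuousAt_const.mul
      (continuousAt_const.sub hrpow)).mul (hΓ (by fun_prop) (by norm_num))) ?_
  positivity

theorem continuousAt_mc1 : ContinuousAt mc1 0 := by
  refine continuousAt_const.mul (continuousAt_criticalBase.rpow ?_
    (Or.inl (criticalBase_pos two_pos).ne'))
  exact continuousAt_const.div (by fun_prop) (by norm_num)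

theorem continuousAt_Rc1 : ContinuousAt Rc1 0 :=
  (continuousAt_mc1.div_const _).sqrt

theorem continuousAt_rhoc1 : ContinuousAt rhoc1 0 := by
  have h : ContinuousAt (fun α => 2 * (1 + criticalRatio α) / Rc1 α) 0 :=
    (continuousAt_const.mul (continuousAt_const.add continuousAt_criticalRatio)).div
      continuousAt_Rc1 (Rc1_pos two_pos).ne'
  refine h.congr ?_
  filter_upwards [Iio_mem_nhds (two_pos (α := ℝ))] with α hα using (rhoc1_eq hα).symm

theorem continuousAt_rho0 {r : ℝ} (hr : 0 < r) : ContinuousAt (fun α => rho0 α r) 0 := by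
  have hρ := rhoc1_pos two_pos
  unfold rho0
  refine continuousAt_const.add (((ContinuousAt.mul ?_ ?_).div
    (continuousAt_rhoc1.rpow continuousAt_id (Or.inl hρ.ne')) ?_).mul ?_)
  · exact Real.continuousAt_const_rpow two_ne_zero
  · exact (Real.continuousAt_const_rpow Real.pi_pos.ne').comp (by fun_prop)
  · simp
  · exact (Real.continuousAt_const_rpow hr.ne').comp (by fun_prop)

/-- At α = 0 both sides are values of 2/r + πr², which increases once πr³ ≥ 1; and πR_{c1}³ =
4(√2-1) > 1. -/
theorem rhoc1_zero_lt_rho0_zero {r : ℝ} (hr : Rc1 0 < r) : rhoc1 0 < rho0 0 r := by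
  have hR := Rc1_pos two_pos
  have hpi := Real.pi_pos
  have hr0 := hR.trans hr
  have hs : 1.414 ≤ √2 := Real.le_sqrt_of_sq_le (by norm_num)
  have hbase : Real.pi * Rc1 0 ^ (3 - 0 : ℝ) = 4 * (√2 - 1) := by
    rw [Rc1_rpow two_pos, criticalBase]
    norm_num [Real.Gamma_two]
    field_simp
    norm_num
  have hq : criticalRatio 0 = 2 * (√2 - 1) := by
    rw [criticalRatio]
    norm_num
    ring
  rw [sub_zero, show (3 : ℝ) = ((3 : ℕ) : ℝ) by norm_num, Real.rpow_natCast] at hbase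
  rw [rhoc1_eq two_pos, hq, rho0]
  norm_num
  set R := Rc1 0
  have e1 : 2 * (1 + 2 * (√2 - 1)) / R = 2 / R + Real.pi * R ^ 2 := by
    field_simp
    linarith
  rw [e1]
  have e2 : 2 / r + Real.pi * r ^ 2 - (2 / R + Real.pi * R ^ 2) =
      (r - R) * (Real.pi * (r + R) - 2 / (R * r)) := by
    field_simp
    ring
  have e3 : 2 / (R * r) < Real.pi * (r + R) := by
    rw [div_lt_iff₀ (by positivity)]
    have h1 : R ^ 3 ≤ R * r * r := by nlinarith [mul_pos hR hr0]
    have h2 : R ^ 3 ≤ R * r * R := by nlinarith [mul_pos hR hr0, mul_pos hR hR]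
    nlinarith
  have := mul_pos (sub_pos.2 hr) (sub_pos.2 e3)
  linarith

/-- No continuity of the root is needed. Below it is bounded by R_{c1}(α); above, the strict
inequality ρ_{c1} < ρ₀(b) at α = 0 persists for small α whenever b > R_{c1}(0), and forces the root
below b. -/
theorem tendsto_root {R₀ : ℝ → ℝ} (hge : ∀ α, 0 < α → α ≤ 1 / 2 → Rc1 α ≤ R₀ α)
    (hlt : ∀ α, 0 < α → α ≤ 1 / 2 → ∀ r, Rc1 α ≤ r → rhoc1 α < rho0 α r → R₀ α < r) :
    Tendsto R₀ (𝓝[>] 0) (𝓝 (Rc1 0)) := by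
  have hsmall : ∀ᶠ α : ℝ in 𝓝[>] 0, 0 < α ∧ α ≤ 1 / 2 :=
    Ioc_mem_nhdsGT (by norm_num)
  refine tendsto_order.2 ⟨fun a ha => ?_, fun b hb => ?_⟩
  · have h1 : ∀ᶠ α in 𝓝[>] (0 : ℝ), a < Rc1 α :=
      nhdsWithin_le_nhds (continuousAt_Rc1.eventually (lt_mem_nhds ha))
    filter_upwards [hsmall, h1] with α hα h using h.trans_le (hge α hα.1 hα.2)
  · have h1 : ∀ᶠ α in 𝓝[>] (0 : ℝ), Rc1 α < b :=
      nhdsWithin_le_nhds (continuousAt_Rc1.eventually (gt_mem_nhds hb))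
    have h2 : ∀ᶠ α in 𝓝[>] (0 : ℝ), rhoc1 α < rho0 α b :=
      nhdsWithin_le_nhds (continuousAt_rhoc1.eventually_lt
        (continuousAt_rho0 ((Rc1_pos two_pos).trans hb)) (rhoc1_zero_lt_rho0_zero hb))
    filter_upwards [hsmall, h1, h2] with α hα h h' using hlt α hα.1 hα.2 b h.le h'

end NonlocalIsoperimetric

theorem proposition4p2 :
    ∃ R₀ : ℝ → ℝ,
      -- `R₀ α` is the unique root of `ρ₀ = ρ_{c1}` in `[R_{c1}, ∞)`
      (∀ α : ℝ, 0 < α → α ≤ 1 / 2 →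
        NonlocalIsoperimetric.Rc1 α ≤ R₀ α ∧
        NonlocalIsoperimetric.rho0 α (R₀ α) = NonlocalIsoperimetric.rhoc1 α ∧
        ∀ R : ℝ, NonlocalIsoperimetric.Rc1 α ≤ R →
          NonlocalIsoperimetric.rho0 α R = NonlocalIsoperimetric.rhoc1 α → R = R₀ α) ∧
      -- nonexistence for every mass `m > m₂(α) = π R₀²`
      (∀ α : ℝ, 0 < α → α ≤ 1 / 2 → ∀ m : ℝ, Real.pi * R₀ α ^ 2 < m →
        ¬ ∃ Ω : Set NonlocalIsoperimetric.Plane, NonlocalIsoperimetric.IsMinimizer α m Ω) ∧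
      -- `m₂(α) → m_{c1}(0)` as `α → 0`
      Tendsto (fun α : ℝ => Real.pi * R₀ α ^ 2) (𝓝[>] 0)
        (𝓝 (NonlocalIsoperimetric.mc1 0)) := by
  classical
  choose! R₀ h1 h2 h3 h4 h5 using fun (α : ℝ) (h : 0 < α ∧ α ≤ 1 / 2) =>
    NonlocalIsoperimetric.exists_unique_root_rho0 h.1 h.2
  refine ⟨R₀, fun α h0 hα => ⟨(h1 α ⟨h0, hα⟩).le, h2 α ⟨h0, hα⟩, h3 α ⟨h0, hα⟩⟩,
    fun α h0 hα m hm => ?_, ?_⟩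
  · exact NonlocalIsoperimetric.not_exists_isMinimizer h0 hα (h1 α ⟨h0, hα⟩).le (h4 α ⟨h0, hα⟩) hm
  · rw [← NonlocalIsoperimetric.pi_mul_Rc1_sq two_pos]
    exact ((NonlocalIsoperimetric.tendsto_root (fun α h0 hα => (h1 α ⟨h0, hα⟩).le)
      fun α h0 hα => h5 α ⟨h0, hα⟩).pow 2).const_mul _
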